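/- **Setting.** Let $(S,A,P_{\rm env},r)$ be a finite Markov decision process with a fixed policy $\pi$. Put $P(s'\mid s)=\sum_a P_{\rm env}(s'\mid s,a)\pi(a\mid s)$, $r_s=\sum_a\pi(a\mid s)r(s,a)$, $R=(r_s)_{s\in S}$, $r_{\max}=\max_{s,a}|r(s,a)|$. Let $d\ge 1$ and let $\Phi\in\mathbb R^{S\times d}$ be a feature matrix with linearly independent columns whose rows $\phi(s)^\top$ satisfy $\|\phi(s)\|\le 1$. Assume that the Markov chain with transition matrix $P$ is irreducible and aperiodic. Then it has a unique stationary distribution $\mu$, $\mu(s)>0$ for all $s$, and there are constants $C>1$, $\beta\in[0,1)$ with $$\|p_\tau(\cdot\mid s)-\mu\|_1\le C\beta^\tau\qquad(\tau\ge 0,\ s\in S),\tag{1}$$ where $p_\tau(\cdot\mid s)$ is the law of the chain after $\tau$ steps from $s$; moreover $$\eta=\min_{\|x\|=1}\Big(\tfrac12\sum_{s,s'}\mu(s)P(s'\mid s)\big((\Phi x)(s)-(\Phi x)(s')\big)^2+(\mu^\top\Phi x)^2\Big)>0,$$ and, with $D=\mathrm{diag}(\mu)$ and $\Pi=I-e\mu^\top$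 ($e$ the all-ones vector), the linear system $\Phi^\top D(I-\Pi P)\Phi\theta^*=\Phi^\top D\Pi R$ has a unique solution $\theta^*$. Fix any $C,\beta$ as in (1) and put $L_1=\max\{1,\frac{\log C+1}{\log(1/\beta)}\}$ (so $L_1=1$ if $\beta=0$) and $\tau_{\rm mix}(\alpha)=\min\{\tau\in\mathbb N: C\beta^\tau\le\alpha\}$. **Algorithm.** Let $(s_t)_{t\ge0}$ and $(\hat s_t)_{t\ge0}$ be two independent Markov chains with transition matrix $P$ (arbitrary initial distributions), and let $\theta_0$ be a square-integrable random vector independent of them (for instance deterministic). The double-chain method with stepsizes $\alpha_t=a/(t+c_0)^\xi$, $a>0$, $\xi\in(0,1]$, is $$\theta_{t+1}=\theta_t+\alpha_t\Big(-\big(r_{s_t}+\phi(s_t)^\top\theta_t\big)\phi(\hat s_t)+\big(r_{s_t}+\phi(s_{t+1})^\top\theta_t-\phi(s_t)^\top\theta_t\big)\phi(s_t)\Big).$$ Put $$\beta_1=2\,\mathbb E\big(\|\theta_0\|+r_{\max}+2\|\theta^*\|\big)^2+2\,\mathbb E\|\theta_0-\theta^*\|^2,\quad \beta_2=946\,(r_{\max}+3\|\theta^*\|)^2,\quad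 \tilde\beta(T)=2L_1\beta_2\big(\log(T+c_0)-\log a+1\big).$$ **Theorem.** There are an absolute constant $K_0>0$ and a function $c_{\min}(a,\xi,\eta,C,\beta)>0$ such that the following holds. *(Error bounds.)* If $c_0\ge c_{\min}(a,\xi,\eta,C,\beta)$, then for every $T$ with $T\ge\tau_{\rm mix}:=\tau_{\rm mix}(\alpha_T)$ the vector $\theta_T$ is square integrable and: 1. if $\xi=1$, $$\mathbb E\|\theta_T-\theta^*\|^2\le\beta_1\Big(\frac{\tau_{\rm mix}+c_0}{T+c_0}\Big)^{a\eta}+\frac{\Gamma(T)}{(T+c_0)^{\min\{1,a\eta\}}},\qquad \Gamma(T)=\begin{cases}\frac{4a^2}{1-a\eta}\tilde\beta(T),&a\eta<1,\\ 4a^2\log(T+c_0)\,\tilde\beta(T),&a\eta=1,\\ \frac{4\mathrm e\,a^2}{a\eta-1}\tilde\beta(T),&a\eta>1;\end{cases}$$ 2. if $\xi\in(0,1)$, with $\Delta_T=(T+c_0)^{1-\xi}-(\tau_{\rm mix}+c_0)^{1-\xi}$, $$\mathbb E\|\theta_T-\theta^*\|^2\le\beta_1\exp\Big(-\frac{\eta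 a}{1-\xi}\Delta_T\Big)+\frac{2a\tilde\beta(T)}{\eta(T+c_0)^\xi},$$ and also, without the logarithmic factor, $$\mathbb E\|\theta_T-\theta^*\|^2\le\beta_1\exp\Big(-\frac{\eta a}{1-\xi}\Delta_T\Big)+K_0L_1(r_{\max}+3\|\theta^*\|)^2\,\frac{a}{\eta(T+c_0)^\xi}.$$ *(Sample complexity for $a=\Theta(1/\eta)$.)* Let $\xi\in(0,1]$ and $0<\kappa_1\le\kappa_2$, with $\kappa_1\ge1$ if $\xi=1$. There are $K,p>0$ depending only on $\xi,\kappa_1,\kappa_2$ such that, whenever $\kappa_1/\eta\le a\le\kappa_2/\eta$, there is a choice of $c_0\ge c_{\min}(a,\xi,\eta,C,\beta)$, depending only on $\xi,\kappa_1,\kappa_2,a,\eta,C,\beta$, for which, for every $\varepsilon\in(0,1)$ and every $$T\ge K\Big(L_1(1+\rho)\big(1+\log\tfrac1\varepsilon+\log(1+\tfrac1\eta)\big)\Big)^p\,\varepsilon^{-1/\xi}\,\eta^{-2/\xi},\qquad \rho=\big(\mathbb E\|\theta_0-\theta^*\|^2\big)^{1/2}+r_{\max}+\|\theta^*\|,$$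 one has $T\ge\tau_{\rm mix}(\alpha_T)$ and $\mathbb E\|\theta_T-\theta^*\|^2\le\varepsilon$. That is, the sample complexity is $\tilde O(\varepsilon^{-1/\xi}\eta^{-2/\xi})$, which is $\tilde O(\varepsilon^{-1}\eta^{-2})$ for $\xi=1$. -/

import Mathlib

open MeasureTheory ProbabilityTheory

universe u v w

noncomputable section

namespace AvgRewardTD

/-- A finite Markov decision process `(S, A, P_env, r)`, a fixed policy, and a feature map with
values in `ℝ^d`. The features are normalized and the columns of the feature matrix are linearly
independent. -/
structure PolicyEvaluation (S : Type u) (A : Type v) [Fintype S] [Fintype A] (d : ℕ) where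
  /-- `Penv s a s'` is the probability of moving from `s` to `s'` under the action `a`. -/
  Penv : S → A → S → ℝ
  Penv_nonneg : ∀ s a s', 0 ≤ Penv s a s'
  Penv_sum : ∀ s a, ∑ s', Penv s a s' = 1
  /-- the reward function -/
  r : S → A → ℝ
  /-- `pol s a` is the probability of taking the action `a` in the state `s`. -/
  pol : S → A → ℝ
  pol_nonneg : ∀ s a, 0 ≤ pol s a
  pol_sum : ∀ s, ∑ a, pol s a = 1
  /-- the feature vector of a state -/
  φ : S → EuclideanSpace ℝ (Fin d)
  norm_φ_le : ∀ s, ‖φ s‖ ≤ 1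
  φ_columns : LinearIndependent ℝ (fun (j : Fin d) (s : S) => φ s j)

/-- Aperiodicity: for every state, `1` is the greatest common divisor of the possible return
times. -/
def IsAperiodic {S : Type u} [Fintype S] [DecidableEq S] (P : Matrix S S ℝ) : Prop :=
  ∀ s : S, ∀ k : ℕ, (∀ n : ℕ, 0 < n → 0 < (P ^ n) s s → k ∣ n) → k = 1

/-- The probability vector `μ` is a stationary distribution of `P`. -/
def IsStationaryDist {S : Type u} [Fintype S] (P : Matrix S S ℝ) (μ : S → ℝ) : Prop :=
  μ ∈ stdSimplex ℝ S ∧ Matrix.vecMul μ P = μ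

/-- `C > 1` and `β ∈ [0,1)` are geometric mixing constants:
`‖p_τ(· | s) - μ‖₁ ≤ C β^τ` for all `τ` and `s`. -/
def IsMixing {S : Type u} [Fintype S] [DecidableEq S] (P : Matrix S S ℝ) (μ : S → ℝ)
    (C β : ℝ) : Prop :=
  1 < C ∧ 0 ≤ β ∧ β < 1 ∧ ∀ (τ : ℕ) (s : S), ∑ s', |(P ^ τ) s s' - μ s'| ≤ C * β ^ τ

namespace PolicyEvaluation

variable {S : Type u} {A : Type v} [Fintype S] [Fintype A] {d : ℕ}

/-- The transition matrix induced by the policy; `M.P s s'` is `P(s' | s)`. -/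
def P (M : PolicyEvaluation S A d) : Matrix S S ℝ :=
  Matrix.of fun s s' => ∑ a, M.Penv s a s' * M.pol s a

/-- The expected reward `r_s` in the state `s` under the policy. -/
def R (M : PolicyEvaluation S A d) (s : S) : ℝ := ∑ a, M.pol s a * M.r s a

/-- `r_max = max_{s,a} |r(s,a)|`. -/
def rmax (M : PolicyEvaluation S A d) : ℝ := ⨆ p : S × A, |M.r p.1 p.2|

/-- The feature matrix, with rows `φ(s)ᵀ`. -/
def Φ (M : PolicyEvaluation S A d) : Matrix S (Fin d) ℝ := Matrix.of fun s j => M.φ s j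

/-- The squared Dirichlet seminorm. -/
def dirichletSq (M : PolicyEvaluation S A d) (μ : S → ℝ) (f : S → ℝ) : ℝ :=
  (1 / 2) * ∑ s, ∑ s', μ s * M.P s s' * (f s - f s') ^ 2

/-- The condition number `η = min_{‖x‖ = 1} ‖Φ x‖²_Dir + (μᵀ Φ x)²`. -/
def eta (M : PolicyEvaluation S A d) (μ : S → ℝ) : ℝ :=
  sInf ((fun x : EuclideanSpace ℝ (Fin d) =>
    M.dirichletSq μ (M.Φ.mulVec x) + (μ ⬝ᵥ M.Φ.mulVec x) ^ 2) '' Metric.sphere 0 1)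

/-- `Π = I - e μᵀ`. -/
def proj [DecidableEq S] (μ : S → ℝ) : Matrix S S ℝ := 1 - Matrix.vecMulVec 1 μ

/-- `θ` solves `Φᵀ D (I - Π P) Φ θ = Φᵀ D Π R`, where `D = diag(μ)`. -/
def IsFixedPoint [DecidableEq S] (M : PolicyEvaluation S A d) (μ : S → ℝ)
    (θ : EuclideanSpace ℝ (Fin d)) : Prop :=
  (M.Φ.transpose * Matrix.diagonal μ * (1 - proj μ * M.P) * M.Φ).mulVec θ =
    (M.Φ.transpose * Matrix.diagonal μ * proj μ).mulVec M.R

/-- `f(s, ŝ, θ) = -(r_s + φ(s)ᵀ θ) φ(ŝ)`. -/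
def f (M : PolicyEvaluation S A d) (s sHat : S) (θ : EuclideanSpace ℝ (Fin d)) :
    EuclideanSpace ℝ (Fin d) :=
  (-(M.R s + inner ℝ (M.φ s) θ)) • M.φ sHat

/-- `g(s, s', θ) = (r_s + φ(s')ᵀ θ - φ(s)ᵀ θ) φ(s)`. -/
def g (M : PolicyEvaluation S A d) (s s' : S) (θ : EuclideanSpace ℝ (Fin d)) :
    EuclideanSpace ℝ (Fin d) :=
  (M.R s + inner ℝ (M.φ s') θ - inner ℝ (M.φ s) θ) • M.φ s

/-- The iterates of the double-chain algorithm with stepsizes `α`, driven by the two state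
sequences `s` and `sHat`; under Markov sampling the successor of `s_t` is `s_{t+1}`. -/
def iterate (M : PolicyEvaluation S A d) {Ω : Type w} (α : ℕ → ℝ) (s sHat : ℕ → Ω → S)
    (θ₀ : Ω → EuclideanSpace ℝ (Fin d)) : ℕ → Ω → EuclideanSpace ℝ (Fin d)
  | 0, ω => θ₀ ω
  | t + 1, ω =>
    M.iterate α s sHat θ₀ t ω +
      α t • (M.f (s t ω) (sHat t ω) (M.iterate α s sHat θ₀ t ω) +
        M.g (s t ω) (s (t + 1) ω) (M.iterate α s sHat θ₀ t ω))

end PolicyEvaluation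

/-- `s` is a time-homogeneous Markov chain with transition matrix `P` under `Pr`, started from an
arbitrary initial distribution. -/
def IsMarkovChain {S : Type u} [MeasurableSpace S] {Ω : Type w} [MeasurableSpace Ω]
    (P : Matrix S S ℝ) (Pr : Measure Ω) (s : ℕ → Ω → S) : Prop :=
  (∀ t, Measurable (s t)) ∧
    ∀ (n : ℕ) (x : ℕ → S),
      Pr {ω | ∀ i ≤ n + 1, s i ω = x i} =
        Pr {ω | ∀ i ≤ n, s i ω = x i} * ENNReal.ofReal (P (x n) (x (n + 1)))

/-- Markov sampling for the double-chain algorithm: `s` and `sHat` are independent Markov chains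
with transition matrix `P`, and the square-integrable initial parameter `θ₀` (for instance a
constant) is independent of them. -/
structure IsDoubleChain {S : Type u} [MeasurableSpace S] {Ω : Type w} [MeasurableSpace Ω] {d : ℕ}
    (P : Matrix S S ℝ) (Pr : Measure Ω) (s sHat : ℕ → Ω → S)
    (θ₀ : Ω → EuclideanSpace ℝ (Fin d)) : Prop where
  chain : IsMarkovChain P Pr s
  chainHat : IsMarkovChain P Pr sHat
  indep : IndepFun (fun ω t => s t ω) (fun ω t => sHat t ω) Pr
  measurable_init : Measurable θ₀
  memLp_init : MemLp θ₀ 2 Pr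
  indep_init : IndepFun θ₀ (fun ω => ((fun t => s t ω), (fun t => sHat t ω))) Pr

/-- The random vector `X` is square integrable and `E ‖X‖² ≤ b`. -/
def MeanSquareLE {Ω : Type w} [MeasurableSpace Ω] {d : ℕ} (Pr : Measure Ω)
    (X : Ω → EuclideanSpace ℝ (Fin d)) (b : ℝ) : Prop :=
  MemLp X 2 Pr ∧ ∫ ω, ‖X ω‖ ^ 2 ∂Pr ≤ b

/-- The stepsize `α_t = a / (t + c₀)^ξ`. -/
def stepsize (a c₀ ξ : ℝ) (t : ℕ) : ℝ := a / ((t : ℝ) + c₀) ^ ξ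

/-- The mixing time `τ_mix(α) = min {τ | C β^τ ≤ α}`. -/
def tauMix (C β α : ℝ) : ℕ := sInf {τ : ℕ | C * β ^ τ ≤ α}

/-- `L₁ = max {1, (log C + 1) / log (1/β)}`. For `β = 0` this is `1`, in accordance with
`log (1/0) = ∞`. -/
def L1 (C β : ℝ) : ℝ := max 1 ((Real.log C + 1) / Real.log (1 / β))

/-- `β₁ = 2 E (‖θ₀‖ + r_max + 2 ‖θ*‖)² + 2 E ‖θ₀ - θ*‖²`. -/
def beta1 {Ω : Type w} [MeasurableSpace Ω] {d : ℕ} (Pr : Measure Ω)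
    (θ₀ : Ω → EuclideanSpace ℝ (Fin d)) (rmax : ℝ) (θs : EuclideanSpace ℝ (Fin d)) : ℝ :=
  2 * ∫ ω, (‖θ₀ ω‖ + rmax + 2 * ‖θs‖) ^ 2 ∂Pr + 2 * ∫ ω, ‖θ₀ ω - θs‖ ^ 2 ∂Pr

/-- `β₂ = 946 (r_max + 3 ‖θ*‖)²`. -/
def beta2 {d : ℕ} (rmax : ℝ) (θs : EuclideanSpace ℝ (Fin d)) : ℝ := 946 * (rmax + 3 * ‖θs‖) ^ 2

/-- `2 L₁ β₂ (log (T + c₀) - log a + 1)`, where `L = L₁` and `b₂ = β₂`. -/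
def betaTilde (a c₀ L b₂ : ℝ) (T : ℕ) : ℝ :=
  2 * L * b₂ * (Real.log ((T : ℝ) + c₀) - Real.log a + 1)

/-- The coefficient `Γ(T)` of the second term in the case `ξ = 1`. -/
def Gam (a c₀ η L b₂ : ℝ) (T : ℕ) : ℝ :=
  if a * η < 1 then 4 * a ^ 2 / (1 - a * η) * betaTilde a c₀ L b₂ T
  else if a * η = 1 then 4 * a ^ 2 * Real.log ((T : ℝ) + c₀) * betaTilde a c₀ L b₂ T
  else 4 * Real.exp 1 * a ^ 2 / (a * η - 1) * betaTilde a c₀ L b₂ T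

/-- The number of iterations
`K (L₁ (1 + ρ) (1 + log (1/ε) + log (1 + 1/η)))^p ε^{-1/ξ} η^{-2/ξ}`: it is
`Õ(ε^{-1/ξ} η^{-2/ξ})`, with a polynomial dependence on the size `ρ` of the problem. -/
def sampleBound (K p ξ η L ρ ε : ℝ) : ℝ :=
  K * (L * (1 + ρ) * (1 + Real.log (1 / ε) + Real.log (1 + 1 / η))) ^ p *
    ε ^ (-1 / ξ) * η ^ (-2 / ξ)

end AvgRewardTD

end

open AvgRewardTD

/-!
The Dirichlet form of an irreducible chain vanishes only on constants, so `η > 0`, and `-η` is a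
one-sided Lipschitz constant of the mean update direction, whose zero is `θ*`. The noise of the
update direction is Markovian, driven by the pair chain, which mixes as fast as `P`. Summing its
conditional means along the pair chain solves a Poisson equation with a solution of size `O(L₁)`;
adding `2 α_t ⟪θ_t - θ*, ·⟫` of this solution to `‖θ_t - θ*‖²` gives a Lyapunov function that
contracts by the factor `1 - η α_t` up to an error of order `L₁ (α_t² + α_t - α_{t+1})`. The
resulting scalar recursion is compared with explicit supersolutions. The contraction holds from the
start, so any index may stand in place of `τ_mix`.
-/

namespace AvgRewardTD

section FiniteMarkovChains

open Matrix

variable {S : Type*} [Fintype S] [DecidableEq S] {P : Matrix S S ℝ} {μ ν : S → ℝ}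

lemma pow_add_apply_pos {R : Type*} [Ring R] [LinearOrder R] [IsStrictOrderedRing R]
    {Q : Matrix S S R} (hQ : ∀ i j, 0 ≤ Q i j) {m n : ℕ} {i j k : S}
    (hij : 0 < (Q ^ m) i j) (hjk : 0 < (Q ^ n) j k) : 0 < (Q ^ (m + n)) i k := by
  rw [pow_add, mul_apply]
  exact Finset.sum_pos'
    (fun l _ => mul_nonneg (pow_apply_nonneg hQ m i l) (pow_apply_nonneg hQ n l k))
    ⟨j, Finset.mem_univ j, mul_pos hij hjk⟩

lemma IsAperiodic.exists_forall_ge_pow_apply_self_pos (hap : IsAperiodic P)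
    (hP : ∀ i j, 0 ≤ P i j) (i : S) : ∃ N, ∀ n ≥ N, 0 < (P ^ n) i i := by
  set returnTimes : Set ℕ := {n : ℕ | 0 < n ∧ 0 < (P ^ n) i i}
  have hgcd : Nat.setGcd returnTimes = 1 :=
    hap i _ fun n hn hpos => Nat.setGcd_dvd_of_mem ⟨hn, hpos⟩
  obtain ⟨N, hN⟩ := Nat.exists_mem_closure_of_ge returnTimes
  refine ⟨N, fun n hn => ?_⟩
  have hmem : n ∈ AddSubmonoid.closure returnTimes := hN n hn (by simp [hgcd])
  clear hn
  induction hmem using AddSubmonoid.closure_induction with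
  | mem n hn => exact hn.2
  | zero => simp
  | add m n _ _ hm hn => exact pow_add_apply_pos hP hm hn

lemma IsAperiodic.isPrimitive (hap : IsAperiodic P) (hirr : P.IsIrreducible) : P.IsPrimitive := by
  choose n hn using hap.exists_forall_ge_pow_apply_self_pos hirr.nonneg
  choose k _ hk using (isIrreducible_iff_exists_pow_pos hirr.nonneg).1 hirr
  set K := ∑ i, ∑ j, k i j
  set N := ∑ i, n i
  refine ⟨hirr.nonneg, N + K + 1, by omega, fun i j => ?_⟩
  have hkK : k i j ≤ K :=
    (Finset.single_le_sum_of_canonicallyOrdered (f := k i) (Finset.mem_univ j)).trans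
      (Finset.single_le_sum_of_canonicallyOrdered (f := fun i => ∑ j, k i j) (Finset.mem_univ i))
  have hnN : n i ≤ N := Finset.single_le_sum_of_canonicallyOrdered (Finset.mem_univ i)
  rw [show N + K + 1 = (N + K + 1 - k i j) + k i j by omega]
  exact pow_add_apply_pos hirr.nonneg (hn i _ (by omega)) (hk i j)

lemma apply_eq_of_pow_apply_pos {X : Type*} {f : S → X} (hP : ∀ i j, 0 ≤ P i j)
    (hf : ∀ i j, 0 < P i j → f i = f j) (n : ℕ) {i j : S} (hij : 0 < (P ^ n) i j) : f i = f j := by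
  induction n generalizing j with
  | zero =>
    obtain rfl | hne := eq_or_ne i j
    · rfl
    · simp [one_apply_ne hne] at hij
  | succ n ih =>
    rw [pow_succ, mul_apply] at hij
    obtain ⟨k, -, hk⟩ := Finset.exists_lt_of_sum_lt
      ((Finset.sum_const_zero (s := Finset.univ)).trans_lt hij)
    exact (ih (pos_of_mul_pos_left hk (hP k j))).trans
      (hf k j (pos_of_mul_pos_right hk (pow_apply_nonneg hP n i k)))

lemma IsStationaryDist.vecMul_pow (hμ : IsStationaryDist P μ) (n : ℕ) : μ ᵥ* (P ^ n) = μ := by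
  induction n with
  | zero => simp
  | succ n ih => rw [pow_succ, ← vecMul_vecMul, ih, hμ.2]

lemma sum_vecMul_of_mem_rowStochastic (hP : P ∈ rowStochastic ℝ S) (w : S → ℝ) :
    ∑ j, (w ᵥ* P) j = ∑ i, w i := by
  simp only [← dotProduct_one, ← dotProduct_mulVec, one_vecMul_of_mem_rowStochastic hP]

lemma vecMul_eq_self_of_le_vecMul (hP : P ∈ rowStochastic ℝ S) {w : S → ℝ} (hw : w ≤ w ᵥ* P) :
    w ᵥ* P = w :=
  funext fun j => ((Finset.sum_eq_sum_iff_of_le fun j _ => hw j).1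
    (sum_vecMul_of_mem_rowStochastic hP w).symm j (Finset.mem_univ j)).symm

-- If `v` is a left eigenvector for the eigenvalue `1`, then so is `|v|`.
lemma exists_isStationaryDist [Nonempty S] (hP : P ∈ rowStochastic ℝ S) :
    ∃ μ, IsStationaryDist P μ := by
  have hdet : (1 - P).det = 0 := exists_mulVec_eq_zero_iff.1
    ⟨1, one_ne_zero, by rw [sub_mulVec, one_vecMul_of_mem_rowStochastic hP, one_mulVec, sub_self]⟩
  obtain ⟨v, hv0, hv⟩ := exists_vecMul_eq_zero_iff.2 hdet
  have hvP : v ᵥ* P = v := by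
    rwa [vecMul_sub, vecMul_one, sub_eq_zero, eq_comm] at hv
  have habs : |v| ≤ |v| ᵥ* P := fun j =>
    calc |v j| = |∑ i, v i * P i j| := congrArg abs (congrFun hvP j).symm
      _ ≤ ∑ i, |v i * P i j| := Finset.abs_sum_le_sum_abs _ _
      _ = (|v| ᵥ* P) j := by
        simp only [vecMul, dotProduct, Pi.abs_apply, abs_mul, abs_of_nonneg (hP.1 _ _)]
  have hpos : 0 < ∑ j, |v| j := by
    obtain ⟨i, hi⟩ := Function.ne_iff.1 hv0
    exact Finset.sum_pos' (fun _ _ => abs_nonneg _) ⟨i, Finset.mem_univ _, abs_pos.2 hi⟩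
  refine ⟨(∑ j, |v| j)⁻¹ • |v|, ⟨fun i => mul_nonneg (inv_nonneg.2 hpos.le) (abs_nonneg _), ?_⟩, ?_⟩
  · simp only [Pi.smul_apply, smul_eq_mul, ← Finset.mul_sum, inv_mul_cancel₀ hpos.ne']
  · rw [smul_vecMul, vecMul_eq_self_of_le_vecMul hP habs]

lemma IsStationaryDist.pos (hμ : IsStationaryDist P μ) (hP : P.IsPrimitive) (s : S) : 0 < μ s := by
  obtain ⟨N, -, hN⟩ := hP.exists_pos_pow
  obtain ⟨i, -, hi⟩ := Finset.exists_ne_zero_of_sum_ne_zero (hμ.1.2.trans_ne one_ne_zero)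
  rw [← hμ.vecMul_pow N]
  exact Finset.sum_pos' (fun j _ => mul_nonneg (hμ.1.1 j) (hN j s).le)
    ⟨i, Finset.mem_univ i, mul_pos ((hμ.1.1 i).lt_of_ne' hi) (hN i s)⟩

-- Doeblin's minorization: subtracting the constant `δ` from `P` does not change `w ᵥ* P`.
lemma sum_abs_vecMul_le_of_forall_le (hP : P ∈ rowStochastic ℝ S) {δ : ℝ} (hδ : ∀ i j, δ ≤ P i j)
    {w : S → ℝ} (hw : ∑ i, w i = 0) :
    ∑ j, |(w ᵥ* P) j| ≤ (1 - Fintype.card S * δ) * ∑ i, |w i| := by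
  have hshift : ∀ j, (w ᵥ* P) j = ∑ i, w i * (P i j - δ) := fun j => by
    simp only [vecMul, dotProduct, mul_sub, Finset.sum_sub_distrib, ← Finset.sum_mul, hw,
      zero_mul, sub_zero]
  calc ∑ j, |(w ᵥ* P) j| ≤ ∑ j, ∑ i, |w i| * (P i j - δ) := by
        refine Finset.sum_le_sum fun j _ => ?_
        rw [hshift]
        refine (Finset.abs_sum_le_sum_abs _ _).trans_eq (Finset.sum_congr rfl fun i _ => ?_)
        rw [abs_mul, abs_of_nonneg (sub_nonneg.2 (hδ i j))]
    _ = (1 - Fintype.card S * δ) * ∑ i, |w i| := by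
        rw [Finset.sum_comm, Finset.mul_sum]
        refine Finset.sum_congr rfl fun i _ => ?_
        rw [← Finset.mul_sum, Finset.sum_sub_distrib, sum_row_of_mem_rowStochastic hP i,
          Finset.sum_const, Finset.card_univ, nsmul_eq_mul, mul_comm]

lemma sum_abs_vecMul_le (hP : P ∈ rowStochastic ℝ S) {w : S → ℝ} (hw : ∑ i, w i = 0) :
    ∑ j, |(w ᵥ* P) j| ≤ ∑ i, |w i| := by
  simpa using sum_abs_vecMul_le_of_forall_le hP hP.1 hw

lemma exists_pow_contraction_of_isPrimitive [Nonempty S] (hP : P ∈ rowStochastic ℝ S)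
    (hprim : P.IsPrimitive) :
    ∃ N, 0 < N ∧ ∃ q : ℝ, 0 < q ∧ q < 1 ∧
      ∀ w : S → ℝ, ∑ i, w i = 0 → ∑ j, |(w ᵥ* (P ^ N)) j| ≤ q * ∑ i, |w i| := by
  obtain ⟨N, hN, hpos⟩ := hprim.exists_pos_pow
  obtain ⟨p, hp⟩ := Finite.exists_min fun p : S × S => (P ^ N) p.1 p.2
  set δ := (P ^ N) p.1 p.2
  have hcard : 0 < Fintype.card S * δ := mul_pos (mod_cast Fintype.card_pos) (hpos _ _)
  refine ⟨N, hN, max (1 - Fintype.card S * δ) (1 / 2), by positivity,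
    max_lt (by linarith) (by norm_num), fun w hw => ?_⟩
  exact (sum_abs_vecMul_le_of_forall_le (pow_mem hP N) (fun i j => hp (i, j)) hw).trans
    (mul_le_mul_of_nonneg_right (le_max_left _ _) (Finset.sum_nonneg fun _ _ => abs_nonneg _))

lemma IsStationaryDist.eq [Nonempty S] (hP : P ∈ rowStochastic ℝ S) (hprim : P.IsPrimitive)
    (hμ : IsStationaryDist P μ) (hν : IsStationaryDist P ν) : μ = ν := by
  obtain ⟨N, -, q, -, hq, hcontr⟩ := exists_pow_contraction_of_isPrimitive hP hprim
  have hle := hcontr (μ - ν) (by simp [Finset.sum_sub_distrib, hμ.1.2, hν.1.2])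
  rw [sub_vecMul, hμ.vecMul_pow, hν.vecMul_pow] at hle
  have h0 : ∑ i, |(μ - ν) i| = 0 :=
    le_antisymm (by nlinarith) (Finset.sum_nonneg fun _ _ => abs_nonneg _)
  rw [Finset.sum_eq_zero_iff_of_nonneg fun _ _ => abs_nonneg _] at h0
  exact funext fun i => sub_eq_zero.1 (abs_eq_zero.1 (h0 i (Finset.mem_univ i)))

lemma sum_abs_sub_le_two {ι : Type*} [Fintype ι] {p q : ι → ℝ} (hp : p ∈ stdSimplex ℝ ι)
    (hq : q ∈ stdSimplex ℝ ι) : ∑ i, |p i - q i| ≤ 2 :=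
  calc ∑ i, |p i - q i| ≤ ∑ i, (p i + q i) := Finset.sum_le_sum fun i _ =>
        abs_le.2 ⟨by linarith [hp.1 i, hq.1 i], by linarith [hp.1 i, hq.1 i]⟩
    _ = 2 := by rw [Finset.sum_add_distrib, hp.2, hq.2]; norm_num

lemma row_mem_stdSimplex (hP : P ∈ rowStochastic ℝ S) (s : S) : P s ∈ stdSimplex ℝ S :=
  ⟨hP.1 s, sum_row_of_mem_rowStochastic hP s⟩

lemma exists_forall_le_mul_pow_of_antitone {N : ℕ} (hN : 0 < N) {q : ℝ} (hq₀ : 0 < q)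
    (hq₁ : q < 1) :
    ∃ β, 0 ≤ β ∧ β < 1 ∧ ∀ u : ℕ → ℝ, 0 ≤ u 0 → Antitone u → (∀ n, u (n + N) ≤ q * u n) →
      ∀ τ, u τ ≤ u 0 / q * β ^ τ := by
  set β := q ^ (1 / (N : ℝ))
  have hβ₀ : 0 ≤ β := Real.rpow_nonneg hq₀.le _
  have hβ₁ : β < 1 := Real.rpow_lt_one hq₀.le hq₁ (by positivity)
  have hβN : β ^ N = q := by
    rw [← Real.rpow_natCast, ← Real.rpow_mul hq₀.le, one_div_mul_cancel (by positivity),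
      Real.rpow_one]
  refine ⟨β, hβ₀, hβ₁, fun u hu₀ hu hdecay τ => ?_⟩
  have hblocks : ∀ k, u (k * N) ≤ q ^ k * u 0 := fun k => by
    induction k with
    | zero => simp
    | succ k ih =>
      rw [Nat.succ_mul, pow_succ', mul_assoc]
      exact (hdecay _).trans (mul_le_mul_of_nonneg_left ih hq₀.le)
  have hpow : q ^ (τ / N + 1) ≤ β ^ τ := by
    rw [← hβN, ← pow_mul]
    exact pow_le_pow_of_le_one hβ₀ hβ₁.le (Nat.lt_mul_div_succ τ hN).le
  calc u τ ≤ u (τ / N * N) := hu (Nat.div_mul_le_self τ N)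
    _ ≤ q ^ (τ / N) * u 0 := hblocks _
    _ = u 0 / q * q ^ (τ / N + 1) := by rw [pow_succ]; field_simp
    _ ≤ u 0 / q * β ^ τ := mul_le_mul_of_nonneg_left hpow (by positivity)

lemma IsStationaryDist.pow_add_row_sub (hμ : IsStationaryDist P μ) (m n : ℕ) (s : S) :
    (P ^ (m + n)) s - μ = ((P ^ m) s - μ) ᵥ* (P ^ n) := by
  rw [sub_vecMul, hμ.vecMul_pow, pow_add, mul_apply_eq_vecMul]

lemma exists_isMixing [Nonempty S] (hP : P ∈ rowStochastic ℝ S) (hprim : P.IsPrimitive)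
    (hμ : IsStationaryDist P μ) : ∃ C β : ℝ, IsMixing P μ C β := by
  obtain ⟨N, hN, q, hq₀, hq₁, hcontr⟩ := exists_pow_contraction_of_isPrimitive hP hprim
  obtain ⟨β, hβ₀, hβ₁, hβ⟩ := exists_forall_le_mul_pow_of_antitone hN hq₀ hq₁
  have hrow : ∀ τ s, (P ^ τ) s ∈ stdSimplex ℝ S := fun τ => row_mem_stdSimplex (pow_mem hP τ)
  have hsum : ∀ τ s, ∑ s', ((P ^ τ) s - μ) s' = 0 := fun τ s => by
    simp [Finset.sum_sub_distrib, (hrow τ s).2, hμ.1.2]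
  refine ⟨2 / q, β, by rw [lt_div_iff₀ hq₀]; linarith, hβ₀, hβ₁, fun τ s => ?_⟩
  have hanti : Antitone fun τ => ∑ s', |((P ^ τ) s - μ) s'| := antitone_nat_of_succ_le fun τ => by
    rw [hμ.pow_add_row_sub, pow_one]
    exact sum_abs_vecMul_le hP (hsum τ s)
  refine (hβ _ (Finset.sum_nonneg fun _ _ => abs_nonneg _) hanti (fun n => ?_) τ).trans ?_
  · rw [hμ.pow_add_row_sub]
    exact hcontr _ (hsum n s)
  · gcongr
    exact sum_abs_sub_le_two (hrow 0 s) hμ.1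

end FiniteMarkovChains

namespace PolicyEvaluation

open Matrix

variable {S : Type*} {A : Type*} [Fintype S] [Fintype A] {d : ℕ} (M : PolicyEvaluation S A d)

lemma P_nonneg (s s' : S) : 0 ≤ M.P s s' :=
  Finset.sum_nonneg fun a _ => mul_nonneg (M.Penv_nonneg s a s') (M.pol_nonneg s a)

lemma P_sum (s : S) : ∑ s', M.P s s' = 1 := by
  simp only [P, of_apply]
  rw [Finset.sum_comm]
  simp only [← Finset.sum_mul, M.Penv_sum, one_mul, M.pol_sum]

lemma P_mem_rowStochastic [DecidableEq S] : M.P ∈ rowStochastic ℝ S :=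
  mem_rowStochastic_iff_sum.2 ⟨M.P_nonneg, M.P_sum⟩

lemma abs_r_le_rmax (s : S) (a : A) : |M.r s a| ≤ M.rmax :=
  le_ciSup (f := fun p : S × A => |M.r p.1 p.2|) (Set.finite_range _).bddAbove (s, a)

lemma rmax_nonneg : 0 ≤ M.rmax := Real.iSup_nonneg fun _ => abs_nonneg _

lemma abs_R_le_rmax (s : S) : |M.R s| ≤ M.rmax :=
  calc |M.R s| ≤ ∑ a, |M.pol s a * M.r s a| := Finset.abs_sum_le_sum_abs _ _
    _ ≤ ∑ a, M.pol s a * M.rmax := Finset.sum_le_sum fun a _ => by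
        rw [abs_mul, abs_of_nonneg (M.pol_nonneg s a)]
        exact mul_le_mul_of_nonneg_left (M.abs_r_le_rmax s a) (M.pol_nonneg s a)
    _ = M.rmax := by rw [← Finset.sum_mul, M.pol_sum, one_mul]

lemma Φ_mulVec_apply (x : EuclideanSpace ℝ (Fin d)) (s : S) :
    (M.Φ *ᵥ x) s = inner ℝ (M.φ s) x := by
  simp [Φ, mulVec, dotProduct, PiLp.inner_apply, mul_comm]

lemma abs_inner_φ_le (x : EuclideanSpace ℝ (Fin d)) (s : S) : |inner ℝ (M.φ s) x| ≤ ‖x‖ :=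
  (abs_real_inner_le_norm _ _).trans (mul_le_of_le_one_left (norm_nonneg _) (M.norm_φ_le s))

lemma eq_zero_of_Φ_mulVec_eq_zero {x : EuclideanSpace ℝ (Fin d)} (hx : M.Φ *ᵥ x = 0) : x = 0 := by
  have hcomb : ∑ j, x j • (fun s => M.φ s j) = 0 := by
    ext s
    simpa [Φ, mulVec, dotProduct, mul_comm] using congrFun hx s
  ext j
  exact Fintype.linearIndependent_iff.1 M.φ_columns (fun j => x j) hcomb j

/-- The squared norm `‖Φ x‖²_Dir + (μᵀ Φ x)²` on the parameter space, whose minimum over the unit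
sphere is `η`. -/
noncomputable def energy (μ : S → ℝ) (x : EuclideanSpace ℝ (Fin d)) : ℝ :=
  M.dirichletSq μ (M.Φ *ᵥ x) + (μ ⬝ᵥ M.Φ *ᵥ x) ^ 2

/-- The bilinear form of the matrix `Φᵀ D (I - Π P) Φ` for a stationary `μ`, written without `Π`
(see `dotProduct_mulVec_eq_bilin`). -/
noncomputable def bilin (μ : S → ℝ) (x y : EuclideanSpace ℝ (Fin d)) : ℝ :=
  ∑ s, μ s * (M.Φ *ᵥ x) s * ((M.Φ *ᵥ y) s - (M.P *ᵥ (M.Φ *ᵥ y)) s) +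
    (μ ⬝ᵥ M.Φ *ᵥ x) * (μ ⬝ᵥ M.Φ *ᵥ y)

/-- The linear form of the vector `Φᵀ D Π R`, written without `Π`
(see `dotProduct_mulVec_eq_linForm`). -/
noncomputable def linForm (μ : S → ℝ) (x : EuclideanSpace ℝ (Fin d)) : ℝ :=
  ∑ s, μ s * (M.Φ *ᵥ x) s * M.R s - (μ ⬝ᵥ M.Φ *ᵥ x) * (μ ⬝ᵥ M.R)

variable {M} {μ : S → ℝ}

lemma dirichletSq_nonneg (hμ : ∀ s, 0 ≤ μ s) (f : S → ℝ) : 0 ≤ M.dirichletSq μ f :=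
  mul_nonneg (by norm_num) <| Finset.sum_nonneg fun s _ => Finset.sum_nonneg fun s' _ =>
    mul_nonneg (mul_nonneg (hμ s) (M.P_nonneg s s')) (sq_nonneg _)

variable (M) in
lemma sum_sum_mul_P_mul_left (μ q : S → ℝ) :
    ∑ s, ∑ s', μ s * M.P s s' * q s = ∑ s, μ s * q s :=
  Finset.sum_congr rfl fun s _ => by rw [← Finset.sum_mul, ← Finset.mul_sum, M.P_sum, mul_one]

lemma sum_sum_mul_P_mul_right (hμ : IsStationaryDist M.P μ) (q : S → ℝ) :
    ∑ s, ∑ s', μ s * M.P s s' * q s' = ∑ s, μ s * q s := by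
  rw [Finset.sum_comm]
  refine Finset.sum_congr rfl fun s' _ => ?_
  rw [← Finset.sum_mul]
  exact congrArg (· * q s') (congrFun hμ.2 s')

lemma dirichletSq_eq_sum (hμ : IsStationaryDist M.P μ) (f : S → ℝ) :
    M.dirichletSq μ f = ∑ s, μ s * f s * (f s - (M.P *ᵥ f) s) := by
  have hexpand : ∀ s s', μ s * M.P s s' * (f s - f s') ^ 2 = μ s * M.P s s' * f s ^ 2 +
      μ s * M.P s s' * f s' ^ 2 - 2 * (μ s * f s * (M.P s s' * f s')) := fun s s' => by ring
  have hright : ∀ s, μ s * f s * (f s - (M.P *ᵥ f) s) =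
      μ s * f s ^ 2 - μ s * f s * ∑ s', M.P s s' * f s' := fun s => by
    simp only [mulVec, dotProduct]; ring
  simp only [dirichletSq, hexpand, hright, Finset.sum_sub_distrib, Finset.sum_add_distrib,
    M.sum_sum_mul_P_mul_left μ (f · ^ 2), sum_sum_mul_P_mul_right hμ (f · ^ 2), ← Finset.mul_sum]
  ring

lemma dirichletSq_le (hμ : IsStationaryDist M.P μ) (f : S → ℝ) (c : ℝ) :
    M.dirichletSq μ f ≤ 2 * ∑ s, μ s * (f s - c) ^ 2 :=
  calc (1 / 2) * ∑ s, ∑ s', μ s * M.P s s' * (f s - f s') ^ 2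
      ≤ (1 / 2) * ∑ s, ∑ s', (μ s * M.P s s' * (2 * (f s - c) ^ 2) +
          μ s * M.P s s' * (2 * (f s' - c) ^ 2)) := by
        gcongr with s _ s' _
        rw [← mul_add]
        refine mul_le_mul_of_nonneg_left ?_ (mul_nonneg (hμ.1.1 s) (M.P_nonneg s s'))
        linarith [sq_nonneg ((f s - c) + (f s' - c))]
    _ = 2 * ∑ s, μ s * (f s - c) ^ 2 := by
        simp_rw [Finset.sum_add_distrib]
        rw [M.sum_sum_mul_P_mul_left μ fun s => 2 * (f s - c) ^ 2,
          sum_sum_mul_P_mul_right hμ fun s => 2 * (f s - c) ^ 2]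
        simp_rw [mul_left_comm (μ _) 2, ← Finset.mul_sum]
        ring

lemma apply_eq_apply_of_dirichletSq_eq_zero (hμ : ∀ s, 0 < μ s) (hirr : M.P.IsIrreducible)
    {f : S → ℝ} (hf : M.dirichletSq μ f = 0) (s s' : S) : f s = f s' := by
  classical
  have hnn : ∀ s s', 0 ≤ μ s * M.P s s' * (f s - f s') ^ 2 := fun s s' =>
    mul_nonneg (mul_nonneg (hμ s).le (M.P_nonneg s s')) (sq_nonneg _)
  have hedge : ∀ s s', 0 < M.P s s' → f s = f s' := fun s s' hP => by
    rw [dirichletSq, mul_eq_zero, or_iff_right (by norm_num),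
      Finset.sum_eq_zero_iff_of_nonneg fun s _ => Finset.sum_nonneg fun s' _ => hnn s s'] at hf
    have hterm := (Finset.sum_eq_zero_iff_of_nonneg fun s' _ => hnn s s').1
      (hf s (Finset.mem_univ s)) s' (Finset.mem_univ s')
    exact sub_eq_zero.1 (pow_eq_zero_iff two_ne_zero |>.1
      ((mul_eq_zero.1 hterm).resolve_left (mul_pos (hμ s) hP).ne'))
  obtain ⟨n, -, hn⟩ := (isIrreducible_iff_exists_pow_pos M.P_nonneg).1 hirr s s'
  exact apply_eq_of_pow_apply_pos M.P_nonneg hedge n hn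

lemma energy_nonneg (hμ : ∀ s, 0 ≤ μ s) (x : EuclideanSpace ℝ (Fin d)) : 0 ≤ M.energy μ x :=
  add_nonneg (dirichletSq_nonneg hμ _) (sq_nonneg _)

lemma energy_smul (c : ℝ) (x : EuclideanSpace ℝ (Fin d)) :
    M.energy μ (c • x) = c ^ 2 * M.energy μ x := by
  have hΦ : M.Φ *ᵥ (c • x).ofLp = c • (M.Φ *ᵥ x.ofLp) := by rw [← mulVec_smul]; rfl
  simp only [energy, hΦ, dirichletSq, dotProduct_smul, Pi.smul_apply, smul_eq_mul, ← mul_sub,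
    mul_pow, mul_add, Finset.mul_sum]
  congr 1
  exact Finset.sum_congr rfl fun s _ => Finset.sum_congr rfl fun s' _ => by ring

lemma continuous_energy : Continuous (M.energy μ) := by
  unfold energy dirichletSq dotProduct
  simp only [Φ_mulVec_apply]
  fun_prop

lemma eta_le_energy (hμ : ∀ s, 0 ≤ μ s) {x : EuclideanSpace ℝ (Fin d)} (hx : ‖x‖ = 1) :
    M.eta μ ≤ M.energy μ x :=
  csInf_le ⟨0, by rintro _ ⟨y, -, rfl⟩; exact energy_nonneg hμ y⟩ ⟨x, by simpa using hx, rfl⟩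

lemma eta_mul_sq_norm_le_energy (hμ : ∀ s, 0 ≤ μ s) (x : EuclideanSpace ℝ (Fin d)) :
    M.eta μ * ‖x‖ ^ 2 ≤ M.energy μ x := by
  rcases eq_or_ne x 0 with rfl | hx
  · simpa using energy_nonneg hμ _
  have hx' : 0 < ‖x‖ := norm_pos_iff.2 hx
  have hunit := eta_le_energy (M := M) hμ (x := ‖x‖⁻¹ • x) (by
    rw [norm_smul, norm_inv, norm_norm, inv_mul_cancel₀ hx'.ne'])
  rwa [energy_smul, inv_pow, inv_mul_eq_div, le_div_iff₀ (by positivity)] at hunit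

lemma energy_le (hμ : IsStationaryDist M.P μ) (x : EuclideanSpace ℝ (Fin d)) :
    M.energy μ x ≤ 2 * ‖x‖ ^ 2 := by
  set f := M.Φ *ᵥ x
  set m := μ ⬝ᵥ f
  have hvariance : ∑ s, μ s * (f s - m) ^ 2 = ∑ s, μ s * f s ^ 2 - m ^ 2 := by
    have hterm : ∀ s, μ s * (f s - m) ^ 2 = μ s * f s ^ 2 - 2 * m * (μ s * f s) + m ^ 2 * μ s :=
      fun s => by ring
    simp only [hterm, Finset.sum_add_distrib, Finset.sum_sub_distrib, ← Finset.mul_sum, hμ.1.2,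
      show ∑ s, μ s * f s = m from rfl]
    ring
  have hmoment : ∑ s, μ s * f s ^ 2 ≤ ‖x‖ ^ 2 :=
    calc ∑ s, μ s * f s ^ 2 ≤ ∑ s, μ s * ‖x‖ ^ 2 := by
          refine Finset.sum_le_sum fun s _ => mul_le_mul_of_nonneg_left ?_ (hμ.1.1 s)
          rw [sq_le_sq, abs_norm, show f s = inner ℝ (M.φ s) x from M.Φ_mulVec_apply x s]
          exact M.abs_inner_φ_le x s
      _ = ‖x‖ ^ 2 := by rw [← Finset.sum_mul, hμ.1.2, one_mul]
  calc M.energy μ x ≤ 2 * ∑ s, μ s * (f s - m) ^ 2 + m ^ 2 :=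
        add_le_add_left (dirichletSq_le hμ f m) _
    _ ≤ 2 * ‖x‖ ^ 2 := by nlinarith [sq_nonneg m]

lemma energy_pos (hμ : IsStationaryDist M.P μ) (hpos : ∀ s, 0 < μ s) (hirr : M.P.IsIrreducible)
    {x : EuclideanSpace ℝ (Fin d)} (hx : x ≠ 0) : 0 < M.energy μ x := by
  refine (energy_nonneg hμ.1.1 x).lt_of_ne' fun h => hx ?_
  obtain ⟨hdir, hmean⟩ :=
    (add_eq_zero_iff_of_nonneg (dirichletSq_nonneg hμ.1.1 _) (sq_nonneg _)).1 h
  refine M.eq_zero_of_Φ_mulVec_eq_zero (funext fun s => ?_)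
  calc (M.Φ *ᵥ x) s = ∑ s', μ s' * (M.Φ *ᵥ x) s := by rw [← Finset.sum_mul, hμ.1.2, one_mul]
    _ = μ ⬝ᵥ M.Φ *ᵥ x := Finset.sum_congr rfl fun s' _ => by
        rw [apply_eq_apply_of_dirichletSq_eq_zero hpos hirr hdir s s']
    _ = 0 := pow_eq_zero_iff two_ne_zero |>.1 hmean

lemma dim_pos_of_eta_pos (hη : 0 < M.eta μ) : 0 < d := by
  refine Nat.pos_of_ne_zero ?_
  rintro rfl
  simp [eta, Metric.sphere_eq_empty_of_subsingleton] at hη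

lemma exists_norm_eq_one_and_eta_eq (hd : 0 < d) :
    ∃ x : EuclideanSpace ℝ (Fin d), ‖x‖ = 1 ∧ M.eta μ = M.energy μ x := by
  have : Nonempty (Fin d) := ⟨⟨0, hd⟩⟩
  obtain ⟨x, hx, hxη⟩ := ((isCompact_sphere (0 : EuclideanSpace ℝ (Fin d)) 1).image
    (continuous_energy (M := M) (μ := μ))).sInf_mem
    ((NormedSpace.sphere_nonempty.2 zero_le_one).image _)
  exact ⟨x, by simpa using hx, hxη.symm⟩

lemma eta_le_two (hd : 0 < d) (hμ : IsStationaryDist M.P μ) : M.eta μ ≤ 2 := by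
  obtain ⟨x, hx, hxη⟩ := exists_norm_eq_one_and_eta_eq (M := M) (μ := μ) hd
  simpa [hxη, hx] using energy_le hμ x

lemma eta_pos (hd : 0 < d) (hμ : IsStationaryDist M.P μ) (hpos : ∀ s, 0 < μ s)
    (hirr : M.P.IsIrreducible) : 0 < M.eta μ := by
  obtain ⟨x, hx, hxη⟩ := exists_norm_eq_one_and_eta_eq (M := M) (μ := μ) hd
  exact hxη ▸ energy_pos hμ hpos hirr (norm_ne_zero_iff.1 (hx.trans_ne one_ne_zero))

lemma bilin_self (hμ : IsStationaryDist M.P μ) (x : EuclideanSpace ℝ (Fin d)) :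
    M.bilin μ x x = M.energy μ x := by
  rw [bilin, energy, dirichletSq_eq_sum hμ, sq]

section FixedPoint

variable [DecidableEq S]

lemma dotProduct_transpose_mul_diagonal_mulVec (μ : S → ℝ) (x : Fin d → ℝ) (w : S → ℝ) :
    x ⬝ᵥ (M.Φ.transpose * Matrix.diagonal μ) *ᵥ w = ∑ s, μ s * (M.Φ *ᵥ x) s * w s := by
  rw [← mulVec_mulVec, mulVec_transpose, dotProduct_comm, ← dotProduct_mulVec, dotProduct]
  exact Finset.sum_congr rfl fun s _ => by rw [mulVec_diagonal]; ring

lemma proj_mulVec (μ w : S → ℝ) : proj μ *ᵥ w = fun s => w s - μ ⬝ᵥ w := by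
  rw [proj, sub_mulVec, one_mulVec, vecMulVec_mulVec]
  ext s
  simp

lemma dotProduct_mulVec_eq_bilin (hμ : IsStationaryDist M.P μ) (x θ : EuclideanSpace ℝ (Fin d)) :
    x.ofLp ⬝ᵥ (M.Φ.transpose * Matrix.diagonal μ * (1 - proj μ * M.P) * M.Φ) *ᵥ θ =
      M.bilin μ x θ := by
  have hμP : ∀ w, μ ⬝ᵥ M.P *ᵥ w = μ ⬝ᵥ w := fun w => by rw [dotProduct_mulVec, hμ.2]
  rw [Matrix.mul_assoc, ← mulVec_mulVec, dotProduct_transpose_mul_diagonal_mulVec, ← mulVec_mulVec,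
    sub_mulVec, one_mulVec, ← mulVec_mulVec, proj_mulVec, hμP, bilin,
    show μ ⬝ᵥ M.Φ *ᵥ x.ofLp = ∑ s, μ s * (M.Φ *ᵥ x.ofLp) s from rfl, Finset.sum_mul,
    ← Finset.sum_add_distrib]
  exact Finset.sum_congr rfl fun s _ => by simp only [Pi.sub_apply]; ring

lemma dotProduct_mulVec_eq_linForm (x : EuclideanSpace ℝ (Fin d)) :
    x.ofLp ⬝ᵥ (M.Φ.transpose * Matrix.diagonal μ * proj μ) *ᵥ M.R = M.linForm μ x := by
  rw [← mulVec_mulVec, dotProduct_transpose_mul_diagonal_mulVec, proj_mulVec, linForm,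
    show μ ⬝ᵥ M.Φ *ᵥ x.ofLp = ∑ s, μ s * (M.Φ *ᵥ x.ofLp) s from rfl, Finset.sum_mul,
    ← Finset.sum_sub_distrib]
  exact Finset.sum_congr rfl fun s _ => by ring

lemma IsFixedPoint.bilin_eq_linForm (hμ : IsStationaryDist M.P μ)
    {θ : EuclideanSpace ℝ (Fin d)} (h : M.IsFixedPoint μ θ) (x : EuclideanSpace ℝ (Fin d)) :
    M.bilin μ x θ = M.linForm μ x := by
  rw [← dotProduct_mulVec_eq_bilin hμ, ← dotProduct_mulVec_eq_linForm, h]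

lemma existsUnique_isFixedPoint (hμ : IsStationaryDist M.P μ) (hη : 0 < M.eta μ) :
    ∃! θs : EuclideanSpace ℝ (Fin d), M.IsFixedPoint μ θs := by
  set B := M.Φ.transpose * Matrix.diagonal μ * (1 - proj μ * M.P) * M.Φ
  have hker : ∀ x : EuclideanSpace ℝ (Fin d), B *ᵥ x = 0 → x = 0 := fun x hx => by
    have henergy : M.energy μ x = 0 := by
      rw [← bilin_self hμ, ← dotProduct_mulVec_eq_bilin hμ, hx, dotProduct_zero]
    have hle := eta_mul_sq_norm_le_energy (M := M) hμ.1.1 x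
    have hsq : ‖x‖ ^ 2 = 0 := le_antisymm (by nlinarith) (sq_nonneg _)
    exact norm_eq_zero.1 (pow_eq_zero_iff two_ne_zero |>.1 hsq)
  have hinj : Function.Injective B.mulVec := fun x y hxy => by
    have hzero : B *ᵥ (x - y) = 0 := by
      rw [Matrix.mulVec_sub B x y]; exact sub_eq_zero.2 hxy
    exact sub_eq_zero.1 ((WithLp.toLp_eq_zero 2).1 (hker (WithLp.toLp 2 (x - y)) hzero))
  obtain ⟨θ, hθ⟩ := mulVec_surjective_iff_isUnit.2 (mulVec_injective_iff_isUnit.1 hinj)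
    ((M.Φ.transpose * Matrix.diagonal μ * proj μ) *ᵥ M.R)
  exact ⟨WithLp.toLp 2 θ, hθ, fun y hy => WithLp.ofLp_injective 2 (hinj (hy.trans hθ.symm))⟩

end FixedPoint

end PolicyEvaluation

lemma norm_sum_smul_le {ι E : Type*} [Fintype ι] [NormedAddCommGroup E] [NormedSpace ℝ E]
    {c : ι → ℝ} {w : ι → E} {r : ℝ} (hw : ∀ i, ‖w i‖ ≤ r) : ‖∑ i, c i • w i‖ ≤ (∑ i, |c i|) * r :=
  calc ‖∑ i, c i • w i‖ ≤ ∑ i, |c i| * r := norm_sum_le_of_le _ fun i _ => by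
        rw [norm_smul, Real.norm_eq_abs]
        exact mul_le_mul_of_nonneg_left (hw i) (abs_nonneg _)
    _ = (∑ i, |c i|) * r := (Finset.sum_mul _ _ _).symm

section PoissonEquation

open Matrix

variable {I : Type*} [Fintype I] [DecidableEq I] {Q : Matrix I I ℝ} {ν : I → ℝ} {b : ℕ → ℝ}

/-- The deviation matrix `∑ₖ (Qᵏ - e νᵀ)` of a chain with transition matrix `Q` and stationary
distribution `ν`. It solves the Poisson equation (see `deviationMatrix_sub_mul`). -/
noncomputable def deviationMatrix (Q : Matrix I I ℝ) (ν : I → ℝ) : Matrix I I ℝ :=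
  of fun i j => ∑' k, ((Q ^ k) i j - ν j)

lemma summable_abs_pow_apply_sub (hb : Summable b)
    (hQ : ∀ k i, ∑ j, |(Q ^ k) i j - ν j| ≤ b k) (i j : I) :
    Summable fun k => |(Q ^ k) i j - ν j| :=
  hb.of_nonneg_of_le (fun _ => abs_nonneg _) fun k =>
    (Finset.single_le_sum (f := fun j => |(Q ^ k) i j - ν j|) (fun _ _ => abs_nonneg _)
      (Finset.mem_univ j)).trans (hQ k i)

lemma sum_abs_deviationMatrix_le (hb : Summable b)
    (hQ : ∀ k i, ∑ j, |(Q ^ k) i j - ν j| ≤ b k) (i : I) :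
    ∑ j, |deviationMatrix Q ν i j| ≤ ∑' k, b k := by
  have habs := summable_abs_pow_apply_sub hb hQ i
  calc ∑ j, |∑' k, ((Q ^ k) i j - ν j)| ≤ ∑ j, ∑' k, |(Q ^ k) i j - ν j| :=
        Finset.sum_le_sum fun j _ =>
          norm_tsum_le_tsum_norm (f := fun k => (Q ^ k) i j - ν j) (habs j)
    _ = ∑' k, ∑ j, |(Q ^ k) i j - ν j| := (Summable.tsum_finsetSum fun j _ => habs j).symm
    _ ≤ ∑' k, b k := Summable.tsum_le_tsum (hQ · i) (summable_sum fun j _ => habs j) hb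

lemma deviationMatrix_sub_mul (hb : Summable b) (hrow : ∀ i, ∑ j, Q i j = 1)
    (hQ : ∀ k i, ∑ j, |(Q ^ k) i j - ν j| ≤ b k) :
    deviationMatrix Q ν - Q * deviationMatrix Q ν = 1 - vecMulVec 1 ν := by
  have hsum : ∀ i j, Summable fun k => (Q ^ k) i j - ν j := fun i j =>
    (summable_abs_pow_apply_sub hb hQ i j).of_abs
  ext i j
  have hshift : (Q * deviationMatrix Q ν) i j = ∑' k, ((Q ^ (k + 1)) i j - ν j) := by
    simp only [mul_apply, deviationMatrix, of_apply, ← tsum_mul_left]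
    rw [← Summable.tsum_finsetSum fun l _ => (hsum l j).mul_left _]
    simp_rw [mul_sub, Finset.sum_sub_distrib, ← Finset.sum_mul, hrow, one_mul, pow_succ', mul_apply]
  rw [Matrix.sub_apply, hshift, deviationMatrix, of_apply, (hsum i j).tsum_eq_zero_add]
  simp

end PoissonEquation

section MixingMajorant

variable {C β : ℝ}

lemma one_le_L1 (C β : ℝ) : 1 ≤ L1 C β := le_max_left _ _

lemma log_one_div_pos (hβ₀ : 0 < β) (hβ₁ : β < 1) : 0 < Real.log (1 / β) :=
  Real.log_pos (one_lt_one_div hβ₀ hβ₁)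

lemma log_add_one_le_L1_mul (hβ₀ : 0 < β) (hβ₁ : β < 1) :
    Real.log C + 1 ≤ L1 C β * Real.log (1 / β) :=
  (div_le_iff₀ (log_one_div_pos hβ₀ hβ₁)).1 (le_max_right _ _)

lemma inv_one_sub_le_L1 (hC : 1 < C) (hβ₀ : 0 ≤ β) (hβ₁ : β < 1) : (1 - β)⁻¹ ≤ 1 + L1 C β := by
  rcases hβ₀.eq_or_lt with rfl | hβ₀
  · norm_num
    linarith [one_le_L1 C 0]
  have hlog : Real.log (1 / β) ≤ 1 / β - 1 := Real.log_le_sub_one_of_pos (by positivity)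
  have hone : 1 ≤ L1 C β * (1 / β - 1) := by
    linarith [mul_le_mul_of_nonneg_left hlog (zero_le_one.trans (one_le_L1 C β)),
      log_add_one_le_L1_mul (C := C) hβ₀ hβ₁, Real.log_pos hC]
  have hβ : β ≤ L1 C β * (1 - β) :=
    calc β ≤ L1 C β * (1 / β - 1) * β := le_mul_of_one_le_left hβ₀.le hone
      _ = L1 C β * (1 - β) := by field_simp
  rw [inv_le_iff_one_le_mul₀ (by linarith)]
  linarith

lemma exists_mul_pow_le_one (hC : 1 < C) (hβ₀ : 0 ≤ β) (hβ₁ : β < 1) :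
    ∃ n : ℕ, (n : ℝ) ≤ L1 C β + 1 ∧ C * β ^ n ≤ 1 := by
  rcases hβ₀.eq_or_lt with rfl | hβ₀
  · exact ⟨1, by norm_num; linarith [one_le_L1 C 0], by norm_num⟩
  refine ⟨⌈L1 C β⌉₊, (Nat.ceil_lt_add_one (zero_le_one.trans (one_le_L1 C β))).le, ?_⟩
  have hC₀ : 0 < C := by linarith
  have hceil := mul_le_mul_of_nonneg_right (Nat.le_ceil (L1 C β)) (log_one_div_pos hβ₀ hβ₁).le
  have hL := log_add_one_le_L1_mul (C := C) hβ₀ hβ₁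
  rw [one_div, Real.log_inv] at hceil hL
  rw [← Real.log_nonpos_iff (by positivity), Real.log_mul hC₀.ne' (by positivity), Real.log_pow]
  linarith

lemma exists_summable_majorant (hC : 1 < C) (hβ₀ : 0 ≤ β) (hβ₁ : β < 1) :
    ∃ b : ℕ → ℝ, Summable b ∧ ∑' k, b k ≤ 8 * L1 C β ∧
      ∀ k x, x ≤ 2 → x ≤ 2 * (C * β ^ k) → x ≤ b k := by
  obtain ⟨n, hn, hCn⟩ := exists_mul_pow_le_one hC hβ₀ hβ₁
  set b : ℕ → ℝ := fun k => if k < n then 2 else 2 * β ^ (k - n) with hb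
  have hshift : ∀ k, b (k + n) = 2 * β ^ k := fun k => by simp [hb]
  have hhead : ∑ k ∈ Finset.range n, b k = n * 2 := by
    rw [Finset.sum_congr rfl fun k hk => if_pos (Finset.mem_range.1 hk)]
    simp
  have hsum : Summable b := (summable_nat_add_iff n).1
    (((summable_geometric_of_lt_one hβ₀ hβ₁).mul_left 2).congr fun k => (hshift k).symm)
  refine ⟨b, hsum, ?_, fun k x hx₂ hx => ?_⟩
  · rw [← hsum.sum_add_tsum_nat_add n, hhead]
    simp_rw [hshift]
    rw [tsum_mul_left, tsum_geometric_of_lt_one hβ₀ hβ₁]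
    linarith [inv_one_sub_le_L1 hC hβ₀ hβ₁, one_le_L1 C β]
  · by_cases hk : k < n
    · simpa only [hb, if_pos hk] using hx₂
    · simp only [hb, if_neg hk]
      refine hx.trans (mul_le_mul_of_nonneg_left ?_ zero_le_two)
      obtain ⟨l, rfl⟩ := Nat.exists_eq_add_of_le (not_lt.1 hk)
      rw [pow_add, ← mul_assoc, Nat.add_sub_cancel_left]
      exact mul_le_of_le_one_left (pow_nonneg hβ₀ l) hCn

end MixingMajorant

section PairChain

open Matrix
open scoped Kronecker

variable {S : Type*} [Fintype S] [DecidableEq S] {P : Matrix S S ℝ} {μ : S → ℝ} {C β : ℝ}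

/-- The joint law of two independent random states with distribution `μ`. -/
def pairDist {S : Type*} (μ : S → ℝ) (i : S × S) : ℝ := μ i.1 * μ i.2

lemma kronecker_self_pow (P : Matrix S S ℝ) (k : ℕ) : (P ⊗ₖ P) ^ k = (P ^ k) ⊗ₖ (P ^ k) := by
  induction k with
  | zero => simp only [pow_zero, one_kronecker_one]
  | succ k ih => rw [pow_succ, ih, ← mul_kronecker_mul, ← pow_succ]

lemma kronecker_self_mem_rowStochastic (hP : P ∈ rowStochastic ℝ S) :
    P ⊗ₖ P ∈ rowStochastic ℝ (S × S) :=
  mem_rowStochastic_iff_sum.2 ⟨fun i j => mul_nonneg (hP.1 i.1 j.1) (hP.1 i.2 j.2), fun i => by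
    simp only [kroneckerMap_apply, Fintype.sum_prod_type, ← Finset.mul_sum,
      sum_row_of_mem_rowStochastic hP, mul_one]⟩

omit [DecidableEq S] in
lemma pairDist_mem_stdSimplex (hμ : μ ∈ stdSimplex ℝ S) : pairDist μ ∈ stdSimplex ℝ (S × S) :=
  ⟨fun _ => mul_nonneg (hμ.1 _) (hμ.1 _), by
    simp [pairDist, Fintype.sum_prod_type, ← Finset.mul_sum, hμ.2]⟩

omit [DecidableEq S] in
lemma sum_abs_mul_sub_mul_le {p q : S → ℝ} (hp : p ∈ stdSimplex ℝ S) (hμ : μ ∈ stdSimplex ℝ S) :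
    ∑ x, ∑ y, |p x * q y - μ x * μ y| ≤ ∑ y, |q y - μ y| + ∑ x, |p x - μ x| :=
  calc ∑ x, ∑ y, |p x * q y - μ x * μ y|
      ≤ ∑ x, ∑ y, (p x * |q y - μ y| + |p x - μ x| * μ y) := by
        refine Finset.sum_le_sum fun x _ => Finset.sum_le_sum fun y _ => ?_
        rw [show p x * q y - μ x * μ y = p x * (q y - μ y) + (p x - μ x) * μ y by ring]
        refine (abs_add_le _ _).trans_eq ?_
        rw [abs_mul, abs_mul, abs_of_nonneg (hp.1 x), abs_of_nonneg (hμ.1 y)]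
    _ = ∑ y, |q y - μ y| + ∑ x, |p x - μ x| := by
        simp_rw [Finset.sum_add_distrib, ← Finset.mul_sum, ← Finset.sum_mul, hp.2, hμ.2]
        ring

lemma sum_abs_kronecker_pow_sub_pairDist_le (hP : P ∈ rowStochastic ℝ S)
    (hμ : μ ∈ stdSimplex ℝ S) (hmix : IsMixing P μ C β) (k : ℕ) (i : S × S) :
    ∑ j, |((P ⊗ₖ P) ^ k) i j - pairDist μ j| ≤ 2 * (C * β ^ k) := by
  rw [kronecker_self_pow, Fintype.sum_prod_type]
  linarith [sum_abs_mul_sub_mul_le (q := (P ^ k) i.2) (row_mem_stdSimplex (pow_mem hP k) i.1) hμ,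
    hmix.2.2.2 k i.1, hmix.2.2.2 k i.2, show
      ∑ x, ∑ y, |((P ^ k) ⊗ₖ (P ^ k)) i (x, y) - pairDist μ (x, y)| =
        ∑ x, ∑ y, |(P ^ k) i.1 x * (P ^ k) i.2 y - μ x * μ y| from rfl]

lemma exists_summable_pair_mixing (hP : P ∈ rowStochastic ℝ S) (hμ : μ ∈ stdSimplex ℝ S)
    (hmix : IsMixing P μ C β) :
    ∃ b : ℕ → ℝ, Summable b ∧ ∑' k, b k ≤ 8 * L1 C β ∧
      ∀ k i, ∑ j, |((P ⊗ₖ P) ^ k) i j - pairDist μ j| ≤ b k := by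
  obtain ⟨b, hb, hsum, hmaj⟩ := exists_summable_majorant hmix.1 hmix.2.1 hmix.2.2.1
  refine ⟨b, hb, hsum, fun k i =>
    hmaj k _ ?_ (sum_abs_kronecker_pow_sub_pairDist_le hP hμ hmix k i)⟩
  exact sum_abs_sub_le_two
    (row_mem_stdSimplex (pow_mem (kronecker_self_mem_rowStochastic hP) k) i)
    (pairDist_mem_stdSimplex hμ)

lemma sum_abs_deviationMatrix_pair_le (hP : P ∈ rowStochastic ℝ S) (hμ : μ ∈ stdSimplex ℝ S)
    (hmix : IsMixing P μ C β) (i : S × S) :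
    ∑ j, |deviationMatrix (P ⊗ₖ P) (pairDist μ) i j| ≤ 8 * L1 C β := by
  obtain ⟨b, hb, hsum, hle⟩ := exists_summable_pair_mixing hP hμ hmix
  exact (sum_abs_deviationMatrix_le hb hle i).trans hsum

lemma deviationMatrix_pair_sub_mul (hP : P ∈ rowStochastic ℝ S) (hμ : μ ∈ stdSimplex ℝ S)
    (hmix : IsMixing P μ C β) :
    deviationMatrix (P ⊗ₖ P) (pairDist μ) - (P ⊗ₖ P) * deviationMatrix (P ⊗ₖ P) (pairDist μ) =
      1 - vecMulVec 1 (pairDist μ) := by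
  obtain ⟨b, hb, -, hle⟩ := exists_summable_pair_mixing hP hμ hmix
  exact deviationMatrix_sub_mul hb
    (sum_row_of_mem_rowStochastic (kronecker_self_mem_rowStochastic hP)) hle

end PairChain

namespace PolicyEvaluation

open Matrix
open scoped Kronecker

variable {S : Type*} {A : Type*} [Fintype S] [Fintype A] {d : ℕ} (M : PolicyEvaluation S A d)
  {μ : S → ℝ} {C β : ℝ} {θs : EuclideanSpace ℝ (Fin d)}

section Increment

/-- The update direction `f + g` of the algorithm, as a function of two consecutive states
`i = (s_t, ŝ_t)` and `j = (s_{t+1}, ŝ_{t+1})` of the pair chain. -/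
noncomputable def increment (i j : S × S) (θ : EuclideanSpace ℝ (Fin d)) :
    EuclideanSpace ℝ (Fin d) :=
  M.f i.1 i.2 θ + M.g i.1 j.1 θ

/-- The conditional expectation of the update direction given the current state of the pair
chain. -/
noncomputable def condIncrement (i : S × S) (θ : EuclideanSpace ℝ (Fin d)) :
    EuclideanSpace ℝ (Fin d) :=
  ∑ j, (M.P ⊗ₖ M.P) i j • M.increment i j θ

/-- The mean of the update direction when the pair chain is stationary. -/
noncomputable def meanIncrement (μ : S → ℝ) (θ : EuclideanSpace ℝ (Fin d)) :
    EuclideanSpace ℝ (Fin d) :=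
  ∑ i, pairDist μ i • M.condIncrement i θ

/-- A common bound for the update directions at `θ` (and for `3 ‖θ - θ*‖`), where
`θs = θ*`. -/
noncomputable def incrementBound (θs θ : EuclideanSpace ℝ (Fin d)) : ℝ :=
  2 * (M.rmax + 3 * ‖θs‖) + 3 * ‖θ - θs‖

lemma norm_smul_φ_le (c : ℝ) (s : S) : ‖c • M.φ s‖ ≤ |c| := by
  rw [norm_smul, Real.norm_eq_abs]
  exact mul_le_of_le_one_right (abs_nonneg _) (M.norm_φ_le s)

lemma norm_increment_sub_le (i j : S × S) (θ θ' : EuclideanSpace ℝ (Fin d)) :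
    ‖M.increment i j θ - M.increment i j θ'‖ ≤ 3 * ‖θ - θ'‖ := by
  have hsub : M.increment i j θ - M.increment i j θ' = (-inner ℝ (M.φ i.1) (θ - θ')) • M.φ i.2 +
      (inner ℝ (M.φ j.1) (θ - θ') - inner ℝ (M.φ i.1) (θ - θ')) • M.φ i.1 := by
    simp only [increment, f, g, inner_sub_right]
    module
  rw [hsub]
  refine (norm_add_le _ _).trans
    ((add_le_add (M.norm_smul_φ_le _ _) (M.norm_smul_φ_le _ _)).trans ?_)
  rw [abs_neg]
  linarith [M.abs_inner_φ_le (θ - θ') i.1, M.abs_inner_φ_le (θ - θ') j.1,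
    abs_sub (inner ℝ (M.φ j.1) (θ - θ')) (inner ℝ (M.φ i.1) (θ - θ'))]

lemma norm_increment_le (i j : S × S) (θ : EuclideanSpace ℝ (Fin d)) :
    ‖M.increment i j θ‖ ≤ 2 * (M.rmax + 3 * ‖θ‖) := by
  rw [increment, f, g]
  refine (norm_add_le _ _).trans
    ((add_le_add (M.norm_smul_φ_le _ _) (M.norm_smul_φ_le _ _)).trans ?_)
  rw [abs_neg]
  linarith [M.abs_inner_φ_le θ i.1, M.abs_inner_φ_le θ j.1, M.abs_R_le_rmax i.1,
    abs_add_le (M.R i.1) (inner ℝ (M.φ i.1) θ), abs_add_le (M.R i.1) (inner ℝ (M.φ j.1) θ),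
    abs_sub (M.R i.1 + inner ℝ (M.φ j.1) θ) (inner ℝ (M.φ i.1) θ), norm_nonneg θ]

lemma three_mul_norm_sub_le_incrementBound (θs θ : EuclideanSpace ℝ (Fin d)) :
    3 * ‖θ - θs‖ ≤ M.incrementBound θs θ := by
  rw [incrementBound]
  linarith [M.rmax_nonneg, norm_nonneg θs]

lemma norm_increment_le_incrementBound (i j : S × S) (θs θ : EuclideanSpace ℝ (Fin d)) :
    ‖M.increment i j θ‖ ≤ M.incrementBound θs θ := by
  rw [incrementBound]
  linarith [M.norm_increment_sub_le i j θ θs, M.norm_increment_le i j θs,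
    norm_sub_norm_le (M.increment i j θ) (M.increment i j θs)]

lemma continuous_increment (i j : S × S) : Continuous (M.increment i j) := by
  unfold increment f g
  fun_prop

lemma norm_sum_kronecker_smul_le {E : Type*} [NormedAddCommGroup E] [NormedSpace ℝ E]
    {w : S × S → E} {r : ℝ} (hw : ∀ j, ‖w j‖ ≤ r) (i : S × S) :
    ‖∑ j, (M.P ⊗ₖ M.P) i j • w j‖ ≤ r := by
  classical
  have hP := kronecker_self_mem_rowStochastic M.P_mem_rowStochastic
  calc ‖∑ j, (M.P ⊗ₖ M.P) i j • w j‖ ≤ (∑ j, |(M.P ⊗ₖ M.P) i j|) * r := norm_sum_smul_le hw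
    _ = r := by
      simp_rw [fun j => abs_of_nonneg (hP.1 i j)]
      rw [sum_row_of_mem_rowStochastic hP, one_mul]

lemma norm_condIncrement_sub_le (i : S × S) (θ θ' : EuclideanSpace ℝ (Fin d)) :
    ‖M.condIncrement i θ - M.condIncrement i θ'‖ ≤ 3 * ‖θ - θ'‖ := by
  simp_rw [condIncrement, ← Finset.sum_sub_distrib, ← smul_sub]
  exact M.norm_sum_kronecker_smul_le (fun j => M.norm_increment_sub_le i j θ θ') i

lemma norm_condIncrement_le (i : S × S) (θs θ : EuclideanSpace ℝ (Fin d)) :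
    ‖M.condIncrement i θ‖ ≤ M.incrementBound θs θ :=
  M.norm_sum_kronecker_smul_le (fun j => M.norm_increment_le_incrementBound i j θs θ) i

end Increment

section MeanIncrement

lemma inner_condIncrement (x θ : EuclideanSpace ℝ (Fin d)) (i : S × S) :
    inner ℝ x (M.condIncrement i θ) =
      -(M.R i.1 + (M.Φ *ᵥ θ) i.1) * (M.Φ *ᵥ x) i.2 +
        (M.R i.1 + (M.P *ᵥ M.Φ *ᵥ θ) i.1 - (M.Φ *ᵥ θ) i.1) * (M.Φ *ᵥ x) i.1 := by
  set c := -(M.R i.1 + (M.Φ *ᵥ θ) i.1) * (M.Φ *ᵥ x) i.2 +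
    (M.R i.1 - (M.Φ *ᵥ θ) i.1) * (M.Φ *ᵥ x) i.1 with hc
  have hincr : ∀ j : S × S, inner ℝ x (M.increment i j θ) =
      c + (M.Φ *ᵥ θ) j.1 * (M.Φ *ᵥ x) i.1 := fun j => by
    simp only [hc, increment, f, g, inner_add_right, inner_smul_right, Φ_mulVec_apply]
    rw [real_inner_comm x (M.φ i.1), real_inner_comm x (M.φ i.2)]
    ring
  calc inner ℝ x (M.condIncrement i θ)
      = ∑ j, ∑ j', (M.P i.1 j * (c + (M.Φ *ᵥ θ) j * (M.Φ *ᵥ x) i.1)) * M.P i.2 j' := by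
        simp only [condIncrement, inner_sum, inner_smul_right, hincr, Fintype.sum_prod_type,
          kroneckerMap_apply, mul_right_comm]
    _ = c + (∑ j, M.P i.1 j * (M.Φ *ᵥ θ) j) * (M.Φ *ᵥ x) i.1 := by
        simp_rw [← Finset.mul_sum, M.P_sum, mul_one, mul_add, Finset.sum_add_distrib,
          ← mul_assoc, ← Finset.sum_mul, M.P_sum, one_mul]
    _ = _ := by
        rw [hc, show ∑ j, M.P i.1 j * (M.Φ *ᵥ θ) j = (M.P *ᵥ M.Φ *ᵥ θ) i.1 from rfl]
        ring

lemma inner_meanIncrement (hμ : μ ∈ stdSimplex ℝ S) (x θ : EuclideanSpace ℝ (Fin d)) :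
    inner ℝ x (M.meanIncrement μ θ) = M.linForm μ x - M.bilin μ x θ := by
  have hsplit : ∀ s s', μ s * μ s' * inner ℝ x (M.condIncrement (s, s') θ) =
      -(μ s * M.R s + μ s * (M.Φ *ᵥ θ) s) * (μ s' * (M.Φ *ᵥ x) s') +
      (μ s * (M.Φ *ᵥ x) s * M.R s -
        μ s * (M.Φ *ᵥ x) s * ((M.Φ *ᵥ θ) s - (M.P *ᵥ M.Φ *ᵥ θ) s)) * μ s' := fun s s' => by
    rw [inner_condIncrement]
    ring
  simp_rw [meanIncrement, inner_sum, inner_smul_right, Fintype.sum_prod_type, pairDist, hsplit,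
    Finset.sum_add_distrib, ← Finset.mul_sum, hμ.2, mul_one, ← Finset.sum_mul,
    Finset.sum_sub_distrib, Finset.sum_neg_distrib, Finset.sum_add_distrib]
  simp only [linForm, bilin, dotProduct]
  ring

lemma bilin_add_right (μ : S → ℝ) (x y z : EuclideanSpace ℝ (Fin d)) :
    M.bilin μ x (y + z) = M.bilin μ x y + M.bilin μ x z := by
  have hadd : M.Φ *ᵥ (y + z).ofLp = M.Φ *ᵥ y.ofLp + M.Φ *ᵥ z.ofLp := by
    rw [← mulVec_add, WithLp.ofLp_add]
  simp only [bilin, hadd, mulVec_add, Pi.add_apply, dotProduct_add, mul_add, mul_sub,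
    Finset.sum_add_distrib, Finset.sum_sub_distrib]
  ring

-- The mean increment at `θ` is minus the residual of the linear system, and the symmetric part of
-- the system matrix is the quadratic form whose minimum is `η`.
lemma inner_meanIncrement_le [DecidableEq S] (hμ : IsStationaryDist M.P μ)
    (hθs : M.IsFixedPoint μ θs) (θ : EuclideanSpace ℝ (Fin d)) :
    inner ℝ (θ - θs) (M.meanIncrement μ θ) ≤ -(M.eta μ * ‖θ - θs‖ ^ 2) := by
  have hbilin : M.bilin μ (θ - θs) θ = M.bilin μ (θ - θs) θs + M.bilin μ (θ - θs) (θ - θs) := by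
    rw [← bilin_add_right, add_sub_cancel]
  rw [inner_meanIncrement M hμ.1, hbilin, hθs.bilin_eq_linForm hμ, bilin_self hμ]
  linarith [eta_mul_sq_norm_le_energy (M := M) hμ.1.1 (θ - θs)]

end MeanIncrement

section Corrector

variable [DecidableEq S]

/-- The solution of the Poisson equation for the update direction. Adding
`2 α_t ⟪θ_t - θ*, corrector⟫` to `‖θ_t - θ*‖²` turns the Markovian noise into a difference. -/
noncomputable def corrector (μ : S → ℝ) (i : S × S) (θ : EuclideanSpace ℝ (Fin d)) :
    EuclideanSpace ℝ (Fin d) :=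
  ∑ k, deviationMatrix (M.P ⊗ₖ M.P) (pairDist μ) i k • M.condIncrement k θ

variable {M}

lemma norm_sum_deviationMatrix_smul_le {E : Type*} [NormedAddCommGroup E] [NormedSpace ℝ E]
    (hμ : μ ∈ stdSimplex ℝ S) (hmix : IsMixing M.P μ C β) {w : S × S → E} {r : ℝ}
    (hw : ∀ k, ‖w k‖ ≤ r) (i : S × S) :
    ‖∑ k, deviationMatrix (M.P ⊗ₖ M.P) (pairDist μ) i k • w k‖ ≤ 8 * L1 C β * r :=
  (norm_sum_smul_le hw).trans <| mul_le_mul_of_nonneg_right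
    (sum_abs_deviationMatrix_pair_le M.P_mem_rowStochastic hμ hmix i)
    ((norm_nonneg _).trans (hw i))

lemma norm_corrector_sub_le (hμ : μ ∈ stdSimplex ℝ S) (hmix : IsMixing M.P μ C β) (i : S × S)
    (θ θ' : EuclideanSpace ℝ (Fin d)) :
    ‖M.corrector μ i θ - M.corrector μ i θ'‖ ≤ 8 * L1 C β * (3 * ‖θ - θ'‖) := by
  simp_rw [corrector, ← Finset.sum_sub_distrib, ← smul_sub]
  exact norm_sum_deviationMatrix_smul_le hμ hmix (fun k => M.norm_condIncrement_sub_le k θ θ') i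

lemma norm_corrector_le (hμ : μ ∈ stdSimplex ℝ S) (hmix : IsMixing M.P μ C β) (i : S × S)
    (θs θ : EuclideanSpace ℝ (Fin d)) :
    ‖M.corrector μ i θ‖ ≤ 8 * L1 C β * M.incrementBound θs θ :=
  norm_sum_deviationMatrix_smul_le hμ hmix (fun k => M.norm_condIncrement_le k θs θ) i

variable (M) in
lemma continuous_corrector (μ : S → ℝ) (i : S × S) : Continuous (M.corrector μ i) := by
  have := M.continuous_increment
  unfold corrector condIncrement
  fun_prop

lemma sum_kronecker_smul_increment_add_corrector (hμ : μ ∈ stdSimplex ℝ S)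
    (hmix : IsMixing M.P μ C β) (i : S × S) (θ : EuclideanSpace ℝ (Fin d)) :
    ∑ j, (M.P ⊗ₖ M.P) i j • (M.increment i j θ + M.corrector μ j θ) =
      M.meanIncrement μ θ + M.corrector μ i θ := by
  set D := deviationMatrix (M.P ⊗ₖ M.P) (pairDist μ) with hD
  have hpoisson : ∀ k, ((M.P ⊗ₖ M.P) * D) i k =
      D i k - (1 : Matrix (S × S) (S × S) ℝ) i k + pairDist μ k := fun k => by
    have := congr_fun₂ (deviationMatrix_pair_sub_mul M.P_mem_rowStochastic hμ hmix) i k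
    simp only [Matrix.sub_apply, vecMulVec_apply, Pi.one_apply, one_mul, ← hD] at this
    linarith
  have hcorr : ∑ j, (M.P ⊗ₖ M.P) i j • M.corrector μ j θ =
      M.corrector μ i θ - M.condIncrement i θ + M.meanIncrement μ θ :=
    calc ∑ j, (M.P ⊗ₖ M.P) i j • M.corrector μ j θ
        = ∑ k, ((M.P ⊗ₖ M.P) * D) i k • M.condIncrement k θ := by
          simp_rw [corrector, mul_apply, Finset.smul_sum, Finset.sum_smul, smul_smul]
          exact Finset.sum_comm
      _ = M.corrector μ i θ - M.condIncrement i θ + M.meanIncrement μ θ := by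
          simp_rw [hpoisson, add_smul, sub_smul, Finset.sum_add_distrib, Finset.sum_sub_distrib]
          simp [corrector, meanIncrement, one_apply, hD]
  simp_rw [smul_add, Finset.sum_add_distrib, hcorr]
  rw [show ∑ j, (M.P ⊗ₖ M.P) i j • M.increment i j θ = M.condIncrement i θ from rfl]
  abel

end Corrector

end PolicyEvaluation

section FiniteIndex

variable {Ω : Type*} [MeasurableSpace Ω] {E : Type*} [MeasurableSpace E] {ι κ : Type*}
  [MeasurableSpace ι] [MeasurableSingletonClass ι] [MeasurableSpace κ] [MeasurableSingletonClass κ]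

lemma measurable_comp_finite_index [Finite ι] {γ : Type*} [MeasurableSpace γ] {ψ : ι → E → γ}
    (hψ : ∀ i, Measurable (ψ i)) {X : Ω → ι} (hX : Measurable X) {Y : Ω → E} (hY : Measurable Y) :
    Measurable fun ω => ψ (X ω) (Y ω) :=
  (measurable_from_prod_countable_left (f := fun p : E × ι => ψ p.2 p.1) hψ).comp (hY.prodMk hX)

variable {Pr : Measure Ω}

lemma integral_finite_index_of_indepFun [Fintype ι] {ψ : ι → E → ℝ}
    (hψ : ∀ i, Measurable (ψ i)) {X : Ω → ι} (hX : Measurable X) {Y : Ω → E} (hY : Measurable Y)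
    (hind : IndepFun Y X Pr)
    (hint : Integrable (fun ω => ψ (X ω) (Y ω)) Pr) :
    ∫ ω, ψ (X ω) (Y ω) ∂Pr = ∑ i, (∫ ω, ψ i (Y ω) ∂Pr) * Pr.real (X ⁻¹' {i}) := by
  classical
  have hmeas : ∀ i, MeasurableSet (X ⁻¹' {i}) := fun i => hX (measurableSet_singleton i)
  have hsum : ∀ ω, ψ (X ω) (Y ω) = ∑ i, ψ i (Y ω) * ({i} : Set ι).indicator 1 (X ω) := fun ω => by
    simp [Set.indicator_apply]
  have hint' : ∀ i, Integrable (fun ω => ψ i (Y ω) * ({i} : Set ι).indicator 1 (X ω)) Pr :=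
    fun i => (hint.indicator (hmeas i)).congr <| .of_forall fun ω => by
      by_cases h : X ω = i <;> simp [h]
  simp_rw [hsum]
  rw [integral_finsetSum _ fun i _ => hint' i]
  refine Finset.sum_congr rfl fun i _ => ?_
  rw [hind.integral_fun_comp_mul_comp (f := ψ i) (g := ({i} : Set ι).indicator 1)
    hY.aemeasurable hX.aemeasurable (hψ i).aestronglyMeasurable
    (measurable_one.indicator (measurableSet_singleton i)).aestronglyMeasurable,
    ← integral_indicator_one (hmeas i)]
  rfl

lemma integrable_comp_finite_index [Finite κ] {Ψ : κ → Ω → ℝ} {N : Ω → κ} (hN : Measurable N)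
    (hΨ : ∀ j, Integrable (Ψ j) Pr) : Integrable (fun ω => Ψ (N ω) ω) Pr := by
  classical
  have := Fintype.ofFinite κ
  have hsum : ∀ ω, Ψ (N ω) ω = ∑ j, (N ⁻¹' {j}).indicator (Ψ j) ω := fun ω => by
    simp [Set.indicator_apply]
  simp_rw [hsum]
  exact integrable_finsetSum _ fun j _ =>
    (hΨ j).indicator (hN (measurableSet_singleton j))

lemma integral_eq_integral_sum_of_conditional_law [Finite ι] [Fintype κ] {H : Ω → ι}
    {N : Ω → κ} {Y : Ω → E} (hH : Measurable H) (hN : Measurable N) (hY : Measurable Y)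
    (hind : IndepFun Y (fun ω => (H ω, N ω)) Pr) {K : ι → κ → ℝ}
    (hK : ∀ h j, Pr.real ((fun ω => (H ω, N ω)) ⁻¹' {(h, j)}) = Pr.real (H ⁻¹' {h}) * K h j)
    {Ψ : ι → κ → E → ℝ} (hΨ : ∀ h j, Measurable (Ψ h j))
    (hint : ∀ j, Integrable (fun ω => Ψ (H ω) j (Y ω)) Pr) :
    ∫ ω, Ψ (H ω) (N ω) (Y ω) ∂Pr = ∫ ω, ∑ j, K (H ω) j * Ψ (H ω) j (Y ω) ∂Pr := by
  have := Fintype.ofFinite ι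
  have hintK : ∀ j, Integrable (fun ω => K (H ω) j * Ψ (H ω) j (Y ω)) Pr := fun j =>
    integrable_comp_finite_index (Ψ := fun h ω => K h j * Ψ (H ω) j (Y ω)) hH
      fun h => (hint j).const_mul _
  have hindH : IndepFun Y H Pr := hind.comp measurable_id measurable_fst
  calc ∫ ω, Ψ (H ω) (N ω) (Y ω) ∂Pr
      = ∑ p : ι × κ, (∫ ω, Ψ p.1 p.2 (Y ω) ∂Pr) *
          Pr.real ((fun ω => (H ω, N ω)) ⁻¹' {p}) :=
        integral_finite_index_of_indepFun (ψ := fun p => Ψ p.1 p.2) (fun p => hΨ p.1 p.2)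
          (hH.prodMk hN) hY hind
          (integrable_comp_finite_index (Ψ := fun j ω => Ψ (H ω) j (Y ω)) hN hint)
    _ = ∑ j, ∑ h, (∫ ω, K h j * Ψ h j (Y ω) ∂Pr) * Pr.real (H ⁻¹' {h}) := by
        simp_rw [Fintype.sum_prod_type_right, hK, integral_const_mul]
        exact Finset.sum_congr rfl fun _ _ => Finset.sum_congr rfl fun _ _ => by ring
    _ = ∑ j, ∫ ω, K (H ω) j * Ψ (H ω) j (Y ω) ∂Pr :=
        Finset.sum_congr rfl fun j _ => (integral_finite_index_of_indepFun
          (ψ := fun h θ => K h j * Ψ h j θ) (fun h => (hΨ h j).const_mul _) hH hY hindH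
          (hintK j)).symm
    _ = ∫ ω, ∑ j, K (H ω) j * Ψ (H ω) j (Y ω) ∂Pr :=
        (integral_finsetSum _ fun j _ => hintK j).symm

end FiniteIndex

section History

variable {S : Type*} {Ω : Type*}

open scoped Kronecker

/-- The path of the chain `s` up to time `t`, as a random variable with finitely many values. -/
def history (s : ℕ → Ω → S) (t : ℕ) (ω : Ω) : Fin (t + 1) → S := fun i => s i ω

lemma history_ofNat {s : ℕ → Ω → S} {i t : ℕ} (hi : i ≤ t) (ω : Ω) :
    history s t ω (Fin.ofNat (t + 1) i) = s i ω := by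
  rw [history, Fin.val_ofNat, Nat.mod_eq_of_lt (Nat.lt_succ_of_le hi)]

lemma history_eq_iff {s : ℕ → Ω → S} {t : ℕ} {ω : Ω} {p : Fin (t + 1) → S} :
    history s t ω = p ↔ ∀ i ≤ t, s i ω = p (Fin.ofNat (t + 1) i) := by
  refine ⟨?_, fun h => funext fun i => ?_⟩
  · rintro rfl i hi
    exact (history_ofNat hi ω).symm
  · simpa [history] using h i (Nat.le_of_lt_succ i.2)

lemma measurable_history [MeasurableSpace S] [MeasurableSpace Ω] {s : ℕ → Ω → S}
    (hs : ∀ t, Measurable (s t)) (t : ℕ) : Measurable (history s t) :=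
  measurable_pi_lambda _ fun i => hs i

lemma IsMarkovChain.measure_history_inter [MeasurableSpace S] [MeasurableSpace Ω]
    {P : Matrix S S ℝ} {Pr : Measure Ω} {s : ℕ → Ω → S} (h : IsMarkovChain P Pr s) {t : ℕ}
    (p : Fin (t + 1) → S) (y : S) :
    Pr (history s t ⁻¹' {p} ∩ s (t + 1) ⁻¹' {y}) =
      Pr (history s t ⁻¹' {p}) * ENNReal.ofReal (P (p (Fin.last t)) y) := by
  set x : ℕ → S := fun i => if i ≤ t then p (Fin.ofNat (t + 1) i) else y
  have hx : ∀ i ≤ t, x i = p (Fin.ofNat (t + 1) i) := fun i hi => if_pos hi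
  have hxy : x (t + 1) = y := if_neg (by lia)
  have hpast : history s t ⁻¹' {p} = {ω | ∀ i ≤ t, s i ω = x i} := by
    ext ω
    exact history_eq_iff.trans (forall₂_congr fun i hi => by rw [hx i hi])
  have hnext : history s t ⁻¹' {p} ∩ s (t + 1) ⁻¹' {y} = {ω | ∀ i ≤ t + 1, s i ω = x i} := by
    rw [hpast]
    ext ω
    simp [Nat.le_succ_iff, or_imp, forall_and, hxy]
  have hlast : x t = p (Fin.last t) := by
    rw [hx t le_rfl]
    congr 1
    ext
    simp
  rw [hnext, hpast, h.2 t, hlast, hxy]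

lemma IsDoubleChain.measureReal_history_inter [Finite S] [MeasurableSpace S]
    [MeasurableSingletonClass S] [MeasurableSpace Ω] {d : ℕ} {P : Matrix S S ℝ} {Pr : Measure Ω}
    {s sHat : ℕ → Ω → S} {θ₀ : Ω → EuclideanSpace ℝ (Fin d)} (h : IsDoubleChain P Pr s sHat θ₀)
    (hP : ∀ x y, 0 ≤ P x y) {t : ℕ} (p : (Fin (t + 1) → S) × (Fin (t + 1) → S)) (j : S × S) :
    Pr.real ((fun ω => ((history s t ω, history sHat t ω), (s (t + 1) ω, sHat (t + 1) ω))) ⁻¹'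
        {(p, j)}) =
      Pr.real ((fun ω => (history s t ω, history sHat t ω)) ⁻¹' {p}) *
        (P ⊗ₖ P) (p.1 (Fin.last t), p.2 (Fin.last t)) j := by
  have hpast : Measurable fun (x : ℕ → S) (i : Fin (t + 1)) => x i := by fun_prop
  have hpre : Measurable fun x : ℕ → S => ((fun i : Fin (t + 1) => x i), x (t + 1)) := by fun_prop
  have hnow : Pr ((fun ω => (history s t ω, history sHat t ω)) ⁻¹' {p}) =
      Pr (history s t ⁻¹' {p.1}) * Pr (history sHat t ⁻¹' {p.2}) := by
    have hprod : Pr (history s t ⁻¹' {p.1} ∩ history sHat t ⁻¹' {p.2}) = _ :=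
      (h.indep.comp hpast hpast).measure_inter_preimage_eq_mul _ _ (measurableSet_singleton p.1)
        (measurableSet_singleton p.2)
    rw [show ({p} : Set _) = {p.1} ×ˢ {p.2} from Set.singleton_prod_singleton.symm,
      Set.mk_preimage_prod, hprod]
    rfl
  have hnext : Pr ((fun ω => ((history s t ω, history sHat t ω), (s (t + 1) ω, sHat (t + 1) ω))) ⁻¹'
        {(p, j)}) = Pr (history s t ⁻¹' {p.1} ∩ s (t + 1) ⁻¹' {j.1}) *
      Pr (history sHat t ⁻¹' {p.2} ∩ sHat (t + 1) ⁻¹' {j.2}) := by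
    have hprod : Pr ((fun ω => (history s t ω, s (t + 1) ω)) ⁻¹' ({p.1} ×ˢ {j.1}) ∩
          (fun ω => (history sHat t ω, sHat (t + 1) ω)) ⁻¹' ({p.2} ×ˢ {j.2})) =
        Pr ((fun ω => (history s t ω, s (t + 1) ω)) ⁻¹' ({p.1} ×ˢ {j.1})) *
          Pr ((fun ω => (history sHat t ω, sHat (t + 1) ω)) ⁻¹' ({p.2} ×ˢ {j.2})) :=
      (h.indep.comp hpre hpre).measure_inter_preimage_eq_mul _ _
        ((measurableSet_singleton _).prod (measurableSet_singleton _))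
        ((measurableSet_singleton _).prod (measurableSet_singleton _))
    simp only [Set.mk_preimage_prod] at hprod
    rw [← hprod]
    congr 1
    ext ω
    simp [Prod.ext_iff, and_and_and_comm]
  rw [measureReal_def, hnext, h.chain.measure_history_inter, h.chainHat.measure_history_inter,
    measureReal_def, hnow, Matrix.kroneckerMap_apply]
  simp only [ENNReal.toReal_mul, ENNReal.toReal_ofReal (hP _ _)]
  ring

end History

namespace PolicyEvaluation

open scoped Kronecker

variable {S : Type*} {A : Type*} [Fintype S] [Fintype A] {d : ℕ} (M : PolicyEvaluation S A d)
  {Ω : Type*} {α : ℕ → ℝ} {s sHat : ℕ → Ω → S} {θ₀ : Ω → EuclideanSpace ℝ (Fin d)}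

lemma iterate_succ (t : ℕ) (ω : Ω) :
    M.iterate α s sHat θ₀ (t + 1) ω = M.iterate α s sHat θ₀ t ω +
      α t • M.increment (s t ω, sHat t ω) (s (t + 1) ω, sHat (t + 1) ω)
        (M.iterate α s sHat θ₀ t ω) :=
  rfl

/-- The iterate at time `t` as a function of the histories `h` of the two chains up to time `t` and
of the initial parameter. -/
noncomputable def iterateOfHistory (α : ℕ → ℝ) {t : ℕ}
    (h : (Fin (t + 1) → S) × (Fin (t + 1) → S)) :
    EuclideanSpace ℝ (Fin d) → EuclideanSpace ℝ (Fin d) :=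
  M.iterate α (fun i _ => h.1 (Fin.ofNat (t + 1) i)) (fun i _ => h.2 (Fin.ofNat (t + 1) i)) id t

lemma iterate_eq_of_forall_le {x y : ℕ → S} {t : ℕ} {ω : Ω} (hx : ∀ i ≤ t, s i ω = x i)
    (hy : ∀ i ≤ t, sHat i ω = y i) :
    M.iterate α s sHat θ₀ t ω = M.iterate α (fun i _ => x i) (fun i _ => y i) id t (θ₀ ω) := by
  induction t with
  | zero => rfl
  | succ t ih =>
    rw [iterate_succ, iterate_succ, ih (fun i hi => hx i (hi.trans t.le_succ))
      (fun i hi => hy i (hi.trans t.le_succ)), hx t t.le_succ, hy t t.le_succ, hx _ le_rfl,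
      hy _ le_rfl]

lemma iterate_eq_iterateOfHistory (t : ℕ) (ω : Ω) :
    M.iterate α s sHat θ₀ t ω =
      M.iterateOfHistory α (history s t ω, history sHat t ω) (θ₀ ω) :=
  M.iterate_eq_of_forall_le (fun _ hi => (history_ofNat hi ω).symm)
    fun _ hi => (history_ofNat hi ω).symm

variable [MeasurableSpace S] [DiscreteMeasurableSpace S] [MeasurableSpace Ω] {Pr : Measure Ω}

lemma measurable_iterate (hs : ∀ t, Measurable (s t)) (hsHat : ∀ t, Measurable (sHat t))
    (hθ₀ : Measurable θ₀) (t : ℕ) : Measurable (M.iterate α s sHat θ₀ t) := by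
  induction t with
  | zero => exact hθ₀
  | succ t ih =>
    refine ih.add (Measurable.const_smul ?_ (α t))
    exact measurable_comp_finite_index (ι := (S × S) × (S × S))
      (ψ := fun p θ => M.increment p.1 p.2 θ)
      (fun p => (M.continuous_increment p.1 p.2).measurable)
      (((hs t).prodMk (hsHat t)).prodMk ((hs (t + 1)).prodMk (hsHat (t + 1)))) ih

lemma measurable_iterateOfHistory {t : ℕ} (h : (Fin (t + 1) → S) × (Fin (t + 1) → S)) :
    Measurable (M.iterateOfHistory α h) :=
  M.measurable_iterate (fun _ => measurable_const) (fun _ => measurable_const) measurable_id t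

lemma memLp_iterate [IsFiniteMeasure Pr] (hs : ∀ t, Measurable (s t))
    (hsHat : ∀ t, Measurable (sHat t)) (hθ₀ : Measurable θ₀) (hθ₀' : MemLp θ₀ 2 Pr) (t : ℕ) :
    MemLp (M.iterate α s sHat θ₀ t) 2 Pr := by
  have hmeas := M.measurable_iterate (α := α) hs hsHat hθ₀
  induction t with
  | zero => exact hθ₀'
  | succ t ih =>
    have hbound : MemLp (fun ω => |α t| * (2 * (M.rmax + 3 * ‖M.iterate α s sHat θ₀ t ω‖))) 2 Pr :=
      (((memLp_const M.rmax).add (ih.norm.const_mul 3)).const_mul 2).const_mul |α t|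
    have hdiff : MemLp (M.iterate α s sHat θ₀ (t + 1) - M.iterate α s sHat θ₀ t) 2 Pr :=
      hbound.mono' ((hmeas _).sub (hmeas _)).aestronglyMeasurable <| .of_forall fun ω => by
        rw [Pi.sub_apply, iterate_succ, add_sub_cancel_left, norm_smul, Real.norm_eq_abs]
        exact mul_le_mul_of_nonneg_left (M.norm_increment_le _ _ _) (abs_nonneg _)
    simpa only [add_sub_cancel] using ih.add hdiff

variable {M} in
lemma integral_markov_step (h : IsDoubleChain M.P Pr s sHat θ₀)
    {ψ : S × S → S × S → EuclideanSpace ℝ (Fin d) → ℝ} (hψ : ∀ i j, Measurable (ψ i j)) (t : ℕ)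
    (hint : ∀ j, Integrable (fun ω => ψ (s t ω, sHat t ω) j (M.iterate α s sHat θ₀ t ω)) Pr) :
    ∫ ω, ψ (s t ω, sHat t ω) (s (t + 1) ω, sHat (t + 1) ω) (M.iterate α s sHat θ₀ t ω) ∂Pr =
      ∫ ω, ∑ j, (M.P ⊗ₖ M.P) (s t ω, sHat t ω) j *
        ψ (s t ω, sHat t ω) j (M.iterate α s sHat θ₀ t ω) ∂Pr := by
  simp_rw [iterate_eq_iterateOfHistory] at hint ⊢
  have hs := h.chain.1
  have hsHat := h.chainHat.1
  have hpre : Measurable fun x : (ℕ → S) × (ℕ → S) =>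
      (((fun i : Fin (t + 1) => x.1 i), fun i : Fin (t + 1) => x.2 i),
        (x.1 (t + 1), x.2 (t + 1))) := by fun_prop
  exact integral_eq_integral_sum_of_conditional_law
    (H := fun ω => (history s t ω, history sHat t ω)) (N := fun ω => (s (t + 1) ω, sHat (t + 1) ω))
    (Ψ := fun p j θ => ψ (p.1 (Fin.last t), p.2 (Fin.last t)) j (M.iterateOfHistory α p θ))
    ((measurable_history hs t).prodMk (measurable_history hsHat t))
    ((hs (t + 1)).prodMk (hsHat (t + 1))) h.measurable_init
    (h.indep_init.comp measurable_id hpre) (h.measureReal_history_inter M.P_nonneg)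
    (fun p j => (hψ _ j).comp (M.measurable_iterateOfHistory p)) hint

end PolicyEvaluation

section LyapunovStep

variable {E : Type*} [NormedAddCommGroup E] [InnerProductSpace ℝ E]

lemma norm_add_smul_sq_add_two_mul_inner (x f v v' : E) (a a' : ℝ) :
    ‖x + a • f‖ ^ 2 + 2 * a' * inner ℝ (x + a • f) v' =
      ‖x‖ ^ 2 + 2 * a * inner ℝ x (f + v) + (a ^ 2 * ‖f‖ ^ 2 + 2 * (a - a') * -inner ℝ x v +
        2 * a' * inner ℝ x (v' - v) + 2 * a' * (a * inner ℝ f v')) := by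
  rw [norm_add_sq_real, inner_smul_right, norm_smul, mul_pow, Real.norm_eq_abs, sq_abs,
    inner_add_left, real_inner_smul_left, inner_sub_right, inner_add_right]
  ring

/- `v` and `v'` are the corrector before and after the step. Replacing `a' ⟪x + a f, v'⟫` by
`a ⟪x, v⟫` costs only second-order terms, because the corrector is Lipschitz. -/
lemma norm_add_smul_sq_add_two_mul_inner_le {x f v v' : E} {a a' Λ q : ℝ} (ha' : 0 ≤ a')
    (haa' : a' ≤ a) (ha : 3 * a ≤ 1) (hΛ : 1 ≤ Λ) (hx : 3 * ‖x‖ ≤ q) (hf : ‖f‖ ≤ q)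
    (hv : ‖v‖ ≤ Λ * q) (hv' : ‖v' - v‖ ≤ Λ * (3 * (a * q))) :
    ‖x + a • f‖ ^ 2 + 2 * a' * inner ℝ (x + a • f) v' ≤
      ‖x‖ ^ 2 + 2 * a * inner ℝ x (f + v) + (7 * a ^ 2 * Λ + (a - a') * Λ) * q ^ 2 := by
  have hq : 0 ≤ q := (norm_nonneg f).trans hf
  have ha₀ : 0 ≤ a := ha'.trans haa'
  have hδ : 0 ≤ a - a' := sub_nonneg.2 haa'
  have hx' : ‖x‖ ≤ q / 3 := by linarith
  have hv'_norm : ‖v'‖ ≤ 2 * Λ * q := by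
    have hstep : a * (3 * (Λ * q)) ≤ Λ * q := by nlinarith [mul_nonneg (zero_le_one.trans hΛ) hq]
    linarith [norm_sub_norm_le v' v]
  have hff : ‖f‖ ^ 2 ≤ Λ * q ^ 2 := (pow_le_pow_left₀ (norm_nonneg f) hf 2).trans
    (le_mul_of_one_le_left (sq_nonneg q) hΛ)
  have hxv : -inner ℝ x v ≤ q / 3 * (Λ * q) :=
    (neg_le_abs _).trans <| (abs_real_inner_le_norm x v).trans (by gcongr)
  have hxv' : inner ℝ x (v' - v) ≤ q / 3 * (Λ * (3 * (a * q))) :=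
    (real_inner_le_norm _ _).trans (by gcongr)
  have hfv' : inner ℝ f v' ≤ q * (2 * Λ * q) := (real_inner_le_norm _ _).trans (by gcongr)
  rw [norm_add_smul_sq_add_two_mul_inner x f v, add_le_add_iff_left]
  calc a ^ 2 * ‖f‖ ^ 2 + 2 * (a - a') * -inner ℝ x v + 2 * a' * inner ℝ x (v' - v) +
        2 * a' * (a * inner ℝ f v')
      ≤ a ^ 2 * (Λ * q ^ 2) + 2 * (a - a') * (q / 3 * (Λ * q)) +
        2 * a' * (q / 3 * (Λ * (3 * (a * q)))) + 2 * a' * (a * (q * (2 * Λ * q))) := by gcongr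
    _ ≤ a ^ 2 * (Λ * q ^ 2) + 2 * (a - a') * (q / 3 * (Λ * q)) +
        2 * a * (q / 3 * (Λ * (3 * (a * q)))) + 2 * a * (a * (q * (2 * Λ * q))) := by gcongr
    _ = (7 * a ^ 2 * Λ + 2 / 3 * ((a - a') * Λ)) * q ^ 2 := by ring
    _ ≤ (7 * a ^ 2 * Λ + (a - a') * Λ) * q ^ 2 := by
        refine mul_le_mul_of_nonneg_right ?_ (sq_nonneg q)
        linarith [mul_nonneg hδ (zero_le_one.trans hΛ)]

lemma le_one_sub_mul_add_of_abs_sub_le {W W' e G a δ η Λ : ℝ} (he : 0 ≤ e) (ha : 0 ≤ a)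
    (hΛ : 0 ≤ Λ) (hη : 0 ≤ η) (hη₂ : η ≤ 2) (haΛ : 64 * (a * Λ) ≤ 1)
    (hdrift : 18 * (7 * a ^ 2 * Λ + δ * Λ) ≤ 3 / 4 * (η * a))
    (hstep : W' ≤ W - 2 * a * (η * e) + (7 * a ^ 2 * Λ + δ * Λ) * (8 * G ^ 2 + 18 * e))
    (hW : |W - e| ≤ 2 * (a * Λ) * (G ^ 2 + 4 * e)) :
    W' ≤ (1 - η * a) * W + G ^ 2 * Λ * (60 * a ^ 2 + 8 * δ) := by
  have hWe : W ≤ 5 / 4 * e + 2 * (a * Λ) * G ^ 2 := by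
    nlinarith [(abs_le.1 hW).2]
  have hnoise : (7 * a ^ 2 * Λ + δ * Λ) * (18 * e) ≤ 3 / 4 * (η * a) * e := by
    nlinarith
  have hηW : η * a * W ≤ η * a * (5 / 4 * e + 2 * (a * Λ) * G ^ 2) := by gcongr
  have hcross : η * (2 * (a ^ 2 * Λ * G ^ 2)) ≤ 2 * (2 * (a ^ 2 * Λ * G ^ 2)) := by gcongr
  linarith

end LyapunovStep

/-- The conditions on the stepsizes `α_t` under which the corrected Lyapunov function contracts,
where `η` is the strong monotonicity constant of the mean update direction and `Λ` is the bound
for the solution of the Poisson equation. -/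
structure IsAdmissibleStepsize (α : ℕ → ℝ) (η Λ : ℝ) : Prop where
  nonneg : ∀ t, 0 ≤ α t
  succ_le : ∀ t, α (t + 1) ≤ α t
  mul_le : ∀ t, 64 * (α t * Λ) ≤ 1
  drift : ∀ t, 18 * (7 * α t ^ 2 * Λ + (α t - α (t + 1)) * Λ) ≤ 3 / 4 * (η * α t)

namespace PolicyEvaluation

open scoped Kronecker

variable {S : Type*} {A : Type*} [Fintype S] [Fintype A] [DecidableEq S] {d : ℕ}
  (M : PolicyEvaluation S A d) {μ : S → ℝ} {C β a a' : ℝ} {θs : EuclideanSpace ℝ (Fin d)}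

/-- The squared distance to `θs = θ*`, corrected by the solution of the Poisson equation; `a` is the
current stepsize and `i` the current state of the pair chain. -/
noncomputable def lyapunov (μ : S → ℝ) (θs : EuclideanSpace ℝ (Fin d)) (a : ℝ) (i : S × S)
    (θ : EuclideanSpace ℝ (Fin d)) : ℝ :=
  ‖θ - θs‖ ^ 2 + 2 * a * inner ℝ (θ - θs) (M.corrector μ i θ)

lemma continuous_lyapunov (μ : S → ℝ) (θs : EuclideanSpace ℝ (Fin d)) (a : ℝ) (i : S × S) :
    Continuous (M.lyapunov μ θs a i) := by
  have := M.continuous_corrector μ i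
  unfold lyapunov
  fun_prop

variable {M}

lemma abs_lyapunov_sub_le (hμ : μ ∈ stdSimplex ℝ S) (hmix : IsMixing M.P μ C β) (ha : 0 ≤ a)
    (i : S × S) (θs θ : EuclideanSpace ℝ (Fin d)) :
    |M.lyapunov μ θs a i θ - ‖θ - θs‖ ^ 2| ≤
      2 * (a * (8 * L1 C β)) * ((M.rmax + 3 * ‖θs‖) ^ 2 + 4 * ‖θ - θs‖ ^ 2) := by
  have hL : 0 ≤ 8 * L1 C β := by linarith [one_le_L1 C β]
  have hq : ‖θ - θs‖ * M.incrementBound θs θ ≤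
      (M.rmax + 3 * ‖θs‖) ^ 2 + 4 * ‖θ - θs‖ ^ 2 := by
    rw [incrementBound]
    nlinarith [sq_nonneg ((M.rmax + 3 * ‖θs‖) - ‖θ - θs‖)]
  rw [lyapunov, add_sub_cancel_left, abs_mul, abs_of_nonneg (by positivity : 0 ≤ 2 * a)]
  calc 2 * a * |inner ℝ (θ - θs) (M.corrector μ i θ)|
      ≤ 2 * a * (‖θ - θs‖ * (8 * L1 C β * M.incrementBound θs θ)) := by
        gcongr
        exact (abs_real_inner_le_norm _ _).trans (by gcongr; exact norm_corrector_le hμ hmix i θs θ)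
    _ = 2 * (a * (8 * L1 C β)) * (‖θ - θs‖ * M.incrementBound θs θ) := by ring
    _ ≤ _ := by gcongr

lemma lyapunov_step_le (hμ : μ ∈ stdSimplex ℝ S) (hmix : IsMixing M.P μ C β) (ha' : 0 ≤ a')
    (haa' : a' ≤ a) (ha : 3 * a ≤ 1) (i j : S × S) (θs θ : EuclideanSpace ℝ (Fin d)) :
    M.lyapunov μ θs a' j (θ + a • M.increment i j θ) ≤
      ‖θ - θs‖ ^ 2 + 2 * a * inner ℝ (θ - θs) (M.increment i j θ + M.corrector μ j θ) +
        (7 * a ^ 2 * (8 * L1 C β) + (a - a') * (8 * L1 C β)) * M.incrementBound θs θ ^ 2 := by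
  have hL : 1 ≤ 8 * L1 C β := by linarith [one_le_L1 C β]
  have hincr := M.norm_increment_le_incrementBound i j θs θ
  have hmove : ‖θ + a • M.increment i j θ - θ‖ ≤ a * M.incrementBound θs θ := by
    rw [add_sub_cancel_left, norm_smul, Real.norm_eq_abs, abs_of_nonneg (ha'.trans haa')]
    exact mul_le_mul_of_nonneg_left hincr (ha'.trans haa')
  rw [lyapunov, add_sub_right_comm]
  exact norm_add_smul_sq_add_two_mul_inner_le ha' haa' ha hL
    (M.three_mul_norm_sub_le_incrementBound θs θ) hincr (norm_corrector_le hμ hmix j θs θ)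
    ((norm_corrector_sub_le hμ hmix j _ θ).trans (by gcongr))

omit [DecidableEq S] in
lemma incrementBound_sq_le (θs θ : EuclideanSpace ℝ (Fin d)) :
    M.incrementBound θs θ ^ 2 ≤ 8 * (M.rmax + 3 * ‖θs‖) ^ 2 + 18 * ‖θ - θs‖ ^ 2 := by
  rw [incrementBound]
  nlinarith [sq_nonneg (2 * (M.rmax + 3 * ‖θs‖) - 3 * ‖θ - θs‖)]

lemma sum_kronecker_mul_inner_increment_add_corrector_le (hμ : IsStationaryDist M.P μ)
    (hmix : IsMixing M.P μ C β) (hθs : M.IsFixedPoint μ θs) (i : S × S)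
    (θ : EuclideanSpace ℝ (Fin d)) :
    ∑ j, (M.P ⊗ₖ M.P) i j * inner ℝ (θ - θs) (M.increment i j θ + M.corrector μ j θ) ≤
      inner ℝ (θ - θs) (M.corrector μ i θ) - M.eta μ * ‖θ - θs‖ ^ 2 := by
  simp_rw [← real_inner_smul_right, ← inner_sum]
  rw [sum_kronecker_smul_increment_add_corrector hμ.1 hmix, inner_add_right]
  linarith [M.inner_meanIncrement_le hμ hθs θ]

lemma sum_kronecker_mul_lyapunov_le (hμ : IsStationaryDist M.P μ) (hmix : IsMixing M.P μ C β)
    (hθs : M.IsFixedPoint μ θs) (ha' : 0 ≤ a') (haa' : a' ≤ a) (ha : 3 * a ≤ 1) (i : S × S)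
    (θ : EuclideanSpace ℝ (Fin d)) :
    ∑ j, (M.P ⊗ₖ M.P) i j * M.lyapunov μ θs a' j (θ + a • M.increment i j θ) ≤
      M.lyapunov μ θs a i θ - 2 * a * (M.eta μ * ‖θ - θs‖ ^ 2) +
        (7 * a ^ 2 * (8 * L1 C β) + (a - a') * (8 * L1 C β)) *
          (8 * (M.rmax + 3 * ‖θs‖) ^ 2 + 18 * ‖θ - θs‖ ^ 2) := by
  have hL : 0 ≤ 8 * L1 C β := by linarith [one_le_L1 C β]
  have : 0 ≤ a - a' := sub_nonneg.2 haa'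
  have ha₀ : 0 ≤ a := ha'.trans haa'
  have hQ := kronecker_self_mem_rowStochastic M.P_mem_rowStochastic
  set c := 7 * a ^ 2 * (8 * L1 C β) + (a - a') * (8 * L1 C β)
  calc ∑ j, (M.P ⊗ₖ M.P) i j * M.lyapunov μ θs a' j (θ + a • M.increment i j θ)
      ≤ ∑ j, (M.P ⊗ₖ M.P) i j * (‖θ - θs‖ ^ 2 +
          2 * a * inner ℝ (θ - θs) (M.increment i j θ + M.corrector μ j θ) +
          c * M.incrementBound θs θ ^ 2) :=
        Finset.sum_le_sum fun j _ => mul_le_mul_of_nonneg_left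
          (lyapunov_step_le hμ.1 hmix ha' haa' ha i j θs θ) (hQ.1 i j)
    _ = ‖θ - θs‖ ^ 2 + 2 * a * ∑ j, (M.P ⊗ₖ M.P) i j *
          inner ℝ (θ - θs) (M.increment i j θ + M.corrector μ j θ) +
          c * M.incrementBound θs θ ^ 2 := by
        simp_rw [mul_add, Finset.sum_add_distrib, ← Finset.sum_mul,
          Matrix.sum_row_of_mem_rowStochastic hQ, one_mul, Finset.mul_sum, mul_left_comm (2 * a)]
    _ ≤ ‖θ - θs‖ ^ 2 + 2 * a * (inner ℝ (θ - θs) (M.corrector μ i θ) -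
          M.eta μ * ‖θ - θs‖ ^ 2) +
          c * (8 * (M.rmax + 3 * ‖θs‖) ^ 2 + 18 * ‖θ - θs‖ ^ 2) := by
        gcongr
        · exact sum_kronecker_mul_inner_increment_add_corrector_le hμ hmix hθs i θ
        · exact incrementBound_sq_le θs θ
    _ = _ := by rw [lyapunov]; ring

lemma sum_kronecker_mul_lyapunov_le_one_sub_mul {α : ℕ → ℝ} (hμ : IsStationaryDist M.P μ)
    (hη : 0 < M.eta μ) (hmix : IsMixing M.P μ C β) (hθs : M.IsFixedPoint μ θs)
    (hα : IsAdmissibleStepsize α (M.eta μ) (8 * L1 C β)) (t : ℕ) (i : S × S)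
    (θ : EuclideanSpace ℝ (Fin d)) :
    ∑ j, (M.P ⊗ₖ M.P) i j * M.lyapunov μ θs (α (t + 1)) j (θ + α t • M.increment i j θ) ≤
      (1 - M.eta μ * α t) * M.lyapunov μ θs (α t) i θ +
        (M.rmax + 3 * ‖θs‖) ^ 2 * (8 * L1 C β) * (60 * α t ^ 2 + 8 * (α t - α (t + 1))) := by
  have hL := one_le_L1 C β
  have hαt : 3 * α t ≤ 1 := by nlinarith [hα.nonneg t, hα.mul_le t]
  exact le_one_sub_mul_add_of_abs_sub_le (sq_nonneg ‖θ - θs‖) (hα.nonneg t) (by linarith) hη.le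
    (eta_le_two (dim_pos_of_eta_pos hη) hμ) (hα.mul_le t) (hα.drift t)
    (sum_kronecker_mul_lyapunov_le hμ hmix hθs (hα.nonneg _) (hα.succ_le t) hαt i θ)
    (abs_lyapunov_sub_le hμ.1 hmix (hα.nonneg t) i θs θ)

section Expectation

variable {Ω : Type*} [MeasurableSpace Ω] {Pr : Measure Ω} [IsProbabilityMeasure Pr]
  {X : Ω → EuclideanSpace ℝ (Fin d)}

omit [DecidableEq S] in
lemma memLp_increment_comp (hX : MemLp X 2 Pr) (i j : S × S) :
    MemLp (fun ω => M.increment i j (X ω)) 2 Pr :=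
  (((memLp_const M.rmax).add (hX.norm.const_mul 3)).const_mul 2).mono'
    ((M.continuous_increment i j).comp_aestronglyMeasurable hX.1)
    (.of_forall fun ω => M.norm_increment_le i j (X ω))

lemma integrable_norm_sub_sq (hX : MemLp X 2 Pr) (θs : EuclideanSpace ℝ (Fin d)) :
    Integrable (fun ω => ‖X ω - θs‖ ^ 2) Pr :=
  (hX.sub (memLp_const θs)).integrable_norm_pow two_ne_zero

lemma integrable_lyapunov_comp (hμ : μ ∈ stdSimplex ℝ S) (hmix : IsMixing M.P μ C β) (ha : 0 ≤ a)
    (hX : MemLp X 2 Pr) (θs : EuclideanSpace ℝ (Fin d)) (i : S × S) :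
    Integrable (fun ω => M.lyapunov μ θs a i (X ω)) Pr := by
  have hE := integrable_norm_sub_sq hX θs
  refine (hE.add (((integrable_const ((M.rmax + 3 * ‖θs‖) ^ 2)).add (hE.const_mul 4)).const_mul
    (2 * (a * (8 * L1 C β))))).mono'
    ((M.continuous_lyapunov μ θs a i).comp_aestronglyMeasurable hX.1) (.of_forall fun ω => ?_)
  have habs := abs_lyapunov_sub_le hμ hmix ha i θs (X ω)
  have htri := abs_sub_abs_le_abs_sub (M.lyapunov μ θs a i (X ω)) (‖X ω - θs‖ ^ 2)
  rw [abs_of_nonneg (sq_nonneg ‖X ω - θs‖)] at htri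
  simp only [Real.norm_eq_abs, Pi.add_apply]
  linarith

variable [MeasurableSpace S] [MeasurableSingletonClass S]

lemma abs_integral_lyapunov_sub_le (hμ : μ ∈ stdSimplex ℝ S) (hmix : IsMixing M.P μ C β)
    (ha : 0 ≤ a) (hX : MemLp X 2 Pr) {Y : Ω → S × S} (hY : Measurable Y)
    (θs : EuclideanSpace ℝ (Fin d)) :
    |∫ ω, M.lyapunov μ θs a (Y ω) (X ω) ∂Pr - ∫ ω, ‖X ω - θs‖ ^ 2 ∂Pr| ≤
      2 * (a * (8 * L1 C β)) * ((M.rmax + 3 * ‖θs‖) ^ 2 + 4 * ∫ ω, ‖X ω - θs‖ ^ 2 ∂Pr) := by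
  have hE := integrable_norm_sub_sq hX θs
  have hW := integrable_comp_finite_index (Ψ := fun i ω => M.lyapunov μ θs a i (X ω)) hY
    fun i => integrable_lyapunov_comp hμ hmix ha hX θs i
  rw [← integral_sub hW hE, ← Real.norm_eq_abs]
  refine (norm_integral_le_of_norm_le (((integrable_const _).add (hE.const_mul 4)).const_mul _)
    (.of_forall fun ω => abs_lyapunov_sub_le hμ hmix ha (Y ω) θs (X ω))).trans_eq ?_
  rw [integral_const_mul, integral_add' (integrable_const _) (hE.const_mul 4),
    integral_const_mul, integral_const, probReal_univ, one_smul]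

variable {s sHat : ℕ → Ω → S} {θ₀ : Ω → EuclideanSpace ℝ (Fin d)} {α : ℕ → ℝ}

omit [MeasurableSingletonClass S] in
lemma integral_lyapunov_succ_le [DiscreteMeasurableSpace S] (hμ : IsStationaryDist M.P μ)
    (hη : 0 < M.eta μ) (hmix : IsMixing M.P μ C β) (hθs : M.IsFixedPoint μ θs)
    (h : IsDoubleChain M.P Pr s sHat θ₀) (hα : IsAdmissibleStepsize α (M.eta μ) (8 * L1 C β))
    (t : ℕ) :
    ∫ ω, M.lyapunov μ θs (α (t + 1)) (s (t + 1) ω, sHat (t + 1) ω)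
        (M.iterate α s sHat θ₀ (t + 1) ω) ∂Pr ≤
      (1 - M.eta μ * α t) * ∫ ω, M.lyapunov μ θs (α t) (s t ω, sHat t ω)
          (M.iterate α s sHat θ₀ t ω) ∂Pr +
        (M.rmax + 3 * ‖θs‖) ^ 2 * (8 * L1 C β) * (60 * α t ^ 2 + 8 * (α t - α (t + 1))) := by
  have hY : Measurable fun ω => (s t ω, sHat t ω) := (h.chain.1 t).prodMk (h.chainHat.1 t)
  have hX : MemLp (M.iterate α s sHat θ₀ t) 2 Pr :=
    M.memLp_iterate h.chain.1 h.chainHat.1 h.measurable_init h.memLp_init t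
  have hW := integrable_comp_finite_index
    (Ψ := fun i ω => M.lyapunov μ θs (α t) i (M.iterate α s sHat θ₀ t ω)) hY
    fun i => integrable_lyapunov_comp hμ.1 hmix (hα.nonneg t) hX θs i
  set ψ : S × S → S × S → EuclideanSpace ℝ (Fin d) → ℝ :=
    fun i j θ => M.lyapunov μ θs (α (t + 1)) j (θ + α t • M.increment i j θ)
  have hψ : ∀ i j, Measurable (ψ i j) := fun i j =>
    ((M.continuous_lyapunov μ θs _ j).comp
      (continuous_id.add ((M.continuous_increment i j).const_smul (α t)))).measurable
  have hψint : ∀ i j, Integrable (fun ω => ψ i j (M.iterate α s sHat θ₀ t ω)) Pr := fun i j =>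
    integrable_lyapunov_comp hμ.1 hmix (hα.nonneg _)
      (hX.add ((memLp_increment_comp hX i j).const_smul (α t))) θs j
  calc ∫ ω, ψ (s t ω, sHat t ω) (s (t + 1) ω, sHat (t + 1) ω) (M.iterate α s sHat θ₀ t ω) ∂Pr
      = ∫ ω, ∑ j, (M.P ⊗ₖ M.P) (s t ω, sHat t ω) j *
          ψ (s t ω, sHat t ω) j (M.iterate α s sHat θ₀ t ω) ∂Pr :=
        integral_markov_step h hψ t fun j => integrable_comp_finite_index
          (Ψ := fun i ω => ψ i j (M.iterate α s sHat θ₀ t ω)) hY fun i => hψint i j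
    _ ≤ ∫ ω, ((1 - M.eta μ * α t) *
          M.lyapunov μ θs (α t) (s t ω, sHat t ω) (M.iterate α s sHat θ₀ t ω) +
          (M.rmax + 3 * ‖θs‖) ^ 2 * (8 * L1 C β) * (60 * α t ^ 2 + 8 * (α t - α (t + 1)))) ∂Pr :=
        integral_mono
          (integrable_comp_finite_index (Ψ := fun i ω => ∑ j, (M.P ⊗ₖ M.P) i j *
            ψ i j (M.iterate α s sHat θ₀ t ω)) hY fun i =>
              integrable_finsetSum _ fun j _ => (hψint i j).const_mul _)
          ((hW.const_mul _).add (integrable_const _))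
          fun ω => sum_kronecker_mul_lyapunov_le_one_sub_mul hμ hη hmix hθs hα t _ _
    _ = _ := by
        rw [integral_add (hW.const_mul _) (integrable_const _), integral_const_mul,
          integral_const, probReal_univ, one_smul]

end Expectation

end PolicyEvaluation

section Scalar

/-- Supersolutions `H`, `v` of the scalar recursion
`w (t + 1) = (1 - η * α t) * w t + B * (60 * α t ^ 2 + 8 * (α t - α (t + 1)))` satisfied by the
expected Lyapunov function: `H` dominates the homogeneous solution starting at `1`, and `B * v`
the contribution of the noise. -/
structure IsSupersolution (η : ℝ) (α H v : ℕ → ℝ) : Prop where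
  init : H 0 = 1
  decay_le : ∀ t, (1 - η * α t) * H t ≤ H (t + 1)
  noise_init : 0 ≤ v 0
  noise_le : ∀ t, (1 - η * α t) * v t + (60 * α t ^ 2 + 8 * (α t - α (t + 1))) ≤ v (t + 1)

namespace IsSupersolution

variable {η : ℝ} {α H v : ℕ → ℝ}

lemma nonneg (h : IsSupersolution η α H v) (hα : ∀ t, η * α t ≤ 1) (t : ℕ) : 0 ≤ H t := by
  induction t with
  | zero => exact h.init ▸ zero_le_one
  | succ t ih => exact (mul_nonneg (sub_nonneg.2 (hα t)) ih).trans (h.decay_le t)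

lemma noise_nonneg (h : IsSupersolution η α H v) (hα : ∀ t, η * α t ≤ 1)
    (hα' : ∀ t, α (t + 1) ≤ α t) (t : ℕ) : 0 ≤ v t := by
  induction t with
  | zero => exact h.noise_init
  | succ t ih =>
    have hdecay := mul_nonneg (sub_nonneg.2 (hα t)) ih
    linarith [h.noise_le t, hα' t, sq_nonneg (α t)]

lemma le_of_recursion (h : IsSupersolution η α H v) (hα : ∀ t, η * α t ≤ 1) {W : ℕ → ℝ} {B w : ℝ}
    (hB : 0 ≤ B) (hw : 0 ≤ w) (hW₀ : W 0 ≤ w)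
    (hW : ∀ t, W (t + 1) ≤
      (1 - η * α t) * W t + B * (60 * α t ^ 2 + 8 * (α t - α (t + 1)))) (t : ℕ) :
    W t ≤ w * H t + B * v t := by
  induction t with
  | zero =>
    rw [h.init]
    linarith [mul_nonneg hB h.noise_init]
  | succ t ih =>
    have hstep := mul_le_mul_of_nonneg_left ih (sub_nonneg.2 (hα t))
    have hdecay := mul_le_mul_of_nonneg_left (h.decay_le t) hw
    have hnoise := mul_le_mul_of_nonneg_left (h.noise_le t) hB
    linarith [hW t]

end IsSupersolution

lemma one_sub_div_le_rpow {m x : ℝ} (hm : 0 ≤ m) (hx : 0 < x) :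
    1 - m / x ≤ (x / (x + 1)) ^ m := by
  have hlog : -(1 / x) ≤ Real.log (x / (x + 1)) := by
    have h := Real.one_sub_inv_le_log_of_pos (x := x / (x + 1)) (by positivity)
    rwa [inv_div, add_div, div_self hx.ne', sub_add_cancel_left] at h
  calc 1 - m / x = -(1 / x) * m + 1 := by ring
    _ ≤ Real.log (x / (x + 1)) * m + 1 := by gcongr
    _ ≤ Real.exp (Real.log (x / (x + 1)) * m) := Real.add_one_le_exp _
    _ = (x / (x + 1)) ^ m := (Real.rpow_def_of_pos (by positivity) m).symm

lemma add_one_rpow_sub_le {ξ x : ℝ} (hξ0 : 0 ≤ ξ) (hξ : ξ ≤ 1) (hx : 0 < x) :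
    (x + 1) ^ (1 - ξ) - x ^ (1 - ξ) ≤ (1 - ξ) / x ^ ξ := by
  have hx' : 0 < 1 / x := by positivity
  rw [sub_le_iff_le_add']
  calc (x + 1) ^ (1 - ξ) = x ^ (1 - ξ) * (1 + 1 / x) ^ (1 - ξ) := by
        rw [← Real.mul_rpow hx.le (by positivity), mul_add, mul_one, mul_one_div_cancel hx.ne']
    _ ≤ x ^ (1 - ξ) * (1 + (1 - ξ) * (1 / x)) := by
        gcongr
        exact rpow_one_add_le_one_add_mul_self (by linarith) (by linarith) (by linarith)
    _ = x ^ (1 - ξ) + (1 - ξ) / x ^ ξ := by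
        rw [Real.rpow_sub hx, Real.rpow_one]
        field_simp

section Supersolution

variable {m k x : ℝ}

lemma supersolution_div (hm : 1 < m) (hk : 0 ≤ k) (hx : 0 < x) :
    (1 - m / x) * (k / ((m - 1) * x)) + k / x ^ 2 ≤ k / ((m - 1) * (x + 1)) := by
  have hm' : 0 < m - 1 := by linarith
  have hgap : k / ((m - 1) * (x + 1)) - ((1 - m / x) * (k / ((m - 1) * x)) + k / x ^ 2) =
      k / ((m - 1) * x ^ 2 * (x + 1)) := by
    field_simp
    ring
  have hgap_nonneg : 0 ≤ k / ((m - 1) * x ^ 2 * (x + 1)) := by positivity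
  linarith

lemma log_add_inv_le_log_add_one (hx : 0 < x) :
    Real.log x + 1 / (x + 1) ≤ Real.log (x + 1) := by
  have h := Real.one_sub_inv_le_log_of_pos (x := (x + 1) / x) (by positivity)
  rw [Real.log_div (by positivity) hx.ne', inv_div] at h
  have heq : 1 - x / (x + 1) = 1 / (x + 1) := by
    field_simp
    ring
  linarith

lemma two_le_log_of_eight_le (hx : 8 ≤ x) : 2 ≤ Real.log x := by
  have hlog8 : Real.log 8 = 3 * Real.log 2 := by
    rw [show (8 : ℝ) = 2 ^ 3 by norm_num, Real.log_pow]
    norm_num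
  linarith [Real.log_two_gt_d9, Real.log_le_log (by norm_num) hx]

lemma supersolution_log_div (hm : 1 ≤ m) (hk : 0 ≤ k) (hx : 8 ≤ x) :
    (1 - m / x) * (k * Real.log x / x) + k / x ^ 2 ≤ k * Real.log (x + 1) / (x + 1) := by
  have hx0 : 0 < x := by linarith
  have hlog := two_le_log_of_eight_le hx
  have hgap : 0 ≤ k * ((x + 1) * (Real.log x - 2) + 1) / (x ^ 2 * (x + 1) ^ 2) := by
    have := mul_nonneg (by linarith : 0 ≤ x + 1) (sub_nonneg.2 hlog)
    positivity
  calc (1 - m / x) * (k * Real.log x / x) + k / x ^ 2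
      ≤ (1 - 1 / x) * (k * Real.log x / x) + k / x ^ 2 := by gcongr
    _ ≤ (1 - 1 / x) * (k * Real.log x / x) + k / x ^ 2 +
          k * ((x + 1) * (Real.log x - 2) + 1) / (x ^ 2 * (x + 1) ^ 2) :=
        le_add_of_nonneg_right hgap
    _ = k * (Real.log x + 1 / (x + 1)) / (x + 1) := by
        field_simp
        ring
    _ ≤ k * Real.log (x + 1) / (x + 1) := by
        gcongr
        exact log_add_inv_le_log_add_one hx0

lemma supersolution_rpow_sub_inv (hm0 : 0 ≤ m) (hm : m < 1) (hk : 0 ≤ k) (hx0 : 0 < x)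
    (hx : 2 / (1 - m) ≤ x) :
    (1 - m / x) * (2 * k / (1 - m) * (x ^ (-m) - x⁻¹)) + k / x ^ 2 ≤
      2 * k / (1 - m) * ((x + 1) ^ (-m) - (x + 1)⁻¹) := by
  have hm' : 0 < 1 - m := by linarith
  have hpow : (1 - m / x) * x ^ (-m) ≤ (x + 1) ^ (-m) :=
    calc (1 - m / x) * x ^ (-m) ≤ (x / (x + 1)) ^ m * x ^ (-m) := by
          gcongr
          exact one_sub_div_le_rpow hm0 hx0
      _ = (x + 1) ^ (-m) := by
          rw [Real.div_rpow hx0.le (by positivity), Real.rpow_neg hx0.le,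
            Real.rpow_neg (by positivity)]
          field_simp
  have hinv : k / x ^ 2 ≤ 2 * k / (1 - m) * ((1 - m / x) * x⁻¹ - (x + 1)⁻¹) := by
    have hgap : 2 * k / (1 - m) * ((1 - m / x) * x⁻¹ - (x + 1)⁻¹) - k / x ^ 2 =
        k * ((1 - m) * x - (1 + m)) / ((1 - m) * x ^ 2 * (x + 1)) := by
      field_simp
      ring
    rw [div_le_iff₀ hm'] at hx
    have hgap_nonneg : 0 ≤ k * ((1 - m) * x - (1 + m)) / ((1 - m) * x ^ 2 * (x + 1)) :=
      div_nonneg (mul_nonneg hk (by linarith)) (by positivity)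
    linarith
  have := mul_le_mul_of_nonneg_left hpow (by positivity : 0 ≤ 2 * k / (1 - m))
  linarith

end Supersolution

section Stepsize

variable {a c₀ ξ η : ℝ}

lemma cast_succ_add (t : ℕ) (c : ℝ) : ((t + 1 : ℕ) : ℝ) + c = t + c + 1 := by
  push_cast
  ring

lemma le_cast_add (t : ℕ) (c : ℝ) : c ≤ t + c := le_add_of_nonneg_left t.cast_nonneg

lemma stepsize_one (t : ℕ) : stepsize a c₀ 1 t = a / (t + c₀) := by
  rw [stepsize, Real.rpow_one]

lemma stepsize_pos (ha : 0 < a) (hc : 0 < c₀) (t : ℕ) : 0 < stepsize a c₀ ξ t :=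
  div_pos ha (Real.rpow_pos_of_pos (by positivity) _)

lemma stepsize_le (ha : 0 ≤ a) (hc : 0 < c₀) (hξ : 0 ≤ ξ) (t : ℕ) :
    stepsize a c₀ ξ t ≤ a / c₀ ^ ξ := by
  unfold stepsize
  gcongr
  exact le_cast_add t c₀

lemma stepsize_succ_le (ha : 0 ≤ a) (hc : 0 < c₀) (hξ : 0 ≤ ξ) (t : ℕ) :
    stepsize a c₀ ξ (t + 1) ≤ stepsize a c₀ ξ t := by
  unfold stepsize
  gcongr
  exact t.le_succ

lemma stepsize_sub_succ_le (ha : 0 < a) (hc : 0 < c₀) (hξ : ξ ≤ 1) (t : ℕ) :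
    stepsize a c₀ ξ t - stepsize a c₀ ξ (t + 1) ≤ stepsize a c₀ ξ t / (t + c₀) := by
  have hx : 0 < (t : ℝ) + c₀ := by positivity
  have hratio : stepsize a c₀ ξ (t + 1) =
      stepsize a c₀ ξ t * (((t : ℝ) + c₀) / (t + c₀ + 1)) ^ ξ := by
    rw [stepsize, stepsize, Real.div_rpow hx.le (by positivity), cast_succ_add]
    field_simp
  have hratio_ge : 1 - 1 / ((t : ℝ) + c₀) ≤ (((t : ℝ) + c₀) / (t + c₀ + 1)) ^ ξ :=
    calc 1 - 1 / ((t : ℝ) + c₀) ≤ (((t : ℝ) + c₀) / (t + c₀ + 1)) ^ (1 : ℝ) :=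
          one_sub_div_le_rpow zero_le_one hx
      _ ≤ (((t : ℝ) + c₀) / (t + c₀ + 1)) ^ ξ :=
          Real.rpow_le_rpow_of_exponent_ge (by positivity)
            ((div_le_one (by positivity)).2 (by linarith)) hξ
  rw [hratio]
  have := mul_le_mul_of_nonneg_left hratio_ge (stepsize_pos (ξ := ξ) ha hc t).le
  linarith [div_eq_mul_one_div (stepsize a c₀ ξ t) ((t : ℝ) + c₀)]

lemma one_sub_mul_exp_le (ha : 0 < a) (hη : 0 ≤ η) (hc : 0 < c₀) (hξ0 : 0 ≤ ξ) (hξ : ξ < 1)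
    (t : ℕ) :
    (1 - η * stepsize a c₀ ξ t) *
        Real.exp (-(η * a / (1 - ξ)) * (((t : ℝ) + c₀) ^ (1 - ξ) - c₀ ^ (1 - ξ))) ≤
      Real.exp (-(η * a / (1 - ξ)) * ((((t + 1 : ℕ) : ℝ) + c₀) ^ (1 - ξ) - c₀ ^ (1 - ξ))) := by
  have hx : 0 < (t : ℝ) + c₀ := by positivity
  have hξ' : 0 < 1 - ξ := by linarith
  have hincr : η * a / (1 - ξ) * ((t + c₀ + 1) ^ (1 - ξ) - (t + c₀) ^ (1 - ξ)) ≤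
      η * stepsize a c₀ ξ t :=
    calc η * a / (1 - ξ) * ((t + c₀ + 1) ^ (1 - ξ) - (t + c₀) ^ (1 - ξ))
        ≤ η * a / (1 - ξ) * ((1 - ξ) / (t + c₀) ^ ξ) := by
          gcongr
          exact add_one_rpow_sub_le hξ0 hξ.le hx
      _ = η * stepsize a c₀ ξ t := by
          rw [stepsize]
          field_simp
  refine (mul_le_mul_of_nonneg_right (Real.one_sub_le_exp_neg _) (Real.exp_pos _).le).trans ?_
  rw [← Real.exp_add, Real.exp_le_exp, cast_succ_add]
  linarith

lemma one_sub_mul_rpow_le (ha : 0 ≤ a) (hη : 0 ≤ η) (hc : 0 < c₀) (t : ℕ) :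
    (1 - η * stepsize a c₀ 1 t) * (c₀ / (t + c₀)) ^ (a * η) ≤
      (c₀ / (((t + 1 : ℕ) : ℝ) + c₀)) ^ (a * η) := by
  have hx : 0 < (t : ℝ) + c₀ := by positivity
  have hstep : η * stepsize a c₀ 1 t = a * η / (t + c₀) := by
    rw [stepsize_one]
    ring
  have hsplit : c₀ / ((t : ℝ) + c₀ + 1) = (t + c₀) / (t + c₀ + 1) * (c₀ / (t + c₀)) := by
    field_simp
  rw [hstep, cast_succ_add, hsplit, Real.mul_rpow (by positivity) (by positivity)]
  gcongr
  exact one_sub_div_le_rpow (by positivity) hx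

lemma supersolution_stepsize {k : ℝ} (ha : 0 < a) (hc : 0 < c₀) (hξ : ξ ≤ 1)
    (hη : 0 < η) (hk : 0 ≤ k) (t : ℕ) (hx : 2 / ((t : ℝ) + c₀) ≤ η * stepsize a c₀ ξ t) :
    (1 - η * stepsize a c₀ ξ t) * (2 * k * stepsize a c₀ ξ t / η) + k * stepsize a c₀ ξ t ^ 2 ≤
      2 * k * stepsize a c₀ ξ (t + 1) / η := by
  have hdiff := stepsize_sub_succ_le ha hc hξ t
  have hpos := stepsize_pos (ξ := ξ) ha hc t
  generalize stepsize a c₀ ξ (t + 1) = α' at *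
  generalize stepsize a c₀ ξ t = α at *
  have hdiff' : α - α' ≤ η * α ^ 2 / 2 := by
    have := mul_le_mul_of_nonneg_left hx hpos.le
    linarith [mul_div_left_comm α 2 ((t : ℝ) + c₀)]
  calc (1 - η * α) * (2 * k * α / η) + k * α ^ 2 = (2 * k * α - η * k * α ^ 2) / η := by
        field_simp
        ring
    _ ≤ 2 * k * α' / η := by
        gcongr
        linarith [mul_le_mul_of_nonneg_left hdiff' hk]

lemma noise_le_of_eq_one (ha : 0 < a) (hc : 0 < c₀) (t : ℕ) :
    60 * stepsize a c₀ 1 t ^ 2 + 8 * (stepsize a c₀ 1 t - stepsize a c₀ 1 (t + 1)) ≤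
      (60 * a ^ 2 + 8 * a) / ((t : ℝ) + c₀) ^ 2 :=
  calc 60 * stepsize a c₀ 1 t ^ 2 + 8 * (stepsize a c₀ 1 t - stepsize a c₀ 1 (t + 1))
      ≤ 60 * stepsize a c₀ 1 t ^ 2 + 8 * (stepsize a c₀ 1 t / (t + c₀)) := by
        gcongr
        exact stepsize_sub_succ_le ha hc le_rfl t
    _ = (60 * a ^ 2 + 8 * a) / ((t : ℝ) + c₀) ^ 2 := by
        rw [stepsize_one]
        field_simp

lemma noise_le_of_two_div_le (ha : 0 < a) (hc : 0 < c₀) (hξ : ξ ≤ 1) (hη2 : η ≤ 2) {t : ℕ}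
    (hx : 2 / ((t : ℝ) + c₀) ≤ η * stepsize a c₀ ξ t) :
    60 * stepsize a c₀ ξ t ^ 2 + 8 * (stepsize a c₀ ξ t - stepsize a c₀ ξ (t + 1)) ≤
      68 * stepsize a c₀ ξ t ^ 2 := by
  have hdiff := stepsize_sub_succ_le ha hc hξ t
  have hpos := stepsize_pos (ξ := ξ) ha hc t
  have hx' := mul_le_mul_of_nonneg_left hx hpos.le
  have hη' := mul_le_mul_of_nonneg_right hη2 (sq_nonneg (stepsize a c₀ ξ t))
  linarith [mul_div_left_comm (stepsize a c₀ ξ t) 2 ((t : ℝ) + c₀)]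

end Stepsize

end Scalar

section Offset

/-- The size of `c₀` from which on the error bounds hold. The first four terms make
`α_t L₁ / η`, `L₁ / ((t + c₀) η)` and, for `ξ < 1`, `1 / ((t + c₀) η α_t)` small, the fifth one
gives `1 / a ≤ log (t + c₀) - log a`, and the last one is used for `ξ = 1` and `a * η < 1`. -/
noncomputable def minOffset (a ξ η C β : ℝ) : ℝ :=
  max (max (max 8 ((2048 * a * L1 C β / η) ^ (1 / ξ))) (max (2048 * L1 C β / η)
    ((2 / (a * η)) ^ (1 / (1 - ξ))))) (max (a * Real.exp (1 / a))
      (if ξ = 1 then 2 / (1 - a * η) else 0))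

lemma minOffset_pos (a ξ η C β : ℝ) : 0 < minOffset a ξ η C β :=
  lt_max_of_lt_left (lt_max_of_lt_left (lt_max_of_lt_left (by norm_num)))

variable {a ξ η C β c₀ : ℝ}

lemma eight_le_of_minOffset_le (h : minOffset a ξ η C β ≤ c₀) : 8 ≤ c₀ := by
  simp only [minOffset, max_le_iff] at h
  exact h.1.1.1

lemma stepsize_mul_L1_le (ha : 0 < a) (hξ : 0 < ξ) (hη : 0 < η) (h : minOffset a ξ η C β ≤ c₀)
    (t : ℕ) : 2048 * (stepsize a c₀ ξ t * L1 C β) ≤ η := by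
  have hc : 0 < c₀ := (minOffset_pos a ξ η C β).trans_le h
  have hL := one_le_L1 C β
  simp only [minOffset, max_le_iff] at h
  have hc_pow : 2048 * a * L1 C β / η ≤ c₀ ^ ξ :=
    (Real.rpow_inv_le_iff_of_pos (by positivity) hc.le hξ).1 (one_div ξ ▸ h.1.1.2)
  calc 2048 * (stepsize a c₀ ξ t * L1 C β) ≤ 2048 * (a / c₀ ^ ξ * L1 C β) := by
        gcongr
        exact stepsize_le ha.le hc hξ.le t
    _ = 2048 * a * L1 C β / c₀ ^ ξ := by ring
    _ ≤ η := by rwa [div_le_iff₀ (by positivity), ← div_le_iff₀' hη]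

lemma L1_div_le (hη : 0 < η) (h : minOffset a ξ η C β ≤ c₀) (t : ℕ) :
    2048 * (L1 C β / ((t : ℝ) + c₀)) ≤ η := by
  have hc : 0 < c₀ := (minOffset_pos a ξ η C β).trans_le h
  simp only [minOffset, max_le_iff] at h
  rw [← mul_div_assoc, div_le_iff₀ (by positivity), ← div_le_iff₀' hη]
  exact h.1.2.1.trans (le_cast_add t c₀)

lemma two_div_le_eta_mul_stepsize (ha : 0 < a) (hξ : ξ < 1) (hη : 0 < η)
    (h : minOffset a ξ η C β ≤ c₀) (t : ℕ) :
    2 / ((t : ℝ) + c₀) ≤ η * stepsize a c₀ ξ t := by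
  have hc : 0 < c₀ := (minOffset_pos a ξ η C β).trans_le h
  simp only [minOffset, max_le_iff] at h
  have hx : 0 < (t : ℝ) + c₀ := by positivity
  have hpow : 2 / (a * η) ≤ ((t : ℝ) + c₀) ^ (1 - ξ) :=
    (Real.rpow_inv_le_iff_of_pos (by positivity) hx.le (by linarith)).1
      (one_div (1 - ξ) ▸ h.1.2.2.trans (le_cast_add t c₀))
  rw [Real.rpow_sub hx, Real.rpow_one, div_le_div_iff₀ (by positivity) (by positivity)] at hpow
  rw [stepsize, ← mul_div_assoc, div_le_div_iff₀ hx (by positivity)]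
  linarith

lemma one_add_inv_le_log (ha : 0 < a) (h : minOffset a ξ η C β ≤ c₀) (t : ℕ) :
    1 + 1 / a ≤ Real.log ((t : ℝ) + c₀) - Real.log a + 1 := by
  simp only [minOffset, max_le_iff] at h
  have hlog := Real.log_le_log (by positivity) (h.2.1.trans (le_cast_add t c₀))
  rw [Real.log_mul ha.ne' (Real.exp_pos _).ne', Real.log_exp] at hlog
  linarith

lemma two_div_one_sub_le (h : minOffset a 1 η C β ≤ c₀) : 2 / (1 - a * η) ≤ c₀ := by
  simp only [minOffset, max_le_iff, if_true] at h
  exact h.2.2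

lemma isAdmissibleStepsize_stepsize (ha : 0 < a) (hξ0 : 0 < ξ) (hξ : ξ ≤ 1) (hη : 0 < η)
    (hη2 : η ≤ 2) (h : minOffset a ξ η C β ≤ c₀) :
    IsAdmissibleStepsize (stepsize a c₀ ξ) η (8 * L1 C β) := by
  have hc : 0 < c₀ := (minOffset_pos a ξ η C β).trans_le h
  have hpos := stepsize_pos (ξ := ξ) ha hc
  have hαL := stepsize_mul_L1_le ha hξ0 hη h
  refine ⟨fun t => (hpos t).le, stepsize_succ_le ha.le hc hξ0.le, fun t => ?_, fun t => ?_⟩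
  · linarith [hαL t]
  · have hdiff := mul_le_mul_of_nonneg_right (stepsize_sub_succ_le ha hc hξ t)
      (zero_le_one.trans (one_le_L1 C β))
    have hsq := mul_le_mul_of_nonneg_left (hαL t) (hpos t).le
    have hx := mul_le_mul_of_nonneg_left (L1_div_le hη h t) (hpos t).le
    rw [div_mul_eq_mul_div, mul_div_assoc] at hdiff
    linarith [mul_pos hη (hpos t)]

lemma eta_mul_stepsize_le_one (ha : 0 < a) (hξ0 : 0 < ξ) (hη : 0 < η) (hη2 : η ≤ 2)
    (h : minOffset a ξ η C β ≤ c₀) (t : ℕ) : η * stepsize a c₀ ξ t ≤ 1 := by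
  have hpos := stepsize_pos (ξ := ξ) ha ((minOffset_pos a ξ η C β).trans_le h) t
  have hαL := le_mul_of_one_le_right hpos.le (one_le_L1 C β)
  linarith [stepsize_mul_L1_le ha hξ0 hη h t, mul_le_mul_of_nonneg_right hη2 hpos.le]

lemma isSupersolution_of_lt_one (ha : 0 < a) (hξ0 : 0 < ξ) (hξ : ξ < 1) (hη : 0 < η)
    (hη2 : η ≤ 2) (h : minOffset a ξ η C β ≤ c₀) :
    IsSupersolution η (stepsize a c₀ ξ)
      (fun t => Real.exp (-(η * a / (1 - ξ)) * (((t : ℝ) + c₀) ^ (1 - ξ) - c₀ ^ (1 - ξ))))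
      (fun t => 2 * 68 * stepsize a c₀ ξ t / η) := by
  have hc : 0 < c₀ := (minOffset_pos a ξ η C β).trans_le h
  refine ⟨by simp, one_sub_mul_exp_le ha hη.le hc hξ0.le hξ,
    div_nonneg (mul_nonneg (by norm_num) (stepsize_pos ha hc 0).le) hη.le, fun t => ?_⟩
  have hx := two_div_le_eta_mul_stepsize ha hξ hη h t
  linarith [supersolution_stepsize (k := 68) ha hc hξ.le hη (by norm_num) t hx,
    noise_le_of_two_div_le ha hc hξ.le hη2 hx]

lemma isSupersolution_of_eq_one (ha : 0 < a) (hη : 0 ≤ η) (hc : 0 < c₀) {v : ℝ → ℝ}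
    (hv₀ : 0 ≤ v c₀)
    (hv : ∀ x, c₀ ≤ x → (1 - a * η / x) * v x + (60 * a ^ 2 + 8 * a) / x ^ 2 ≤ v (x + 1)) :
    IsSupersolution η (stepsize a c₀ 1) (fun t => (c₀ / ((t : ℝ) + c₀)) ^ (a * η))
      (fun t => v (t + c₀)) := by
  refine ⟨by simp [div_self hc.ne'], one_sub_mul_rpow_le ha.le hη hc, by simpa using hv₀,
    fun t => ?_⟩
  have hstep : η * stepsize a c₀ 1 t = a * η / (t + c₀) := by
    rw [stepsize_one]
    ring
  rw [hstep, cast_succ_add]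
  linarith [noise_le_of_eq_one ha hc t, hv _ (le_cast_add t c₀)]

lemma isSupersolution_of_one_lt_mul (ha : 0 < a) (hη : 0 ≤ η) (hc : 0 < c₀) (hm : 1 < a * η) :
    IsSupersolution η (stepsize a c₀ 1) (fun t => (c₀ / ((t : ℝ) + c₀)) ^ (a * η))
      (fun t => (60 * a ^ 2 + 8 * a) / ((a * η - 1) * (t + c₀))) :=
  isSupersolution_of_eq_one (v := fun x => (60 * a ^ 2 + 8 * a) / ((a * η - 1) * x)) ha hη hc
    (div_nonneg (by positivity) (mul_nonneg (by linarith) hc.le))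
    fun _ hx => supersolution_div hm (by positivity) (hc.trans_le hx)

lemma isSupersolution_of_one_le_mul (ha : 0 < a) (hη : 0 ≤ η) (hc : 8 ≤ c₀) (hm : 1 ≤ a * η) :
    IsSupersolution η (stepsize a c₀ 1) (fun t => (c₀ / ((t : ℝ) + c₀)) ^ (a * η))
      (fun t => (60 * a ^ 2 + 8 * a) * Real.log (t + c₀) / (t + c₀)) := by
  refine isSupersolution_of_eq_one (v := fun x => (60 * a ^ 2 + 8 * a) * Real.log x / x) ha hη
    (by linarith) ?_ fun _ hx => supersolution_log_div hm (by positivity) (hc.trans hx)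
  have := two_le_log_of_eight_le hc
  positivity

lemma inv_le_rpow_neg {m x : ℝ} (hm : m ≤ 1) (hx : 1 ≤ x) : x⁻¹ ≤ x ^ (-m) := by
  rw [← Real.rpow_neg_one]
  exact Real.rpow_le_rpow_of_exponent_le hx (by linarith)

lemma isSupersolution_of_mul_lt_one (ha : 0 < a) (hη : 0 ≤ η) (hc : 8 ≤ c₀) (hm : a * η < 1)
    (hc' : 2 / (1 - a * η) ≤ c₀) :
    IsSupersolution η (stepsize a c₀ 1) (fun t => (c₀ / ((t : ℝ) + c₀)) ^ (a * η))
      (fun t => 2 * (60 * a ^ 2 + 8 * a) / (1 - a * η) *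
        (((t : ℝ) + c₀) ^ (-(a * η)) - ((t : ℝ) + c₀)⁻¹)) :=
  have hm' : 0 < 1 - a * η := by linarith
  isSupersolution_of_eq_one ha hη (by linarith)
    (v := fun x => 2 * (60 * a ^ 2 + 8 * a) / (1 - a * η) * (x ^ (-(a * η)) - x⁻¹))
    (mul_nonneg (by positivity) (sub_nonneg.2 (inv_le_rpow_neg hm.le (by linarith))))
    fun _ hx => supersolution_rpow_sub_inv (by positivity) hm (by positivity) (by linarith)
      (hc'.trans hx)

end Offset

lemma MeanSquareLE.mono {Ω : Type*} [MeasurableSpace Ω] {d : ℕ} {Pr : Measure Ω}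
    {X : Ω → EuclideanSpace ℝ (Fin d)} {b b' : ℝ} (h : MeanSquareLE Pr X b) (hb : b ≤ b') :
    MeanSquareLE Pr X b' :=
  ⟨h.1, h.2.trans hb⟩

namespace PolicyEvaluation

section Lyapunov

variable {S : Type*} {A : Type*} [Fintype S] [Fintype A] [DecidableEq S] [MeasurableSpace S]
  {d : ℕ} {M : PolicyEvaluation S A d} {Ω : Type*} [MeasurableSpace Ω] {μ : S → ℝ} {C β : ℝ}
  {θs : EuclideanSpace ℝ (Fin d)} {Pr : Measure Ω} [IsProbabilityMeasure Pr]
  {s sHat : ℕ → Ω → S} {θ₀ : Ω → EuclideanSpace ℝ (Fin d)} {a ξ c₀ : ℝ}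

lemma abs_integral_lyapunov_stepsize_sub_le [MeasurableSingletonClass S]
    (hη : 0 < M.eta μ) (hμ : IsStationaryDist M.P μ)
    (hmix : IsMixing M.P μ C β) (h : IsDoubleChain M.P Pr s sHat θ₀) (ha : 0 < a) (hξ : 0 < ξ)
    (hc : minOffset a ξ (M.eta μ) C β ≤ c₀) (t : ℕ) :
    |∫ ω, M.lyapunov μ θs (stepsize a c₀ ξ t) (s t ω, sHat t ω)
          (M.iterate (stepsize a c₀ ξ) s sHat θ₀ t ω) ∂Pr -
        ∫ ω, ‖M.iterate (stepsize a c₀ ξ) s sHat θ₀ t ω - θs‖ ^ 2 ∂Pr| ≤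
      1 / 8 * ∫ ω, ‖M.iterate (stepsize a c₀ ξ) s sHat θ₀ t ω - θs‖ ^ 2 ∂Pr +
        16 * (L1 C β * (M.rmax + 3 * ‖θs‖) ^ 2) * stepsize a c₀ ξ t := by
  have hη2 := eta_le_two (dim_pos_of_eta_pos hη) hμ
  have hα := stepsize_pos (ξ := ξ) ha ((minOffset_pos a ξ (M.eta μ) C β).trans_le hc) t
  have hdist := abs_integral_lyapunov_sub_le (θs := θs) hμ.1 hmix hα.le
    (M.memLp_iterate (α := stepsize a c₀ ξ) h.chain.1 h.chainHat.1 h.measurable_init h.memLp_init t)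
    ((h.chain.1 t).prodMk (h.chainHat.1 t))
  have hE : 0 ≤ ∫ ω, ‖M.iterate (stepsize a c₀ ξ) s sHat θ₀ t ω - θs‖ ^ 2 ∂Pr :=
    integral_nonneg fun _ => sq_nonneg _
  have hsmall := mul_le_mul_of_nonneg_right (stepsize_mul_L1_le ha hξ hη hc t) hE
  linarith [mul_le_mul_of_nonneg_right hη2 hE]

variable [DiscreteMeasurableSpace S]

lemma meanSquareLE_of_isSupersolution (hη : 0 < M.eta μ) (hμ : IsStationaryDist M.P μ)
    (hmix : IsMixing M.P μ C β) (hθs : M.IsFixedPoint μ θs) (h : IsDoubleChain M.P Pr s sHat θ₀)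
    (ha : 0 < a) (hξ0 : 0 < ξ) (hξ : ξ ≤ 1) (hc : minOffset a ξ (M.eta μ) C β ≤ c₀) {H v : ℕ → ℝ}
    (hsup : IsSupersolution (M.eta μ) (stepsize a c₀ ξ) H v) (T : ℕ) :
    MeanSquareLE Pr (fun ω => M.iterate (stepsize a c₀ ξ) s sHat θ₀ T ω - θs)
      ((2 * (∫ ω, ‖θ₀ ω - θs‖ ^ 2 ∂Pr) + (M.rmax + 3 * ‖θs‖) ^ 2 / 4) * H T +
        16 * (L1 C β * (M.rmax + 3 * ‖θs‖) ^ 2) * (v T + 2 * stepsize a c₀ ξ T)) := by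
  refine ⟨(M.memLp_iterate h.chain.1 h.chainHat.1 h.measurable_init h.memLp_init T).sub
    (memLp_const θs), ?_⟩
  have hc0 : 0 < c₀ := (minOffset_pos a ξ (M.eta μ) C β).trans_le hc
  have hη2 := eta_le_two (dim_pos_of_eta_pos hη) hμ
  have hL := one_le_L1 C β
  have hdist := abs_integral_lyapunov_stepsize_sub_le (θs := θs) hη hμ hmix h ha hξ0 hc
  have hE₀ : 0 ≤ ∫ ω, ‖θ₀ ω - θs‖ ^ 2 ∂Pr := integral_nonneg fun _ => sq_nonneg _
  set G2 := (M.rmax + 3 * ‖θs‖) ^ 2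
  have hG2 : 0 ≤ G2 := sq_nonneg _
  have hinit : ∫ ω, M.lyapunov μ θs (stepsize a c₀ ξ 0) (s 0 ω, sHat 0 ω) (θ₀ ω) ∂Pr ≤
      9 / 8 * (∫ ω, ‖θ₀ ω - θs‖ ^ 2 ∂Pr) + G2 / 32 := by
    have hsmall := mul_le_mul_of_nonneg_right (stepsize_mul_L1_le ha hξ0 hη hc 0) hG2
    have hW : _ - ∫ ω, ‖θ₀ ω - θs‖ ^ 2 ∂Pr ≤ _ := (abs_le.1 (hdist 0)).2
    simp only [iterate] at hW
    linarith [mul_le_mul_of_nonneg_right hη2 hG2]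
  have hα : ∀ t, M.eta μ * stepsize a c₀ ξ t ≤ 1 := eta_mul_stepsize_le_one ha hξ0 hη hη2 hc
  have hrec := hsup.le_of_recursion hα
    (W := fun t => ∫ ω, M.lyapunov μ θs (stepsize a c₀ ξ t) (s t ω, sHat t ω)
      (M.iterate (stepsize a c₀ ξ) s sHat θ₀ t ω) ∂Pr)
    (B := G2 * (8 * L1 C β)) (by positivity) (by positivity) hinit
    (integral_lyapunov_succ_le hμ hη hmix hθs h
      (isAdmissibleStepsize_stepsize ha hξ0 hξ hη hη2 hc)) T
  have hH := hsup.nonneg hα T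
  have hv := hsup.noise_nonneg hα (stepsize_succ_le ha.le hc0 hξ0.le) T
  have hLG : 0 ≤ L1 C β * G2 := by positivity
  linarith [(abs_le.1 (hdist T)).1, mul_nonneg hE₀ hH, mul_nonneg hG2 hH, mul_nonneg hLG hv,
    mul_nonneg hLG (stepsize_pos (ξ := ξ) ha hc0 T).le]

end Lyapunov

section ErrorBounds

variable {S : Type*} {A : Type*} [Fintype S] [Fintype A] [DecidableEq S] [MeasurableSpace S]
  [DiscreteMeasurableSpace S] {d : ℕ} {M : PolicyEvaluation S A d} {Ω : Type*} [MeasurableSpace Ω]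
  {μ : S → ℝ} {C β : ℝ} {θs : EuclideanSpace ℝ (Fin d)} {Pr : Measure Ω} [IsProbabilityMeasure Pr]
  {s sHat : ℕ → Ω → S} {θ₀ : Ω → EuclideanSpace ℝ (Fin d)} {a ξ c₀ : ℝ}

lemma meanSquareLE_of_lt_one (hη : 0 < M.eta μ) (hμ : IsStationaryDist M.P μ)
    (hmix : IsMixing M.P μ C β) (hθs : M.IsFixedPoint μ θs) (h : IsDoubleChain M.P Pr s sHat θ₀)
    (ha : 0 < a) (hξ0 : 0 < ξ) (hξ : ξ < 1) (hc : minOffset a ξ (M.eta μ) C β ≤ c₀) (T : ℕ) :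
    MeanSquareLE Pr (fun ω => M.iterate (stepsize a c₀ ξ) s sHat θ₀ T ω - θs)
      ((2 * (∫ ω, ‖θ₀ ω - θs‖ ^ 2 ∂Pr) + (M.rmax + 3 * ‖θs‖) ^ 2 / 4) *
          Real.exp (-(M.eta μ * a / (1 - ξ)) * (((T : ℝ) + c₀) ^ (1 - ξ) - c₀ ^ (1 - ξ))) +
        2240 * L1 C β * (M.rmax + 3 * ‖θs‖) ^ 2 * (a / (M.eta μ * ((T : ℝ) + c₀) ^ ξ))) := by
  have hη2 := eta_le_two (dim_pos_of_eta_pos hη) hμ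
  have hα := stepsize_pos (ξ := ξ) ha ((minOffset_pos a ξ (M.eta μ) C β).trans_le hc) T
  have hL := one_le_L1 C β
  refine (meanSquareLE_of_isSupersolution hη hμ hmix hθs h ha hξ0 hξ.le hc
    (isSupersolution_of_lt_one ha hξ0 hξ hη hη2 hc) T).mono (add_le_add_right ?_ _)
  calc 16 * (L1 C β * (M.rmax + 3 * ‖θs‖) ^ 2) *
        (2 * 68 * stepsize a c₀ ξ T / M.eta μ + 2 * stepsize a c₀ ξ T)
      ≤ 16 * (L1 C β * (M.rmax + 3 * ‖θs‖) ^ 2) *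
        (2 * 68 * stepsize a c₀ ξ T / M.eta μ + 4 * stepsize a c₀ ξ T / M.eta μ) := by
        gcongr
        rw [le_div_iff₀ hη]
        linarith [mul_le_mul_of_nonneg_left hη2 hα.le]
    _ = _ := by
        rw [stepsize]
        field_simp
        ring

lemma meanSquareLE_of_one_lt_mul (hη : 0 < M.eta μ) (hμ : IsStationaryDist M.P μ)
    (hmix : IsMixing M.P μ C β) (hθs : M.IsFixedPoint μ θs) (h : IsDoubleChain M.P Pr s sHat θ₀)
    (ha : 0 < a) (hc : minOffset a 1 (M.eta μ) C β ≤ c₀) (hm : 1 < a * M.eta μ) (T : ℕ) :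
    MeanSquareLE Pr (fun ω => M.iterate (stepsize a c₀ 1) s sHat θ₀ T ω - θs)
      ((2 * (∫ ω, ‖θ₀ ω - θs‖ ^ 2 ∂Pr) + (M.rmax + 3 * ‖θs‖) ^ 2 / 4) *
          (c₀ / ((T : ℝ) + c₀)) ^ (a * M.eta μ) +
        16 * (L1 C β * (M.rmax + 3 * ‖θs‖) ^ 2) *
          ((60 * a ^ 2 + 8 * a) / ((a * M.eta μ - 1) * (T + c₀)) + 2 * a / (T + c₀))) := by
  have hc0 : 0 < c₀ := (minOffset_pos a 1 (M.eta μ) C β).trans_le hc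
  refine (meanSquareLE_of_isSupersolution hη hμ hmix hθs h ha one_pos le_rfl hc
    (isSupersolution_of_one_lt_mul ha hη.le hc0 hm) T).mono (le_of_eq ?_)
  rw [stepsize_one, mul_div_assoc 2 a]

lemma meanSquareLE_of_one_le_mul (hη : 0 < M.eta μ) (hμ : IsStationaryDist M.P μ)
    (hmix : IsMixing M.P μ C β) (hθs : M.IsFixedPoint μ θs) (h : IsDoubleChain M.P Pr s sHat θ₀)
    (ha : 0 < a) (hc : minOffset a 1 (M.eta μ) C β ≤ c₀) (hm : 1 ≤ a * M.eta μ) (T : ℕ) :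
    MeanSquareLE Pr (fun ω => M.iterate (stepsize a c₀ 1) s sHat θ₀ T ω - θs)
      ((2 * (∫ ω, ‖θ₀ ω - θs‖ ^ 2 ∂Pr) + (M.rmax + 3 * ‖θs‖) ^ 2 / 4) *
          (c₀ / ((T : ℝ) + c₀)) ^ (a * M.eta μ) +
        16 * (L1 C β * (M.rmax + 3 * ‖θs‖) ^ 2) *
          ((60 * a ^ 2 + 10 * a) * Real.log (T + c₀) / (T + c₀))) := by
  have hc8 := eight_le_of_minOffset_le hc
  have hx := hc8.trans (le_cast_add T c₀)
  have hL := one_le_L1 C β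
  refine (meanSquareLE_of_isSupersolution hη hμ hmix hθs h ha one_pos le_rfl hc
    (isSupersolution_of_one_le_mul ha hη.le hc8 hm) T).mono (add_le_add_right ?_ _)
  gcongr
  rw [stepsize_one, ← mul_div_assoc, ← add_div]
  gcongr
  linarith [mul_le_mul_of_nonneg_left (two_le_log_of_eight_le hx) ha.le]

lemma meanSquareLE_of_mul_lt_one (hη : 0 < M.eta μ) (hμ : IsStationaryDist M.P μ)
    (hmix : IsMixing M.P μ C β) (hθs : M.IsFixedPoint μ θs) (h : IsDoubleChain M.P Pr s sHat θ₀)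
    (ha : 0 < a) (hc : minOffset a 1 (M.eta μ) C β ≤ c₀) (hm : a * M.eta μ < 1) (T : ℕ) :
    MeanSquareLE Pr (fun ω => M.iterate (stepsize a c₀ 1) s sHat θ₀ T ω - θs)
      ((2 * (∫ ω, ‖θ₀ ω - θs‖ ^ 2 ∂Pr) + (M.rmax + 3 * ‖θs‖) ^ 2 / 4) *
          (c₀ / ((T : ℝ) + c₀)) ^ (a * M.eta μ) +
        16 * (L1 C β * (M.rmax + 3 * ‖θs‖) ^ 2) *
          ((120 * a ^ 2 + 18 * a) / (1 - a * M.eta μ) / (T + c₀) ^ (a * M.eta μ))) := by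
  have hc8 := eight_le_of_minOffset_le hc
  have hx : 8 ≤ (T : ℝ) + c₀ := hc8.trans (le_cast_add T c₀)
  have hx0 : 0 < (T : ℝ) + c₀ := by linarith [hx]
  have hm0 : 0 < a * M.eta μ := mul_pos ha hη
  have hm1 : 0 < 1 - a * M.eta μ := sub_pos.2 hm
  have hL := one_le_L1 C β
  refine (meanSquareLE_of_isSupersolution hη hμ hmix hθs h ha one_pos le_rfl hc
    (isSupersolution_of_mul_lt_one ha hη.le hc8 hm (two_div_one_sub_le hc)) T).mono
    (add_le_add_right ?_ _)
  gcongr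
  rw [stepsize_one, div_eq_mul_inv _ (_ ^ _), ← Real.rpow_neg hx0.le]
  have hstep : 2 * (a / ((T : ℝ) + c₀)) ≤
      2 * a / (1 - a * M.eta μ) * ((T : ℝ) + c₀) ^ (-(a * M.eta μ)) := by
    rw [← mul_div_assoc, div_eq_mul_inv]
    refine mul_le_mul ?_ (inv_le_rpow_neg hm.le (by linarith)) (by positivity) (by positivity)
    exact le_div_self (by positivity) hm1 (by linarith)
  have hdrop : 0 ≤ 2 * (60 * a ^ 2 + 8 * a) / (1 - a * M.eta μ) * ((T : ℝ) + c₀)⁻¹ := by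
    positivity
  have hsplit : (120 * a ^ 2 + 18 * a) / (1 - a * M.eta μ) =
    2 * (60 * a ^ 2 + 8 * a) / (1 - a * M.eta μ) + 2 * a / (1 - a * M.eta μ) := by ring
  rw [hsplit]
  linarith

end ErrorBounds

end PolicyEvaluation

section Gam

variable {a c₀ η L b : ℝ} {T : ℕ}

lemma noise_le_Gam_of_mul_lt_one (ha : 0 ≤ a) (hL : 0 ≤ L) (hb : 0 ≤ b)
    (hx : 0 ≤ (T : ℝ) + c₀)
    (hlog : a ^ 2 + a ≤ a ^ 2 * (Real.log ((T : ℝ) + c₀) - Real.log a + 1)) (hm : a * η < 1) :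
    16 * (L * b) * ((120 * a ^ 2 + 18 * a) / (1 - a * η) / (T + c₀) ^ (a * η)) ≤
      Gam a c₀ η L (946 * b) T / ((T : ℝ) + c₀) ^ min 1 (a * η) := by
  rw [Gam, if_pos hm, min_eq_right hm.le, betaTilde]
  calc 16 * (L * b) * ((120 * a ^ 2 + 18 * a) / (1 - a * η) / (T + c₀) ^ (a * η))
      ≤ 16 * (L * b) * (473 * (a ^ 2 * (Real.log ((T : ℝ) + c₀) - Real.log a + 1)) /
          (1 - a * η) / (T + c₀) ^ (a * η)) := by
        gcongr
        linarith [sq_nonneg a, ha]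
    _ = _ := by ring

lemma noise_le_Gam_of_mul_eq_one (ha : 0 ≤ a) (hL : 0 ≤ L) (hb : 0 ≤ b)
    (hx : 1 ≤ (T : ℝ) + c₀)
    (hlog : a ^ 2 + a ≤ a ^ 2 * (Real.log ((T : ℝ) + c₀) - Real.log a + 1)) (hm : a * η = 1) :
    16 * (L * b) * ((60 * a ^ 2 + 10 * a) * Real.log (T + c₀) / (T + c₀)) ≤
      Gam a c₀ η L (946 * b) T / ((T : ℝ) + c₀) ^ min 1 (a * η) := by
  have hlog' := Real.log_nonneg hx
  rw [Gam, if_neg hm.not_lt, if_pos hm, min_eq_left hm.ge, Real.rpow_one, betaTilde]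
  calc 16 * (L * b) * ((60 * a ^ 2 + 10 * a) * Real.log (T + c₀) / (T + c₀))
      ≤ 16 * (L * b) * (473 * (a ^ 2 * (Real.log ((T : ℝ) + c₀) - Real.log a + 1)) *
          Real.log (T + c₀) / (T + c₀)) := by
        gcongr
        linarith [sq_nonneg a, ha]
    _ = _ := by ring

lemma noise_le_Gam_of_one_lt_mul (ha : 0 ≤ a) (hη2 : η ≤ 2) (hL : 0 ≤ L) (hb : 0 ≤ b)
    (hx : 0 < (T : ℝ) + c₀)
    (hlog : a ^ 2 + a ≤ a ^ 2 * (Real.log ((T : ℝ) + c₀) - Real.log a + 1)) (hm : 1 < a * η) :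
    16 * (L * b) * ((60 * a ^ 2 + 8 * a) / ((a * η - 1) * (T + c₀)) + 2 * a / (T + c₀)) ≤
      Gam a c₀ η L (946 * b) T / ((T : ℝ) + c₀) ^ min 1 (a * η) := by
  have hm' : 0 < a * η - 1 := sub_pos.2 hm
  have hcoeff : (60 * a ^ 2 + 8 * a) + 2 * a * (a * η - 1) ≤
      473 * Real.exp 1 * (a ^ 2 * (Real.log ((T : ℝ) + c₀) - Real.log a + 1)) :=
    calc (60 * a ^ 2 + 8 * a) + 2 * a * (a * η - 1) ≤ 473 * 1 * (a ^ 2 + a) := by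
          linarith [mul_le_mul_of_nonneg_left hη2 (sq_nonneg a), sq_nonneg a, ha]
      _ ≤ _ := by
          gcongr
          exact Real.one_le_exp zero_le_one
  rw [Gam, if_neg hm.not_gt, if_neg hm.ne', min_eq_left hm.le, Real.rpow_one, betaTilde]
  calc 16 * (L * b) * ((60 * a ^ 2 + 8 * a) / ((a * η - 1) * (T + c₀)) + 2 * a / (T + c₀))
      = 16 * (L * b) * (((60 * a ^ 2 + 8 * a) + 2 * a * (a * η - 1)) /
          ((a * η - 1) * (T + c₀))) := by
        field_simp
    _ ≤ 16 * (L * b) * (473 * Real.exp 1 *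
          (a ^ 2 * (Real.log ((T : ℝ) + c₀) - Real.log a + 1)) / ((a * η - 1) * (T + c₀))) := by
        gcongr
    _ = _ := by
        field_simp
        ring

end Gam

namespace PolicyEvaluation

variable {S : Type*} {A : Type*} [Fintype S] [Fintype A] {d : ℕ} {M : PolicyEvaluation S A d}
  {Ω : Type*} [MeasurableSpace Ω] {θs : EuclideanSpace ℝ (Fin d)} {Pr : Measure Ω}
  [IsProbabilityMeasure Pr] {θ₀ : Ω → EuclideanSpace ℝ (Fin d)}

lemma two_mul_integral_add_sq_div_le_beta1 (hθ₀ : MemLp θ₀ 2 Pr) :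
    2 * (∫ ω, ‖θ₀ ω - θs‖ ^ 2 ∂Pr) + (M.rmax + 3 * ‖θs‖) ^ 2 / 4 ≤ beta1 Pr θ₀ M.rmax θs := by
  have hr := M.rmax_nonneg
  have hint : Integrable (fun ω => (‖θ₀ ω‖ + M.rmax + 2 * ‖θs‖) ^ 2) Pr :=
    ((hθ₀.norm.add (memLp_const M.rmax)).add (memLp_const (2 * ‖θs‖))).integrable_sq
  have hmono : (M.rmax + 2 * ‖θs‖) ^ 2 ≤ ∫ ω, (‖θ₀ ω‖ + M.rmax + 2 * ‖θs‖) ^ 2 ∂Pr :=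
    calc (M.rmax + 2 * ‖θs‖) ^ 2 = ∫ _, (M.rmax + 2 * ‖θs‖) ^ 2 ∂Pr := by simp
      _ ≤ _ := by
        refine integral_mono (integrable_const _) hint fun ω => ?_
        gcongr
        exact le_add_of_nonneg_left (norm_nonneg _)
  have hscale : (M.rmax + 3 * ‖θs‖) ^ 2 ≤ (3 / 2 * (M.rmax + 2 * ‖θs‖)) ^ 2 := by
    gcongr
    linarith
  rw [beta1]
  linarith [sq_nonneg (M.rmax + 2 * ‖θs‖)]

lemma initial_error_mul_le_beta1_mul (hθ₀ : MemLp θ₀ 2 Pr) {H H' : ℝ} (hH : 0 ≤ H)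
    (hHH' : H ≤ H') :
    (2 * (∫ ω, ‖θ₀ ω - θs‖ ^ 2 ∂Pr) + (M.rmax + 3 * ‖θs‖) ^ 2 / 4) * H ≤
      beta1 Pr θ₀ M.rmax θs * H' := by
  have hbeta := two_mul_integral_add_sq_div_le_beta1 (M := M) (θs := θs) hθ₀
  exact mul_le_mul hbeta hHH' hH (le_trans (by positivity) hbeta)

variable [DecidableEq S] [MeasurableSpace S] [DiscreteMeasurableSpace S] {μ : S → ℝ} {C β : ℝ}
  {s sHat : ℕ → Ω → S} {a ξ c₀ : ℝ}

lemma meanSquareLE_error_bound_of_lt_one (hη : 0 < M.eta μ) (hμ : IsStationaryDist M.P μ)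
    (hmix : IsMixing M.P μ C β) (hθs : M.IsFixedPoint μ θs) (h : IsDoubleChain M.P Pr s sHat θ₀)
    (ha : 0 < a) (hξ0 : 0 < ξ) (hξ : ξ < 1) (hc : minOffset a ξ (M.eta μ) C β ≤ c₀) (T τ : ℕ) :
    MeanSquareLE Pr (fun ω => M.iterate (stepsize a c₀ ξ) s sHat θ₀ T ω - θs)
      (beta1 Pr θ₀ M.rmax θs *
          Real.exp (-(M.eta μ * a / (1 - ξ)) * (((T : ℝ) + c₀) ^ (1 - ξ) -
            ((τ : ℝ) + c₀) ^ (1 - ξ))) +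
        2240 * L1 C β * (M.rmax + 3 * ‖θs‖) ^ 2 * (a / (M.eta μ * ((T : ℝ) + c₀) ^ ξ))) := by
  have hc0 : 0 < c₀ := (minOffset_pos a ξ (M.eta μ) C β).trans_le hc
  refine (meanSquareLE_of_lt_one hη hμ hmix hθs h ha hξ0 hξ hc T).mono
    (add_le_add_left (initial_error_mul_le_beta1_mul h.memLp_init (Real.exp_pos _).le ?_) _)
  have hpow := Real.rpow_le_rpow hc0.le (le_cast_add τ c₀) (sub_nonneg.2 hξ.le)
  have hrate : -(M.eta μ * a / (1 - ξ)) ≤ 0 :=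
    neg_nonpos.2 (div_nonneg (mul_pos hη ha).le (sub_nonneg.2 hξ.le))
  exact Real.exp_le_exp.2 (mul_le_mul_of_nonpos_left (sub_le_sub_left hpow _) hrate)

lemma meanSquareLE_log_error_bound_of_lt_one (hη : 0 < M.eta μ) (hμ : IsStationaryDist M.P μ)
    (hmix : IsMixing M.P μ C β) (hθs : M.IsFixedPoint μ θs) (h : IsDoubleChain M.P Pr s sHat θ₀)
    (ha : 0 < a) (hξ0 : 0 < ξ) (hξ : ξ < 1) (hc : minOffset a ξ (M.eta μ) C β ≤ c₀) (T τ : ℕ) :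
    MeanSquareLE Pr (fun ω => M.iterate (stepsize a c₀ ξ) s sHat θ₀ T ω - θs)
      (beta1 Pr θ₀ M.rmax θs *
          Real.exp (-(M.eta μ * a / (1 - ξ)) * (((T : ℝ) + c₀) ^ (1 - ξ) -
            ((τ : ℝ) + c₀) ^ (1 - ξ))) +
        2 * a * betaTilde a c₀ (L1 C β) (beta2 M.rmax θs) T /
          (M.eta μ * ((T : ℝ) + c₀) ^ ξ)) := by
  have hc0 : 0 < c₀ := (minOffset_pos a ξ (M.eta μ) C β).trans_le hc
  have hL := one_le_L1 C β
  refine (meanSquareLE_error_bound_of_lt_one hη hμ hmix hθs h ha hξ0 hξ hc T τ).mono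
    (add_le_add_right ?_ _)
  have hlog : 1 ≤ Real.log ((T : ℝ) + c₀) - Real.log a + 1 :=
    (le_add_of_nonneg_right (by positivity)).trans (one_add_inv_le_log ha hc T)
  have hnoise : 2240 * (L1 C β * (M.rmax + 3 * ‖θs‖) ^ 2) * 1 ≤
      3784 * (L1 C β * (M.rmax + 3 * ‖θs‖) ^ 2) *
        (Real.log ((T : ℝ) + c₀) - Real.log a + 1) := by
    gcongr
    norm_num
  have hfactor := mul_le_mul_of_nonneg_right hnoise
    (by positivity : 0 ≤ a / (M.eta μ * ((T : ℝ) + c₀) ^ ξ))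
  rw [betaTilde, beta2]
  exact (le_of_eq (by ring)).trans (hfactor.trans_eq (by ring))

lemma meanSquareLE_error_bound_of_eq_one (hη : 0 < M.eta μ) (hμ : IsStationaryDist M.P μ)
    (hmix : IsMixing M.P μ C β) (hθs : M.IsFixedPoint μ θs) (h : IsDoubleChain M.P Pr s sHat θ₀)
    (ha : 0 < a) (hc : minOffset a 1 (M.eta μ) C β ≤ c₀) (T τ : ℕ) :
    MeanSquareLE Pr (fun ω => M.iterate (stepsize a c₀ 1) s sHat θ₀ T ω - θs)
      (beta1 Pr θ₀ M.rmax θs * (((τ : ℝ) + c₀) / ((T : ℝ) + c₀)) ^ (a * M.eta μ) +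
        Gam a c₀ (M.eta μ) (L1 C β) (beta2 M.rmax θs) T /
          ((T : ℝ) + c₀) ^ (min 1 (a * M.eta μ))) := by
  have hc0 : 0 < c₀ := (minOffset_pos a 1 (M.eta μ) C β).trans_le hc
  have hx : 8 ≤ (T : ℝ) + c₀ := (eight_le_of_minOffset_le hc).trans (le_cast_add T c₀)
  have hL : 0 ≤ L1 C β := zero_le_one.trans (one_le_L1 C β)
  have hlog : a ^ 2 + a ≤ a ^ 2 * (Real.log ((T : ℝ) + c₀) - Real.log a + 1) :=
    calc a ^ 2 + a = a ^ 2 * (1 + 1 / a) := by field_simp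
      _ ≤ _ := mul_le_mul_of_nonneg_left (one_add_inv_le_log ha hc T) (sq_nonneg a)
  have hinit : (2 * (∫ ω, ‖θ₀ ω - θs‖ ^ 2 ∂Pr) + (M.rmax + 3 * ‖θs‖) ^ 2 / 4) *
      (c₀ / ((T : ℝ) + c₀)) ^ (a * M.eta μ) ≤
      beta1 Pr θ₀ M.rmax θs * (((τ : ℝ) + c₀) / ((T : ℝ) + c₀)) ^ (a * M.eta μ) := by
    refine initial_error_mul_le_beta1_mul h.memLp_init (by positivity) ?_
    gcongr
    exact le_cast_add τ c₀
  rcases lt_trichotomy (a * M.eta μ) 1 with hm | hm | hm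
  · exact (meanSquareLE_of_mul_lt_one hη hμ hmix hθs h ha hc hm T).mono
      (add_le_add hinit (noise_le_Gam_of_mul_lt_one ha.le hL (sq_nonneg _) (by linarith) hlog hm))
  · exact (meanSquareLE_of_one_le_mul hη hμ hmix hθs h ha hc hm.ge T).mono
      (add_le_add hinit (noise_le_Gam_of_mul_eq_one ha.le hL (sq_nonneg _) (by linarith) hlog hm))
  · exact (meanSquareLE_of_one_lt_mul hη hμ hmix hθs h ha hc hm T).mono
      (add_le_add hinit (noise_le_Gam_of_one_lt_mul ha.le (eta_le_two (dim_pos_of_eta_pos hη) hμ) hL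
        (sq_nonneg _) (by linarith) hlog hm))

end PolicyEvaluation

section SampleComplexity

variable {ξ κ κ₁ κ₂ a η L : ℝ}

lemma two_rpow_mul_rpow_neg (hη : 0 ≤ η) : 2 ^ (2 / ξ) * η ^ (-2 / ξ) = (2 / η) ^ (2 / ξ) := by
  rw [Real.div_rpow zero_le_two hη, neg_div, Real.rpow_neg hη]
  exact (div_eq_mul_inv _ _).symm

lemma one_le_two_rpow_mul_rpow_neg (hξ0 : 0 < ξ) (hη : 0 < η) (hη2 : η ≤ 2) :
    1 ≤ 2 ^ (2 / ξ) * η ^ (-2 / ξ) := by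
  rw [two_rpow_mul_rpow_neg hη.le]
  exact Real.one_le_rpow ((one_le_div hη).2 hη2) (by positivity)

lemma inv_le_two_rpow_mul_rpow_neg (hξ0 : 0 < ξ) (hξ : ξ ≤ 1) (hη : 0 < η) (hη2 : η ≤ 2) :
    1 / η ≤ 2 ^ (2 / ξ) * η ^ (-2 / ξ) := by
  rw [two_rpow_mul_rpow_neg hη.le]
  calc 1 / η ≤ 2 / η := by gcongr; norm_num
    _ ≤ (2 / η) ^ (2 / ξ) :=
        Real.self_le_rpow_of_one_le ((one_le_div hη).2 hη2) ((one_le_div hξ0).2 (by linarith))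

lemma div_le_rpow_mul_rpow_neg (hξ0 : 0 < ξ) (hξ : ξ ≤ 1) (hη : 0 < η) (hη2 : η ≤ 2)
    (hL : 1 ≤ L) : L / η ≤ 2 ^ (2 / ξ) * (L ^ (1 / ξ) * η ^ (-2 / ξ)) :=
  calc L / η = L * (1 / η) := (mul_one_div L η).symm
    _ ≤ L ^ (1 / ξ) * (2 ^ (2 / ξ) * η ^ (-2 / ξ)) := by
        gcongr
        · exact Real.self_le_rpow_of_one_le hL ((one_le_div hξ0).2 hξ)
        · exact inv_le_two_rpow_mul_rpow_neg hξ0 hξ hη hη2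
    _ = 2 ^ (2 / ξ) * (L ^ (1 / ξ) * η ^ (-2 / ξ)) := mul_left_comm _ _ _

lemma one_le_rpow_mul_rpow_neg (hξ0 : 0 < ξ) (hη : 0 < η) (hη2 : η ≤ 2) (hL : 1 ≤ L) :
    1 ≤ 2 ^ (2 / ξ) * (L ^ (1 / ξ) * η ^ (-2 / ξ)) := by
  rw [mul_left_comm]
  exact one_le_mul_of_one_le_of_one_le (Real.one_le_rpow hL (by positivity))
    (one_le_two_rpow_mul_rpow_neg hξ0 hη hη2)

lemma rpow_offset_le (ha : 0 ≤ a) (hη : 0 < η) (hκ : a * η ≤ κ) (hL : 0 ≤ L) (hξ0 : 0 < ξ) :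
    (2048 * a * L / η) ^ (1 / ξ) ≤ (2048 * κ) ^ (1 / ξ) * (L ^ (1 / ξ) * η ^ (-2 / ξ)) := by
  have hκ0 : 0 ≤ κ := (mul_nonneg ha hη.le).trans hκ
  calc (2048 * a * L / η) ^ (1 / ξ) = (2048 * (a * η) * L * η ^ (-2 : ℝ)) ^ (1 / ξ) := by
        rw [Real.rpow_neg hη.le, Real.rpow_two]
        congr 1
        field_simp
    _ ≤ (2048 * κ * L * η ^ (-2 : ℝ)) ^ (1 / ξ) := by gcongr
    _ = (2048 * κ) ^ (1 / ξ) * (L ^ (1 / ξ) * η ^ (-2 / ξ)) := by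
        rw [Real.mul_rpow (by positivity) (by positivity), Real.mul_rpow (by positivity) hL,
          ← Real.rpow_mul hη.le, mul_one_div, mul_assoc]

lemma mul_exp_one_div_le (ha : 0 < a) (hη : 0 < η) (hη2 : η ≤ 2) (hκ₁ : 0 < κ₁)
    (h₁ : κ₁ ≤ a * η) (h₂ : a * η ≤ κ₂) :
    a * Real.exp (1 / a) ≤ κ₂ * Real.exp (2 / κ₁) * (1 / η) := by
  have hinv : 1 / a ≤ 2 / κ₁ := by
    rw [div_le_div_iff₀ ha hκ₁, one_mul, mul_comm]
    exact h₁.trans (by gcongr)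
  have ha₂ : a ≤ κ₂ / η := (le_div_iff₀ hη).2 h₂
  calc a * Real.exp (1 / a) ≤ κ₂ / η * Real.exp (2 / κ₁) :=
        mul_le_mul ha₂ (Real.exp_le_exp.2 hinv) (Real.exp_pos _).le (ha.le.trans ha₂)
    _ = κ₂ * Real.exp (2 / κ₁) * (1 / η) := by ring

lemma exists_minOffset_le (hξ0 : 0 < ξ) (hξ : ξ ≤ 1) (hκ₁ : 0 < κ₁) (hκ : κ₁ ≤ κ₂)
    (hκ' : ξ = 1 → 1 ≤ κ₁) :
    ∃ K : ℝ, 0 < K ∧ ∀ a η C β : ℝ, 0 < η → η ≤ 2 → κ₁ ≤ a * η → a * η ≤ κ₂ →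
      minOffset a ξ η C β ≤ K * (L1 C β ^ (1 / ξ) * η ^ (-2 / ξ)) := by
  have hκ₂ : 0 < κ₂ := hκ₁.trans_le hκ
  refine ⟨2 ^ (2 / ξ) * (8 + 2048 + (2 / κ₁) ^ (1 / (1 - ξ)) + κ₂ * Real.exp (2 / κ₁)) +
    (2048 * κ₂) ^ (1 / ξ), by positivity, fun a η C β hη hη2 h₁ h₂ => ?_⟩
  have ha : 0 < a := pos_of_mul_pos_left (hκ₁.trans_le h₁) hη.le
  have hL := one_le_L1 C β
  have hrpow := rpow_offset_le ha.le hη h₂ (zero_le_one.trans hL) hξ0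
  have hinv : (2 / (a * η)) ^ (1 / (1 - ξ)) ≤ (2 / κ₁) ^ (1 / (1 - ξ)) :=
    Real.rpow_le_rpow (by positivity) (by gcongr) (one_div_nonneg.2 (sub_nonneg.2 hξ))
  have hif : (if ξ = 1 then 2 / (1 - a * η) else 0) ≤ 0 := by
    split_ifs with hξ1
    · exact div_nonpos_of_nonneg_of_nonpos zero_le_two (by linarith [hκ' hξ1])
    · exact le_rfl
  have hexp : a * Real.exp (1 / a) ≤ κ₂ * Real.exp (2 / κ₁) * (L1 C β / η) :=
    (mul_exp_one_div_le ha hη hη2 hκ₁ h₁ h₂).trans (by gcongr)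
  have hone := one_le_rpow_mul_rpow_neg hξ0 hη hη2 hL
  have hdiv := div_le_rpow_mul_rpow_neg hξ0 hξ hη hη2 hL
  have hscale : 0 < L1 C β ^ (1 / ξ) * η ^ (-2 / ξ) := by positivity
  rw [minOffset, mul_div_assoc 2048 (L1 C β)]
  generalize L1 C β ^ (1 / ξ) * η ^ (-2 / ξ) = D at *
  have hinvD := mul_le_mul_of_nonneg_left hone
    (by positivity : 0 ≤ (2 / κ₁) ^ (1 / (1 - ξ)))
  have hexpD := mul_le_mul_of_nonneg_left hdiv
    (by positivity : 0 ≤ κ₂ * Real.exp (2 / κ₁))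
  have hrpowD : 0 ≤ (2048 * κ₂) ^ (1 / ξ) * D := by positivity
  have hinv0 : 0 ≤ (2 / κ₁) ^ (1 / (1 - ξ)) := by positivity
  have hexp0 : 0 ≤ κ₂ * Real.exp (2 / κ₁) * (L1 C β / η) := by positivity
  simp only [max_le_iff]
  refine ⟨⟨⟨?_, ?_⟩, ?_, ?_⟩, ?_, ?_⟩ <;> linarith

lemma exp_neg_le_two_div_sq {y : ℝ} (hy : 0 < y) : Real.exp (-y) ≤ 2 / y ^ 2 := by
  rw [Real.exp_neg, inv_le_comm₀ (Real.exp_pos y) (by positivity), inv_div]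
  linarith [Real.quadratic_le_exp_of_nonneg hy.le]

lemma mul_pow_le_exp_neg {C β y : ℝ} {T : ℕ} (hC : 1 < C) (hβ0 : 0 < β) (hβ1 : β < 1)
    (hy : 1 ≤ y) (hyT : y * L1 C β ≤ T) : C * β ^ T ≤ Real.exp (-y) := by
  have hlog : Real.log C + y ≤ T * Real.log (1 / β) :=
    calc Real.log C + y ≤ y * (Real.log C + 1) := by
          linarith [mul_le_mul_of_nonneg_right hy (Real.log_pos hC).le]
      _ ≤ y * (L1 C β * Real.log (1 / β)) := by
          gcongr
          exact log_add_one_le_L1_mul hβ0 hβ1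
      _ = y * L1 C β * Real.log (1 / β) := (mul_assoc _ _ _).symm
      _ ≤ T * Real.log (1 / β) := by
          have := log_one_div_pos hβ0 hβ1
          gcongr
  have hC0 : 0 < C := zero_lt_one.trans hC
  rw [← Real.log_le_iff_le_exp (by positivity), Real.log_mul hC0.ne' (by positivity),
    Real.log_pow]
  rw [one_div, Real.log_inv] at hlog
  linarith

lemma mul_pow_le_div {C β k κ : ℝ} {T : ℕ} (hC : 1 < C) (hβ0 : 0 ≤ β) (hβ1 : β < 1)
    (hκ : 0 ≤ κ) (hk : 1 ≤ k) (hkκ : 8 ≤ κ * k) (hT0 : 1 ≤ (T : ℝ)) (hT : k * L1 C β ^ 2 ≤ T) :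
    C * β ^ T ≤ κ / (4 * T) := by
  rcases hβ0.eq_or_lt with rfl | hβ0
  · rw [zero_pow (by rintro rfl; norm_num at hT0), mul_zero]
    positivity
  have hL := one_le_L1 C β
  have hkT : 1 ≤ k * T := one_le_mul_of_one_le_of_one_le hk hT0
  have hyT : √(k * T) * L1 C β ≤ T := by
    refine (pow_le_pow_iff_left₀ (by positivity) (by positivity) two_ne_zero).1 ?_
    rw [mul_pow, Real.sq_sqrt (by positivity)]
    calc k * (T : ℝ) * L1 C β ^ 2 = k * L1 C β ^ 2 * T := by ring
      _ ≤ (T : ℝ) * T := by gcongr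
      _ = (T : ℝ) ^ 2 := (sq (T : ℝ)).symm
  calc C * β ^ T ≤ Real.exp (-√(k * T)) :=
        mul_pow_le_exp_neg hC hβ0 hβ1 (Real.one_le_sqrt.2 hkT) hyT
    _ ≤ 2 / √(k * T) ^ 2 := exp_neg_le_two_div_sq (by positivity)
    _ = 2 / (k * T) := by rw [Real.sq_sqrt (by positivity)]
    _ ≤ κ / (4 * T) := by
        rw [div_le_div_iff₀ (by positivity) (by positivity)]
        linarith [mul_le_mul_of_nonneg_right hkκ (zero_le_one.trans hT0)]

lemma div_le_stepsize {c₀ : ℝ} {T : ℕ} (hξ : ξ ≤ 1) (hη2 : η ≤ 2) (ha : 0 ≤ a)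
    (h : κ ≤ a * η) (hT : 1 ≤ (T : ℝ)) (hc0 : 0 ≤ c₀) (hc : c₀ ≤ T) :
    κ / (4 * T) ≤ stepsize a c₀ ξ T := by
  have hrpow : ((T : ℝ) + c₀) ^ ξ ≤ 2 * T :=
    calc ((T : ℝ) + c₀) ^ ξ ≤ (T : ℝ) + c₀ := Real.rpow_le_self_of_one_le (by linarith) hξ
      _ ≤ 2 * T := by linarith
  calc κ / (4 * T) = κ / 2 / (2 * T) := by rw [div_div]; ring_nf
    _ ≤ a / ((T : ℝ) + c₀) ^ ξ := by
        gcongr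
        linarith [mul_le_mul_of_nonneg_left hη2 ha]

lemma tauMix_le {C β c₀ k : ℝ} {T : ℕ} (hξ : ξ ≤ 1) (hκ : 0 ≤ κ) (hη2 : η ≤ 2) (ha : 0 ≤ a)
    (h : κ ≤ a * η) (hC : 1 < C) (hβ0 : 0 ≤ β) (hβ1 : β < 1) (hk : 1 ≤ k) (hkκ : 8 ≤ κ * k)
    (hT0 : 1 ≤ (T : ℝ)) (hT : k * L1 C β ^ 2 ≤ T) (hc0 : 0 ≤ c₀) (hc : c₀ ≤ T) :
    tauMix C β (stepsize a c₀ ξ T) ≤ T :=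
  Nat.sInf_le ((mul_pow_le_div hC hβ0 hβ1 hκ hk hkκ hT0 hT).trans
    (div_le_stepsize hξ hη2 ha h hT0 hc0 hc))

section SampleSize

variable {ρ ε : ℝ}

/-- The factor `L₁ (1 + ρ) (1 + log (1/ε) + log (1 + 1/η))` of the number of iterations: it
collects the mixing time, the size of the problem and the logarithms, and it enters
`sampleBound K p ξ η L ρ ε` with the power `p`. -/
noncomputable def sampleSize (L ρ ε η : ℝ) : ℝ :=
  L * (1 + ρ) * (1 + Real.log (1 / ε) + Real.log (1 + 1 / η))

lemma log_one_div_nonneg (hε : 0 < ε) (hε1 : ε ≤ 1) : 0 ≤ Real.log (1 / ε) :=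
  Real.log_nonneg ((one_le_div hε).2 hε1)

lemma log_one_add_one_div_nonneg (hη : 0 ≤ η) : 0 ≤ Real.log (1 + 1 / η) :=
  Real.log_nonneg (le_add_of_nonneg_right (one_div_nonneg.2 hη))

lemma mul_one_add_le_sampleSize (hL : 0 ≤ L) (hρ : 0 ≤ ρ) (hε : 0 < ε) (hε1 : ε ≤ 1)
    (hη : 0 ≤ η) : L * (1 + ρ) ≤ sampleSize L ρ ε η :=
  le_mul_of_one_le_right (by positivity)
    (by linarith [log_one_div_nonneg hε hε1, log_one_add_one_div_nonneg hη])

lemma le_sampleSize (hL : 0 ≤ L) (hρ : 0 ≤ ρ) (hε : 0 < ε) (hε1 : ε ≤ 1) (hη : 0 ≤ η) :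
    L ≤ sampleSize L ρ ε η :=
  (le_mul_of_one_le_right hL (le_add_of_nonneg_right hρ)).trans
    (mul_one_add_le_sampleSize hL hρ hε hε1 hη)

lemma mul_sq_le_sampleSize_sq (hL : 1 ≤ L) (hρ : 0 ≤ ρ) (hε : 0 < ε) (hε1 : ε ≤ 1)
    (hη : 0 ≤ η) : L * ρ ^ 2 ≤ sampleSize L ρ ε η ^ 2 :=
  calc L * ρ ^ 2 ≤ L ^ 2 * (1 + ρ) ^ 2 := by
        gcongr
        · exact le_self_pow₀ hL two_ne_zero
        · linarith
    _ = (L * (1 + ρ)) ^ 2 := (mul_pow _ _ _).symm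
    _ ≤ sampleSize L ρ ε η ^ 2 := by
        gcongr
        exact mul_one_add_le_sampleSize (by positivity) hρ hε hε1 hη

lemma sq_le_sampleSize_sq (hL : 1 ≤ L) (hρ : 0 ≤ ρ) (hε : 0 < ε) (hε1 : ε ≤ 1) (hη : 0 ≤ η) :
    ρ ^ 2 ≤ sampleSize L ρ ε η ^ 2 :=
  (le_mul_of_one_le_left (sq_nonneg ρ) hL).trans (mul_sq_le_sampleSize_sq hL hρ hε hε1 hη)

lemma mul_le_mul_sampleSize_sq {k g : ℝ} (hk : 0 ≤ k) (hg : g ≤ k * ρ ^ 2) (hL : 1 ≤ L)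
    (hρ : 0 ≤ ρ) (hε : 0 < ε) (hε1 : ε ≤ 1) (hη : 0 ≤ η) :
    L * g ≤ k * sampleSize L ρ ε η ^ 2 :=
  calc L * g ≤ L * (k * ρ ^ 2) := by gcongr
    _ = k * (L * ρ ^ 2) := mul_left_comm _ _ _
    _ ≤ k * sampleSize L ρ ε η ^ 2 := by
        gcongr
        exact mul_sq_le_sampleSize_sq hL hρ hε hε1 hη

lemma log_le_sampleSize (hL : 1 ≤ L) (hρ : 0 ≤ ρ) (hε : 0 < ε) (hε1 : ε ≤ 1) (hη : 0 ≤ η) :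
    1 + Real.log (1 / ε) + Real.log (1 + 1 / η) ≤ sampleSize L ρ ε η :=
  le_mul_of_one_le_left
    (by linarith [log_one_div_nonneg hε hε1, log_one_add_one_div_nonneg hη])
    (one_le_mul_of_one_le_of_one_le hL (le_add_of_nonneg_right hρ))

lemma log_one_div_eps_le_sampleSize (hL : 1 ≤ L) (hρ : 0 ≤ ρ) (hε : 0 < ε) (hε1 : ε ≤ 1)
    (hη : 0 ≤ η) : Real.log (1 / ε) ≤ sampleSize L ρ ε η := by
  linarith [log_le_sampleSize hL hρ hε hε1 hη, log_one_add_one_div_nonneg hη]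

lemma log_one_div_eta_le_sampleSize (hL : 1 ≤ L) (hρ : 0 ≤ ρ) (hε : 0 < ε) (hε1 : ε ≤ 1)
    (hη : 0 < η) : Real.log (1 / η) ≤ sampleSize L ρ ε η := by
  have hlog : Real.log (1 / η) ≤ Real.log (1 + 1 / η) :=
    Real.log_le_log (by positivity) (by linarith)
  linarith [log_le_sampleSize hL hρ hε hε1 hη.le, log_one_div_nonneg hε hε1]

lemma mul_rpow_mul_le_sampleBound {K q y : ℝ} (hξ0 : 0 < ξ) (hq : q ≤ 3 / ξ)
    (hy : 0 ≤ y) (hyK : y ≤ K) (hL : 1 ≤ L) (hρ : 0 ≤ ρ) (hε : 0 < ε) (hε1 : ε ≤ 1)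
    (hη : 0 ≤ η) : y * L ^ q * η ^ (-2 / ξ) ≤ sampleBound K (3 / ξ) ξ η L ρ ε := by
  have hLZ := le_sampleSize (zero_le_one.trans hL) hρ hε hε1 hη
  have hK : 0 ≤ K := hy.trans hyK
  have hε' : 1 ≤ ε ^ (-1 / ξ) :=
    Real.one_le_rpow_of_pos_of_le_one_of_nonpos hε hε1
      (div_nonpos_of_nonpos_of_nonneg (by norm_num) hξ0.le)
  have hrpow : L ^ q ≤ sampleSize L ρ ε η ^ (3 / ξ) :=
    (Real.rpow_le_rpow_of_exponent_le hL hq).trans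
      (Real.rpow_le_rpow (by positivity) hLZ (by positivity))
  calc y * L ^ q * η ^ (-2 / ξ) ≤ K * sampleSize L ρ ε η ^ (3 / ξ) * 1 * η ^ (-2 / ξ) := by
        rw [mul_one]
        gcongr
    _ ≤ K * sampleSize L ρ ε η ^ (3 / ξ) * ε ^ (-1 / ξ) * η ^ (-2 / ξ) := by
        have : 0 ≤ sampleSize L ρ ε η := by linarith
        gcongr

lemma mul_sq_le_sampleBound {K k : ℝ} (hξ0 : 0 < ξ) (hξ : ξ ≤ 1) (hη : 0 < η) (hη2 : η ≤ 2)
    (hk : 0 ≤ k) (hkK : k * 2 ^ (2 / ξ) ≤ K) (hL : 1 ≤ L) (hρ : 0 ≤ ρ) (hε : 0 < ε)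
    (hε1 : ε ≤ 1) : k * L ^ 2 ≤ sampleBound K (3 / ξ) ξ η L ρ ε :=
  calc k * L ^ 2 ≤ k * L ^ 2 * (2 ^ (2 / ξ) * η ^ (-2 / ξ)) :=
        le_mul_of_one_le_right (by positivity) (one_le_two_rpow_mul_rpow_neg hξ0 hη hη2)
    _ = k * 2 ^ (2 / ξ) * L ^ (2 : ℝ) * η ^ (-2 / ξ) := by
        rw [Real.rpow_two]
        ring
    _ ≤ sampleBound K (3 / ξ) ξ η L ρ ε :=
        mul_rpow_mul_le_sampleBound hξ0 ((le_div_iff₀ hξ0).2 (by linarith)) (by positivity) hkK hL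
          hρ hε hε1 hη.le

lemma mul_pow_div_le_rpow_of_sampleBound_le {B K T : ℝ} (hξ0 : 0 < ξ) (hB : 0 ≤ B)
    (hBK : B ^ (1 / ξ) ≤ K) (hZ : 0 ≤ sampleSize L ρ ε η) (hε : 0 ≤ ε) (hη : 0 ≤ η)
    (hT : sampleBound K (3 / ξ) ξ η L ρ ε ≤ T) :
    B * sampleSize L ρ ε η ^ 3 / (ε * η ^ 2) ≤ T ^ ξ := by
  calc B * sampleSize L ρ ε η ^ 3 / (ε * η ^ 2)
      = (B ^ (1 / ξ) * sampleSize L ρ ε η ^ (3 / ξ) * ε ^ (-1 / ξ) * η ^ (-2 / ξ)) ^ ξ := by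
        rw [Real.mul_rpow (by positivity) (by positivity),
          Real.mul_rpow (by positivity) (by positivity),
          Real.mul_rpow (by positivity) (by positivity), ← Real.rpow_mul hB, ← Real.rpow_mul hZ,
          ← Real.rpow_mul hε, ← Real.rpow_mul hη, div_mul_cancel₀ _ hξ0.ne',
          div_mul_cancel₀ _ hξ0.ne', div_mul_cancel₀ _ hξ0.ne', div_mul_cancel₀ _ hξ0.ne',
          Real.rpow_one, Real.rpow_neg_one, Real.rpow_neg hη, Real.rpow_two, Real.rpow_ofNat]
        ring
    _ ≤ T ^ ξ := by
        gcongr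
        refine le_trans ?_ hT
        rw [sampleBound, ← sampleSize]
        gcongr

end SampleSize

end SampleComplexity

section ErrorBound

/-- The bound for `E ‖θ_T - θ*‖²` behind the sample complexity, in terms of the offset `c`,
`L = L₁`, the initial error `b` and the size `g` of the noise. For `ξ = 1` it is a bound only if
`1 ≤ a * η`. -/
noncomputable def errorBound (a ξ c η L b g : ℝ) (T : ℕ) : ℝ :=
  if ξ = 1 then
    b * (c / (T + c)) ^ (a * η) +
      16 * (L * g) * ((60 * a ^ 2 + 10 * a) * Real.log (T + c) / (T + c))
  else
    b * Real.exp (-(η * a / (1 - ξ)) * ((T + c) ^ (1 - ξ) - c ^ (1 - ξ))) +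
      2240 * L * g * (a / (η * (T + c) ^ ξ))

section LtOne

variable {ξ γ κ κ₁ κ₂ a η c x : ℝ}

lemma exp_neg_mul_rpow_le (hξ0 : 0 < ξ) (hξ : ξ < 1) (hγ : 0 < γ) (hx : 0 < x) :
    Real.exp (-(γ * x ^ (1 - ξ))) ≤ (ξ / (1 - ξ) / γ) ^ (ξ / (1 - ξ)) / x ^ ξ := by
  have hξ' : 0 < 1 - ξ := sub_pos.2 hξ
  set r := ξ / (1 - ξ) with hr
  have hr0 : 0 < r := by positivity
  have hexp : (r / γ)⁻¹ * x ^ (1 - ξ) ≤ Real.exp (γ * x ^ (1 - ξ) / r) := by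
    rw [inv_div, div_mul_eq_mul_div]
    linarith [Real.add_one_le_exp (γ * x ^ (1 - ξ) / r)]
  have hpow : ((r / γ) ^ r / x ^ ξ)⁻¹ ≤ Real.exp (γ * x ^ (1 - ξ)) :=
    calc ((r / γ) ^ r / x ^ ξ)⁻¹ = ((r / γ)⁻¹ * x ^ (1 - ξ)) ^ r := by
          rw [Real.mul_rpow (by positivity) (by positivity), Real.inv_rpow (by positivity),
            ← Real.rpow_mul hx.le, hr, mul_div_cancel₀ _ hξ'.ne', inv_div, div_eq_inv_mul]
      _ ≤ Real.exp (γ * x ^ (1 - ξ) / r) ^ r := Real.rpow_le_rpow (by positivity) hexp hr0.le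
      _ = Real.exp (γ * x ^ (1 - ξ)) := by rw [← Real.exp_mul, div_mul_cancel₀ _ hr0.ne']
  rw [Real.exp_neg]
  exact inv_le_of_inv_le₀ (by positivity) hpow

/-- The rate `κ / (1 - ξ) * (1 - (1/2) ^ (1 - ξ))` at which the initial error decays
exponentially in `x ^ (1 - ξ)`, once the offset is at most `x / 2`. -/
noncomputable def decayRate (κ ξ : ℝ) : ℝ := κ / (1 - ξ) * (1 - (1 / 2) ^ (1 - ξ))

lemma decayRate_pos (hξ : ξ < 1) (hκ : 0 < κ) : 0 < decayRate κ ξ := by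
  have hξ' : 0 < 1 - ξ := sub_pos.2 hξ
  exact mul_pos (div_pos hκ hξ')
    (sub_pos.2 (Real.rpow_lt_one (by norm_num) (by norm_num) hξ'))

lemma decayRate_mul_rpow_le (hξ : ξ < 1) (hκ : 0 ≤ κ) (h : κ ≤ a * η) (hc0 : 0 ≤ c)
    (hc : c ≤ x / 2) :
    decayRate κ ξ * x ^ (1 - ξ) ≤ η * a / (1 - ξ) * (x ^ (1 - ξ) - c ^ (1 - ξ)) := by
  have hξ' : 0 < 1 - ξ := sub_pos.2 hξ
  have hx : 0 ≤ x := by linarith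
  have hrpow : c ^ (1 - ξ) ≤ (1 / 2) ^ (1 - ξ) * x ^ (1 - ξ) := by
    rw [← Real.mul_rpow (by norm_num) hx]
    exact Real.rpow_le_rpow hc0 (by linarith) hξ'.le
  have hcx : c ^ (1 - ξ) ≤ x ^ (1 - ξ) := Real.rpow_le_rpow hc0 (by linarith) hξ'.le
  calc decayRate κ ξ * x ^ (1 - ξ)
      = κ / (1 - ξ) * (x ^ (1 - ξ) - (1 / 2) ^ (1 - ξ) * x ^ (1 - ξ)) := by
        rw [decayRate]
        ring
    _ ≤ κ / (1 - ξ) * (x ^ (1 - ξ) - c ^ (1 - ξ)) := by gcongr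
    _ ≤ η * a / (1 - ξ) * (x ^ (1 - ξ) - c ^ (1 - ξ)) := by
        rw [mul_comm η]
        have := sub_nonneg.2 hcx
        gcongr

/-- The constant in the bound of the initial error by a multiple of `x ^ (-ξ)`. -/
noncomputable def decayConst (κ ξ : ℝ) : ℝ :=
  (ξ / (1 - ξ) / decayRate κ ξ) ^ (ξ / (1 - ξ))

lemma decayConst_pos (hξ0 : 0 < ξ) (hξ : ξ < 1) (hκ : 0 < κ) : 0 < decayConst κ ξ :=
  Real.rpow_pos_of_pos (div_pos (div_pos hξ0 (sub_pos.2 hξ)) (decayRate_pos hξ hκ)) _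

lemma exp_neg_mul_rpow_sub_le (hξ0 : 0 < ξ) (hξ : ξ < 1) (hκ : 0 < κ) (h : κ ≤ a * η)
    (hc0 : 0 ≤ c) (hc : c ≤ x / 2) (hx : 0 < x) :
    Real.exp (-(η * a / (1 - ξ)) * (x ^ (1 - ξ) - c ^ (1 - ξ))) ≤ decayConst κ ξ / x ^ ξ := by
  refine le_trans ?_ (exp_neg_mul_rpow_le hξ0 hξ (decayRate_pos hξ hκ) hx)
  rw [neg_mul, Real.exp_le_exp, neg_le_neg_iff]
  exact decayRate_mul_rpow_le hξ hκ.le h hc0 hc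

lemma one_le_four_div_sq (hη : 0 < η) (hη2 : η ≤ 2) : 1 ≤ 4 / η ^ 2 := by
  rw [one_le_div (by positivity)]
  calc η ^ 2 ≤ 2 ^ 2 := by gcongr
    _ = 4 := by norm_num

lemma div_mul_rpow_le (h : a * η ≤ κ) (hη : 0 < η) (hx : 0 ≤ x) :
    a / (η * x ^ ξ) ≤ κ / (η ^ 2 * x ^ ξ) :=
  calc a / (η * x ^ ξ) = a * η / (η ^ 2 * x ^ ξ) := by
        rw [sq, mul_assoc η η, mul_comm a, mul_div_mul_left _ _ hη.ne']
    _ ≤ κ / (η ^ 2 * x ^ ξ) := by gcongr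

lemma initial_term_le_of_lt_one {Z b : ℝ} (hξ0 : 0 < ξ) (hξ : ξ < 1) (hκ : 0 < κ)
    (h : κ ≤ a * η) (hη : 0 < η) (hη2 : η ≤ 2) (hb : b ≤ 5 * Z ^ 2) (hc0 : 0 ≤ c)
    (hc : c ≤ x / 2) (hx : 0 < x) :
    b * Real.exp (-(η * a / (1 - ξ)) * (x ^ (1 - ξ) - c ^ (1 - ξ))) ≤
      20 * decayConst κ ξ * Z ^ 2 / (η ^ 2 * x ^ ξ) := by
  have hq := decayConst_pos hξ0 hξ hκ
  calc b * Real.exp (-(η * a / (1 - ξ)) * (x ^ (1 - ξ) - c ^ (1 - ξ)))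
      ≤ 5 * Z ^ 2 * (decayConst κ ξ / x ^ ξ) * 1 := by
        rw [mul_one]
        exact mul_le_mul hb (exp_neg_mul_rpow_sub_le hξ0 hξ hκ h hc0 hc hx)
          (Real.exp_pos _).le (by positivity)
    _ ≤ 5 * Z ^ 2 * (decayConst κ ξ / x ^ ξ) * (4 / η ^ 2) := by
        gcongr
        exact one_le_four_div_sq hη hη2
    _ = 20 * decayConst κ ξ * Z ^ 2 / (η ^ 2 * x ^ ξ) := by ring

lemma noise_term_le_of_lt_one {Z L g : ℝ} (ha : 0 ≤ a) (h : a * η ≤ κ) (hη : 0 < η)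
    (hg : L * g ≤ 9 * Z ^ 2) (hx : 0 ≤ x) :
    2240 * L * g * (a / (η * x ^ ξ)) ≤ 20160 * κ * Z ^ 2 / (η ^ 2 * x ^ ξ) :=
  calc 2240 * L * g * (a / (η * x ^ ξ)) = 2240 * (L * g) * (a / (η * x ^ ξ)) := by ring
    _ ≤ 2240 * (9 * Z ^ 2) * (κ / (η ^ 2 * x ^ ξ)) :=
        mul_le_mul (by linarith) (div_mul_rpow_le h hη hx) (by positivity) (by positivity)
    _ = 20160 * κ * Z ^ 2 / (η ^ 2 * x ^ ξ) := by ring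

lemma errorBound_le_of_lt_one {ε Z L b g : ℝ} {T : ℕ} (hξ0 : 0 < ξ) (hξ : ξ < 1) (hκ₁ : 0 < κ₁)
    (h₁ : κ₁ ≤ a * η) (h₂ : a * η ≤ κ₂) (hη : 0 < η) (hη2 : η ≤ 2) (hε : 0 < ε) (hZ : 1 ≤ Z)
    (hb : b ≤ 5 * Z ^ 2) (hg : L * g ≤ 9 * Z ^ 2) (hc0 : 0 < c) (hc : c ≤ T)
    (hT : (20 * decayConst κ₁ ξ + 20160 * κ₂) * Z ^ 3 / (ε * η ^ 2) ≤ (T : ℝ) ^ ξ) :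
    errorBound a ξ c η L b g T ≤ ε := by
  have ha : 0 < a := pos_of_mul_pos_left (hκ₁.trans_le h₁) hη.le
  have hκ₂ : 0 < κ₂ := hκ₁.trans_le (h₁.trans h₂)
  have hq := decayConst_pos hξ0 hξ hκ₁
  rw [errorBound, if_neg hξ.ne]
  set x := (T : ℝ) + c
  have hx : 0 < x := by positivity
  have hxξ : (20 * decayConst κ₁ ξ + 20160 * κ₂) * Z ^ 3 / (ε * η ^ 2) ≤ x ^ ξ :=
    hT.trans (Real.rpow_le_rpow (by positivity) (by linarith) hξ0.le)
  calc b * Real.exp (-(η * a / (1 - ξ)) * (x ^ (1 - ξ) - c ^ (1 - ξ))) +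
        2240 * L * g * (a / (η * x ^ ξ))
      ≤ (20 * decayConst κ₁ ξ + 20160 * κ₂) * Z ^ 2 / (η ^ 2 * x ^ ξ) := by
        rw [add_mul, add_div]
        exact add_le_add
          (initial_term_le_of_lt_one hξ0 hξ hκ₁ h₁ hη hη2 hb hc0.le (by linarith) hx)
          (noise_term_le_of_lt_one ha.le h₂ hη hg hx.le)
    _ ≤ (20 * decayConst κ₁ ξ + 20160 * κ₂) * Z ^ 3 / (η ^ 2 * x ^ ξ) := by
        gcongr
        norm_num
    _ ≤ ε := by
        rw [div_le_iff₀ (by positivity)] at hxξ ⊢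
        linarith

end LtOne

section EqOne

variable {κ a η c n Z ε K b : ℝ} {T : ℕ}

lemma initial_term_le_of_eq_one (hη : 0 < η) (hZ : 0 < Z) (hε : 0 < ε) (hn : 0 < n)
    (hT : n ^ 2 * Z ^ 3 / (ε * η ^ 2) ≤ T) (h₁ : 1 ≤ a * η) (hK : 0 ≤ K) (hc0 : 0 < c)
    (hc : c ≤ K * (Z / η ^ 2)) (hb : b ≤ 5 * Z ^ 2) (hnK : 10 * K ≤ n ^ 2) :
    b * (c / (T + c)) ^ (a * η) ≤ ε / 2 := by
  have hx : n ^ 2 * Z ^ 3 / (ε * η ^ 2) ≤ T + c := hT.trans (le_add_of_nonneg_right hc0.le)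
  have hx0 : 0 < (T : ℝ) + c := by positivity
  calc b * (c / (T + c)) ^ (a * η)
      ≤ 5 * Z ^ 2 * (c / (T + c)) := by
        refine mul_le_mul hb ?_ (by positivity) (by positivity)
        exact Real.rpow_le_self_of_le_one (by positivity)
          ((div_le_one hx0).2 (le_add_of_nonneg_left T.cast_nonneg)) h₁
    _ ≤ 5 * Z ^ 2 * (K * (Z / η ^ 2) / (n ^ 2 * Z ^ 3 / (ε * η ^ 2))) := by gcongr
    _ = 10 * K / n ^ 2 * (ε / 2) := by
        field_simp
        ring
    _ ≤ ε / 2 :=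
        mul_le_of_le_one_left (by positivity) ((div_le_one (by positivity)).2 hnK)

lemma exp_one_le_sampleCount (hη : 0 < η) (hη2 : η ≤ 2) (hZ : 1 ≤ Z) (hε : 0 < ε) (hε1 : ε ≤ 1)
    (hn : 16 ≤ n) : Real.exp 1 ≤ n ^ 2 * Z ^ 3 / (ε * η ^ 2) := by
  calc Real.exp 1 ≤ 16 ^ 2 * 1 ^ 3 / (1 * 2 ^ 2) := by linarith [Real.exp_one_lt_d9]
    _ ≤ n ^ 2 * Z ^ 3 / (ε * η ^ 2) := by gcongr

lemma log_sampleCount_le (hη : 0 < η) (hZ : 1 ≤ Z) (hε : 0 < ε) (hn : 16 ≤ n)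
    (hεZ : Real.log (1 / ε) ≤ Z) (hηZ : Real.log (1 / η) ≤ Z) :
    Real.log (n ^ 2 * Z ^ 3 / (ε * η ^ 2)) ≤ 8 * n * Z := by
  have hlog : Real.log (n ^ 2 * Z ^ 3 / (ε * η ^ 2)) =
      2 * Real.log n + 3 * Real.log Z + Real.log (1 / ε) + 2 * Real.log (1 / η) := by
    rw [Real.log_div (by positivity) (by positivity), Real.log_mul (by positivity) (by positivity),
      Real.log_mul (by positivity) (by positivity), Real.log_pow, Real.log_pow, Real.log_pow,
      one_div, one_div, Real.log_inv, Real.log_inv]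
    push_cast
    ring
  have hlogn := Real.log_le_sub_one_of_pos (by linarith : 0 < n)
  have hlogZ := Real.log_le_sub_one_of_pos (by linarith : 0 < Z)
  have hnZ : n ≤ n * Z := le_mul_of_one_le_right (by linarith) hZ
  have hZn : 16 * Z ≤ n * Z := by gcongr
  linarith

lemma noise_term_le_of_eq_one {g : ℝ} (hη : 0 < η) (hη2 : η ≤ 2) (hZ : 1 ≤ Z) (hε : 0 < ε)
    (hε1 : ε ≤ 1) (hn : 16 ≤ n) (hT : n ^ 2 * Z ^ 3 / (ε * η ^ 2) ≤ T)
    (hεZ : Real.log (1 / ε) ≤ Z) (hηZ : Real.log (1 / η) ≤ Z) (ha : 0 ≤ a) (h₂ : a * η ≤ κ)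
    (hc0 : 0 ≤ c) (hg : g ≤ 9 * Z ^ 2) (hnκ : 2304 * (60 * κ ^ 2 + 20 * κ) ≤ n) :
    16 * g * ((60 * a ^ 2 + 10 * a) * Real.log (T + c) / (T + c)) ≤ ε / 2 := by
  have hκ : 0 ≤ κ := (mul_nonneg ha hη.le).trans h₂
  have hNe := exp_one_le_sampleCount hη hη2 hZ hε hε1 hn
  have hx : n ^ 2 * Z ^ 3 / (ε * η ^ 2) ≤ T + c := hT.trans (le_add_of_nonneg_right hc0)
  have hlog : Real.log (T + c) / (T + c) ≤ 8 * n * Z / (n ^ 2 * Z ^ 3 / (ε * η ^ 2)) :=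
    (Real.log_div_self_antitoneOn hNe (hNe.trans hx) hx).trans
      (div_le_div_of_nonneg_right (log_sampleCount_le hη hZ hε hn hεZ hηZ) (by positivity))
  have hlog0 : 0 ≤ Real.log (T + c) / (T + c) :=
    div_nonneg (Real.log_nonneg (by linarith [Real.add_one_le_exp 1])) (by positivity)
  have hcoeff : 60 * a ^ 2 + 10 * a ≤ (60 * κ ^ 2 + 20 * κ) / η ^ 2 := by
    rw [le_div_iff₀ (by positivity)]
    calc (60 * a ^ 2 + 10 * a) * η ^ 2 = 60 * (a * η) ^ 2 + 10 * (a * η * η) := by ring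
      _ ≤ 60 * κ ^ 2 + 10 * (κ * 2) := by gcongr
      _ = 60 * κ ^ 2 + 20 * κ := by ring
  calc 16 * g * ((60 * a ^ 2 + 10 * a) * Real.log (T + c) / (T + c))
      = 16 * g * ((60 * a ^ 2 + 10 * a) * (Real.log (T + c) / (T + c))) := by
        rw [mul_div_assoc (60 * a ^ 2 + 10 * a)]
    _ ≤ 16 * (9 * Z ^ 2) * ((60 * κ ^ 2 + 20 * κ) / η ^ 2 *
          (8 * n * Z / (n ^ 2 * Z ^ 3 / (ε * η ^ 2)))) :=
        mul_le_mul (by linarith) (mul_le_mul hcoeff hlog hlog0 (by positivity)) (by positivity)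
          (by positivity)
    _ = 2304 * (60 * κ ^ 2 + 20 * κ) / n * (ε / 2) := by
        field_simp
        ring
    _ ≤ ε / 2 :=
        mul_le_of_le_one_left (by positivity) ((div_le_one (by positivity)).2 hnκ)

lemma errorBound_le_of_eq_one {L g : ℝ} (h₁ : 1 ≤ a * η) (h₂ : a * η ≤ κ) (hη : 0 < η)
    (hη2 : η ≤ 2) (hε : 0 < ε) (hε1 : ε ≤ 1) (hZ : 1 ≤ Z) (hεZ : Real.log (1 / ε) ≤ Z)
    (hηZ : Real.log (1 / η) ≤ Z) (hb : b ≤ 5 * Z ^ 2) (hg : L * g ≤ 9 * Z ^ 2) (hc0 : 0 < c)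
    (hK : 0 ≤ K) (hc : c ≤ K * (Z / η ^ 2)) (hn : 16 ≤ n) (hnK : 10 * K ≤ n)
    (hnκ : 2304 * (60 * κ ^ 2 + 20 * κ) ≤ n) (hT : n ^ 2 * Z ^ 3 / (ε * η ^ 2) ≤ T) :
    errorBound a 1 c η L b g T ≤ ε := by
  have ha : 0 < a := pos_of_mul_pos_left (zero_lt_one.trans_le h₁) hη.le
  rw [errorBound, if_pos rfl]
  have hinit := initial_term_le_of_eq_one hη (by linarith) hε (by linarith) hT h₁ hK hc0 hc hb
    (hnK.trans (le_self_pow₀ (by linarith) two_ne_zero))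
  have hnoise := noise_term_le_of_eq_one hη hη2 hZ hε hε1 hn hT hεZ hηZ ha.le h₂ hc0.le hg hnκ
  linarith

end EqOne

end ErrorBound

section ExistsSampleBound

variable {ξ κ₁ κ₂ : ℝ}

lemma exists_errorBound_le (hξ0 : 0 < ξ) (hξ : ξ ≤ 1) (hκ₁ : 0 < κ₁) (hκ : κ₁ ≤ κ₂)
    (hκ' : ξ = 1 → 1 ≤ κ₁) {K₀ : ℝ} (hK₀ : 0 ≤ K₀) :
    ∃ B : ℝ, 0 < B ∧ ∀ (a η L ε ρ b g c : ℝ) (T : ℕ), 0 < η → η ≤ 2 → κ₁ ≤ a * η → a * η ≤ κ₂ →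
      1 ≤ L → 0 < ε → ε ≤ 1 → 0 ≤ ρ → b ≤ 5 * ρ ^ 2 → g ≤ 9 * ρ ^ 2 → 0 < c → c ≤ T →
      c ≤ K₀ * (L ^ (1 / ξ) * η ^ (-2 / ξ)) →
      B * sampleSize L ρ ε η ^ 3 / (ε * η ^ 2) ≤ (T : ℝ) ^ ξ →
      errorBound a ξ c η L b g T ≤ ε := by
  have hκ₂ : 0 < κ₂ := hκ₁.trans_le hκ
  rcases hξ.lt_or_eq with hξ | rfl
  · have hq := decayConst_pos hξ0 hξ hκ₁
    refine ⟨20 * decayConst κ₁ ξ + 20160 * κ₂, by positivity, ?_⟩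
    intro a η L ε ρ b g c T hη hη2 h₁ h₂ hL hε hε1 hρ hb hg hc0 hc _ hT
    have hρZ := sq_le_sampleSize_sq hL hρ hε hε1 hη.le
    exact errorBound_le_of_lt_one hξ0 hξ hκ₁ h₁ h₂ hη hη2 hε
      (hL.trans (le_sampleSize (zero_le_one.trans hL) hρ hε hε1 hη.le)) (by linarith)
      (mul_le_mul_sampleSize_sq (by norm_num) hg hL hρ hε hε1 hη.le) hc0 hc hT
  · refine ⟨(16 + 10 * K₀ + 2304 * (60 * κ₂ ^ 2 + 20 * κ₂)) ^ 2, by positivity, ?_⟩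
    intro a η L ε ρ b g c T hη hη2 h₁ h₂ hL hε hε1 hρ hb hg hc0 _ hcK hT
    have hρZ := sq_le_sampleSize_sq hL hρ hε hε1 hη.le
    have hLZ := le_sampleSize (zero_le_one.trans hL) hρ hε hε1 hη.le
    have hcZ : c ≤ K₀ * (sampleSize L ρ ε η / η ^ 2) := by
      rw [div_one, Real.rpow_one, div_one, Real.rpow_neg hη.le, Real.rpow_two,
        ← div_eq_mul_inv] at hcK
      exact hcK.trans (by gcongr)
    rw [Real.rpow_one] at hT
    have hκ₂' : 0 ≤ 2304 * (60 * κ₂ ^ 2 + 20 * κ₂) := by positivity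
    exact errorBound_le_of_eq_one ((hκ' rfl).trans h₁) h₂ hη hη2 hε hε1 (hL.trans hLZ)
      (log_one_div_eps_le_sampleSize hL hρ hε hε1 hη.le)
      (log_one_div_eta_le_sampleSize hL hρ hε hε1 hη) (by linarith)
      (mul_le_mul_sampleSize_sq (by norm_num) hg hL hρ hε hε1 hη.le) hc0 hK₀ hcZ (by linarith)
      (by linarith) (by linarith) hT

lemma exists_sampleBound (hξ0 : 0 < ξ) (hξ : ξ ≤ 1) (hκ₁ : 0 < κ₁) (hκ : κ₁ ≤ κ₂)
    (hκ' : ξ = 1 → 1 ≤ κ₁) :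
    ∃ K : ℝ, 0 < K ∧ ∀ (a η C β ε ρ b g : ℝ) (T : ℕ), 0 < η → η ≤ 2 → κ₁ ≤ a * η → a * η ≤ κ₂ →
      1 < C → 0 ≤ β → β < 1 → 0 < ε → ε ≤ 1 → 0 ≤ ρ → b ≤ 5 * ρ ^ 2 → g ≤ 9 * ρ ^ 2 →
      sampleBound K (3 / ξ) ξ η (L1 C β) ρ ε ≤ T →
      tauMix C β (stepsize a (minOffset a ξ η C β) ξ T) ≤ T ∧
        errorBound a ξ (minOffset a ξ η C β) η (L1 C β) b g T ≤ ε := by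
  obtain ⟨K₀, hK₀, hoff⟩ := exists_minOffset_le hξ0 hξ hκ₁ hκ hκ'
  obtain ⟨B, hB, herr⟩ := exists_errorBound_le hξ0 hξ hκ₁ hκ hκ' hK₀.le
  have hkB : 0 ≤ (1 + 8 / κ₁) * 2 ^ (2 / ξ) := by positivity
  have hB' : 0 < B ^ (1 / ξ) := by positivity
  refine ⟨K₀ + (1 + 8 / κ₁) * 2 ^ (2 / ξ) + B ^ (1 / ξ), by positivity, ?_⟩
  intro a η C β ε ρ b g T hη hη2 h₁ h₂ hC hβ0 hβ1 hε hε1 hρ hb hg hT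
  have ha : 0 < a := pos_of_mul_pos_left (hκ₁.trans_le h₁) hη.le
  have hL := one_le_L1 C β
  have hc0 := minOffset_pos a ξ η C β
  have hcK := hoff a η C β hη hη2 h₁ h₂
  have hcT : minOffset a ξ η C β ≤ T := by
    refine hcK.trans (le_trans ?_ hT)
    rw [← mul_assoc]
    exact mul_rpow_mul_le_sampleBound hξ0 (by gcongr; norm_num) hK₀.le (by linarith) hL hρ hε hε1
      hη.le
  have hmix : (1 + 8 / κ₁) * L1 C β ^ 2 ≤ T :=
    (mul_sq_le_sampleBound hξ0 hξ hη hη2 (by positivity) (by linarith) hL hρ hε hε1).trans hT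
  have hZ := (zero_le_one.trans hL).trans (le_sampleSize (zero_le_one.trans hL) hρ hε hε1 hη.le)
  refine ⟨tauMix_le hξ hκ₁.le hη2 ha.le h₁ hC hβ0 hβ1 (le_add_of_nonneg_right (by positivity))
    (by rw [mul_add, mul_div_cancel₀ _ hκ₁.ne']; linarith)
    ((by norm_num : (1 : ℝ) ≤ 8).trans ((eight_le_of_minOffset_le le_rfl).trans hcT)) hmix hc0.le
    hcT, ?_⟩
  exact herr a η _ ε ρ b g _ T hη hη2 h₁ h₂ hL hε hε1 hρ hb hg hc0 hcT hcK
    (mul_pow_div_le_rpow_of_sampleBound_le hξ0 hB.le (by linarith) hZ hε.le hη.le hT)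

end ExistsSampleBound

namespace PolicyEvaluation

section MeanSquareErrorBound

variable {S : Type*} {A : Type*} [Fintype S] [Fintype A] {d : ℕ} (M : PolicyEvaluation S A d)
  {Ω : Type*} [MeasurableSpace Ω]

lemma sq_scale_le (Pr : Measure Ω) (θ₀ : Ω → EuclideanSpace ℝ (Fin d))
    (θs : EuclideanSpace ℝ (Fin d)) :
    (M.rmax + 3 * ‖θs‖) ^ 2 ≤ 9 * (√(∫ ω, ‖θ₀ ω - θs‖ ^ 2 ∂Pr) + M.rmax + ‖θs‖) ^ 2 := by
  have hr := M.rmax_nonneg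
  calc (M.rmax + 3 * ‖θs‖) ^ 2
      ≤ (3 * (√(∫ ω, ‖θ₀ ω - θs‖ ^ 2 ∂Pr) + M.rmax + ‖θs‖)) ^ 2 := by
        gcongr
        linarith [Real.sqrt_nonneg (∫ ω, ‖θ₀ ω - θs‖ ^ 2 ∂Pr)]
    _ = 9 * (√(∫ ω, ‖θ₀ ω - θs‖ ^ 2 ∂Pr) + M.rmax + ‖θs‖) ^ 2 := by ring

lemma initialError_le (Pr : Measure Ω) (θ₀ : Ω → EuclideanSpace ℝ (Fin d))
    (θs : EuclideanSpace ℝ (Fin d)) :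
    2 * (∫ ω, ‖θ₀ ω - θs‖ ^ 2 ∂Pr) + (M.rmax + 3 * ‖θs‖) ^ 2 / 4 ≤
      5 * (√(∫ ω, ‖θ₀ ω - θs‖ ^ 2 ∂Pr) + M.rmax + ‖θs‖) ^ 2 := by
  have hint : ∫ ω, ‖θ₀ ω - θs‖ ^ 2 ∂Pr ≤
      (√(∫ ω, ‖θ₀ ω - θs‖ ^ 2 ∂Pr) + M.rmax + ‖θs‖) ^ 2 :=
    (Real.sqrt_le_left (by have := M.rmax_nonneg; positivity)).1
      (by linarith [M.rmax_nonneg, norm_nonneg θs])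
  linarith [M.sq_scale_le Pr θ₀ θs, sq_nonneg (√(∫ ω, ‖θ₀ ω - θs‖ ^ 2 ∂Pr) + M.rmax + ‖θs‖)]

variable {M} in
lemma meanSquareLE_errorBound [DecidableEq S] [MeasurableSpace S] [DiscreteMeasurableSpace S]
    {μ : S → ℝ} {C β : ℝ} {θs : EuclideanSpace ℝ (Fin d)} {Pr : Measure Ω}
    [IsProbabilityMeasure Pr] {s sHat : ℕ → Ω → S} {θ₀ : Ω → EuclideanSpace ℝ (Fin d)}
    {a ξ c₀ : ℝ} (hη : 0 < M.eta μ) (hμ : IsStationaryDist M.P μ) (hmix : IsMixing M.P μ C β)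
    (hθs : M.IsFixedPoint μ θs) (h : IsDoubleChain M.P Pr s sHat θ₀) (ha : 0 < a) (hξ0 : 0 < ξ)
    (hξ : ξ ≤ 1) (hc : minOffset a ξ (M.eta μ) C β ≤ c₀) (hm : ξ = 1 → 1 ≤ a * M.eta μ)
    (T : ℕ) :
    MeanSquareLE Pr (fun ω => M.iterate (stepsize a c₀ ξ) s sHat θ₀ T ω - θs)
      (errorBound a ξ c₀ (M.eta μ) (L1 C β)
        (2 * (∫ ω, ‖θ₀ ω - θs‖ ^ 2 ∂Pr) + (M.rmax + 3 * ‖θs‖) ^ 2 / 4)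
        ((M.rmax + 3 * ‖θs‖) ^ 2) T) := by
  rcases hξ.lt_or_eq with hξ | rfl
  · rw [errorBound, if_neg hξ.ne]
    exact meanSquareLE_of_lt_one hη hμ hmix hθs h ha hξ0 hξ hc T
  · rw [errorBound, if_pos rfl]
    exact meanSquareLE_of_one_le_mul hη hμ hmix hθs h ha hc (hm rfl) T

end MeanSquareErrorBound

end PolicyEvaluation

end AvgRewardTD

open AvgRewardTD.PolicyEvaluation in
theorem theorem3_general :
    (∀ (S : Type u) (A : Type v) [Fintype S] [DecidableEq S] [Nonempty S] [Fintype A] (d : ℕ)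
        (M : PolicyEvaluation S A d), 0 < d → M.P.IsIrreducible → IsAperiodic M.P →
      (∃! μ : S → ℝ, IsStationaryDist M.P μ) ∧
      ∀ μ : S → ℝ, IsStationaryDist M.P μ →
        (∀ s, 0 < μ s) ∧ 0 < M.eta μ ∧ (∃ C β : ℝ, IsMixing M.P μ C β) ∧
        ∃! θs : EuclideanSpace ℝ (Fin d), M.IsFixedPoint μ θs) ∧
    ∃ K₀ : ℝ, 0 < K₀ ∧ ∃ cMin : ℝ → ℝ → ℝ → ℝ → ℝ → ℝ,
      (∀ a ξ η C β : ℝ, 0 < cMin a ξ η C β) ∧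
      (∀ (S : Type u) (A : Type v) [Fintype S] [DecidableEq S] [Fintype A]
          [MeasurableSpace S] [DiscreteMeasurableSpace S] (d : ℕ) (M : PolicyEvaluation S A d)
          (μ : S → ℝ) (C β : ℝ) (θs : EuclideanSpace ℝ (Fin d))
          (Ω : Type w) [MeasurableSpace Ω] (Pr : Measure Ω) [IsProbabilityMeasure Pr]
          (s sHat : ℕ → Ω → S) (θ₀ : Ω → EuclideanSpace ℝ (Fin d)) (a ξ c₀ : ℝ) (T n : ℕ),
        IsStationaryDist M.P μ → 0 < M.eta μ → IsMixing M.P μ C β → M.IsFixedPoint μ θs →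
        IsDoubleChain M.P Pr s sHat θ₀ → 0 < a → 0 < ξ → cMin a ξ (M.eta μ) C β ≤ c₀ →
        (ξ = 1 →
          MeanSquareLE Pr (fun ω => M.iterate (stepsize a c₀ ξ) s sHat θ₀ T ω - θs)
            (beta1 Pr θ₀ M.rmax θs * (((n : ℝ) + c₀) / ((T : ℝ) + c₀)) ^ (a * M.eta μ) +
              Gam a c₀ (M.eta μ) (L1 C β) (beta2 M.rmax θs) T /
                ((T : ℝ) + c₀) ^ (min 1 (a * M.eta μ)))) ∧
        (ξ < 1 →
          MeanSquareLE Pr (fun ω => M.iterate (stepsize a c₀ ξ) s sHat θ₀ T ω - θs)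
            (beta1 Pr θ₀ M.rmax θs *
                Real.exp (-(M.eta μ * a / (1 - ξ)) * (((T : ℝ) + c₀) ^ (1 - ξ) -
                  ((n : ℝ) + c₀) ^ (1 - ξ))) +
              2 * a * betaTilde a c₀ (L1 C β) (beta2 M.rmax θs) T /
                (M.eta μ * ((T : ℝ) + c₀) ^ ξ)) ∧
          MeanSquareLE Pr (fun ω => M.iterate (stepsize a c₀ ξ) s sHat θ₀ T ω - θs)
            (beta1 Pr θ₀ M.rmax θs *
                Real.exp (-(M.eta μ * a / (1 - ξ)) * (((T : ℝ) + c₀) ^ (1 - ξ) -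
                  ((n : ℝ) + c₀) ^ (1 - ξ))) +
              K₀ * L1 C β * (M.rmax + 3 * ‖θs‖) ^ 2 * (a / (M.eta μ * ((T : ℝ) + c₀) ^ ξ))))) ∧
      (∀ ξ κ₁ κ₂ : ℝ, 0 < ξ → ξ ≤ 1 → 0 < κ₁ → κ₁ ≤ κ₂ → (ξ = 1 → 1 ≤ κ₁) →
        ∃ K p : ℝ, 0 < K ∧ 0 < p ∧
        ∀ a η C β : ℝ, 0 < η → κ₁ / η ≤ a → a ≤ κ₂ / η → 1 < C → 0 ≤ β → β < 1 →
        ∃ c₀ : ℝ, cMin a ξ η C β ≤ c₀ ∧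
        ∀ (S : Type u) (A : Type v) [Fintype S] [DecidableEq S] [Fintype A]
          [MeasurableSpace S] [DiscreteMeasurableSpace S] (d : ℕ) (M : PolicyEvaluation S A d)
          (μ : S → ℝ) (θs : EuclideanSpace ℝ (Fin d))
          (Ω : Type w) [MeasurableSpace Ω] (Pr : Measure Ω) [IsProbabilityMeasure Pr]
          (s sHat : ℕ → Ω → S) (θ₀ : Ω → EuclideanSpace ℝ (Fin d)) (ε : ℝ) (T : ℕ),
        IsStationaryDist M.P μ → IsMixing M.P μ C β → M.IsFixedPoint μ θs →
        IsDoubleChain M.P Pr s sHat θ₀ → M.eta μ = η → 0 < ε → ε < 1 →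
        sampleBound K p ξ η (L1 C β)
          (√(∫ ω, ‖θ₀ ω - θs‖ ^ 2 ∂Pr) + M.rmax + ‖θs‖) ε ≤ T →
        tauMix C β (stepsize a c₀ ξ T) ≤ T ∧
        MeanSquareLE Pr (fun ω => M.iterate (stepsize a c₀ ξ) s sHat θ₀ T ω - θs) ε) := by
  refine ⟨?_, 2240, by norm_num, minOffset, minOffset_pos, ?_, ?_⟩
  · intro S A _ _ _ _ d M hd hirr hap
    have hP := M.P_mem_rowStochastic
    have hprim := hap.isPrimitive hirr
    obtain ⟨μ₀, hμ₀⟩ := exists_isStationaryDist hP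
    refine ⟨⟨μ₀, hμ₀, fun ν hν => hν.eq hP hprim hμ₀⟩, fun μ hμ => ?_⟩
    have hη : 0 < M.eta μ := eta_pos hd hμ (hμ.pos hprim) hirr
    exact ⟨hμ.pos hprim, hη, exists_isMixing hP hprim hμ, existsUnique_isFixedPoint hμ hη⟩
  · intro S A _ _ _ _ _ d M μ C β θs Ω _ Pr _ s sHat θ₀ a ξ c₀ T n hμ hη hmix hθs h ha hξ0 hc
    refine ⟨?_, fun hξ =>
      ⟨meanSquareLE_log_error_bound_of_lt_one hη hμ hmix hθs h ha hξ0 hξ hc T n,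
        meanSquareLE_error_bound_of_lt_one hη hμ hmix hθs h ha hξ0 hξ hc T n⟩⟩
    rintro rfl
    exact meanSquareLE_error_bound_of_eq_one hη hμ hmix hθs h ha hc T n
  · intro ξ κ₁ κ₂ hξ0 hξ hκ₁ hκ hκ'
    obtain ⟨K, hK, hbound⟩ := exists_sampleBound hξ0 hξ hκ₁ hκ hκ'
    refine ⟨K, 3 / ξ, hK, by positivity, fun a η C β hη ha₁ ha₂ hC hβ0 hβ1 =>
      ⟨minOffset a ξ η C β, le_rfl, ?_⟩⟩
    intro S A _ _ _ _ _ d M μ θs Ω _ Pr _ s sHat θ₀ ε T hμ hmix hθs h hM hε hε1 hT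
    subst hM
    have hρ := M.rmax_nonneg
    have ha₁' := (div_le_iff₀ hη).1 ha₁
    obtain ⟨hτ, hle⟩ := hbound a _ C β ε _ _ _ T hη (eta_le_two (dim_pos_of_eta_pos hη) hμ) ha₁'
      ((le_div_iff₀ hη).1 ha₂) hC hβ0 hβ1 hε hε1.le (by positivity) (M.initialError_le Pr θ₀ θs)
      (M.sq_scale_le Pr θ₀ θs) hT
    exact ⟨hτ, (meanSquareLE_errorBound hη hμ hmix hθs h ((div_pos hκ₁ hη).trans_le ha₁) hξ0 hξ
      le_rfl (fun hξ1 => (hκ' hξ1).trans ha₁') T).mono hle⟩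

theorem theorem3 :
    -- the stationary distribution, the mixing constants, `η > 0` and `θ*` exist
    (∀ (S : Type u) (A : Type v) [Fintype S] [DecidableEq S] [Nonempty S] [Fintype A] (d : ℕ)
        (M : PolicyEvaluation S A d), 0 < d → M.P.IsIrreducible → IsAperiodic M.P →
      (∃! μ : S → ℝ, IsStationaryDist M.P μ) ∧
      ∀ μ : S → ℝ, IsStationaryDist M.P μ →
        (∀ s, 0 < μ s) ∧ 0 < M.eta μ ∧ (∃ C β : ℝ, IsMixing M.P μ C β) ∧
        ∃! θs : EuclideanSpace ℝ (Fin d), M.IsFixedPoint μ θs) ∧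
    -- `K₀` is an absolute constant, and `c₀ ≥ cMin a ξ η C β` is what large `c₀` means
    ∃ K₀ : ℝ, 0 < K₀ ∧ ∃ cMin : ℝ → ℝ → ℝ → ℝ → ℝ → ℝ,
      (∀ a ξ η C β : ℝ, 0 < cMin a ξ η C β) ∧
      -- the error bounds
      (∀ (S : Type u) (A : Type v) [Fintype S] [DecidableEq S] [Nonempty S] [Fintype A]
          [MeasurableSpace S] [DiscreteMeasurableSpace S] (d : ℕ) (M : PolicyEvaluation S A d)
          (μ : S → ℝ) (C β : ℝ) (θs : EuclideanSpace ℝ (Fin d))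
          (Ω : Type w) [MeasurableSpace Ω] (Pr : Measure Ω) [IsProbabilityMeasure Pr]
          (s sHat : ℕ → Ω → S) (θ₀ : Ω → EuclideanSpace ℝ (Fin d)) (a ξ c₀ : ℝ) (T : ℕ),
        0 < d → M.P.IsIrreducible → IsAperiodic M.P → IsStationaryDist M.P μ →
        IsMixing M.P μ C β → M.IsFixedPoint μ θs → IsDoubleChain M.P Pr s sHat θ₀ →
        0 < a → 0 < ξ → ξ ≤ 1 → cMin a ξ (M.eta μ) C β ≤ c₀ →
        tauMix C β (stepsize a c₀ ξ T) ≤ T →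
        (ξ = 1 →
          MeanSquareLE Pr (fun ω => M.iterate (stepsize a c₀ ξ) s sHat θ₀ T ω - θs)
            (beta1 Pr θ₀ M.rmax θs *
                (((tauMix C β (stepsize a c₀ ξ T) : ℝ) + c₀) / ((T : ℝ) + c₀)) ^ (a * M.eta μ) +
              Gam a c₀ (M.eta μ) (L1 C β) (beta2 M.rmax θs) T /
                ((T : ℝ) + c₀) ^ (min 1 (a * M.eta μ)))) ∧
        (ξ < 1 →
          MeanSquareLE Pr (fun ω => M.iterate (stepsize a c₀ ξ) s sHat θ₀ T ω - θs)
            (beta1 Pr θ₀ M.rmax θs *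
                Real.exp (-(M.eta μ * a / (1 - ξ)) * (((T : ℝ) + c₀) ^ (1 - ξ) -
                  ((tauMix C β (stepsize a c₀ ξ T) : ℝ) + c₀) ^ (1 - ξ))) +
              2 * a * betaTilde a c₀ (L1 C β) (beta2 M.rmax θs) T /
                (M.eta μ * ((T : ℝ) + c₀) ^ ξ)) ∧
          MeanSquareLE Pr (fun ω => M.iterate (stepsize a c₀ ξ) s sHat θ₀ T ω - θs)
            (beta1 Pr θ₀ M.rmax θs *
                Real.exp (-(M.eta μ * a / (1 - ξ)) * (((T : ℝ) + c₀) ^ (1 - ξ) -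
                  ((tauMix C β (stepsize a c₀ ξ T) : ℝ) + c₀) ^ (1 - ξ))) +
              K₀ * L1 C β * (M.rmax + 3 * ‖θs‖) ^ 2 * (a / (M.eta μ * ((T : ℝ) + c₀) ^ ξ))))) ∧
      -- the sample complexity for `a = Θ(1/η)`
      (∀ ξ κ₁ κ₂ : ℝ, 0 < ξ → ξ ≤ 1 → 0 < κ₁ → κ₁ ≤ κ₂ → (ξ = 1 → 1 ≤ κ₁) →
        ∃ K p : ℝ, 0 < K ∧ 0 < p ∧
        ∀ a η C β : ℝ, 0 < η → κ₁ / η ≤ a → a ≤ κ₂ / η → 1 < C → 0 ≤ β → β < 1 →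
        ∃ c₀ : ℝ, cMin a ξ η C β ≤ c₀ ∧
        ∀ (S : Type u) (A : Type v) [Fintype S] [DecidableEq S] [Nonempty S] [Fintype A]
          [MeasurableSpace S] [DiscreteMeasurableSpace S] (d : ℕ) (M : PolicyEvaluation S A d)
          (μ : S → ℝ) (θs : EuclideanSpace ℝ (Fin d))
          (Ω : Type w) [MeasurableSpace Ω] (Pr : Measure Ω) [IsProbabilityMeasure Pr]
          (s sHat : ℕ → Ω → S) (θ₀ : Ω → EuclideanSpace ℝ (Fin d)) (ε : ℝ) (T : ℕ),
        0 < d → M.P.IsIrreducible → IsAperiodic M.P → IsStationaryDist M.P μ →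
        IsMixing M.P μ C β → M.IsFixedPoint μ θs → IsDoubleChain M.P Pr s sHat θ₀ →
        M.eta μ = η → 0 < ε → ε < 1 →
        sampleBound K p ξ η (L1 C β)
          (√(∫ ω, ‖θ₀ ω - θs‖ ^ 2 ∂Pr) + M.rmax + ‖θs‖) ε ≤ T →
        tauMix C β (stepsize a c₀ ξ T) ≤ T ∧
        MeanSquareLE Pr (fun ω => M.iterate (stepsize a c₀ ξ) s sHat θ₀ T ω - θs) ε) := by
  obtain ⟨hex, K₀, hK₀, cMin, hcMin, hbound, hsample⟩ := theorem3_general.{u, v, w}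
  refine ⟨hex, K₀, hK₀, cMin, hcMin, ?_, ?_⟩
  · intro S A _ _ _ _ _ _ d M μ C β θs Ω _ Pr _ s sHat θ₀ a ξ c₀ T hd hirr hap hμ hmix hθs h
      ha hξ0 _ hc _
    exact hbound S A d M μ C β θs Ω Pr s sHat θ₀ a ξ c₀ T _ hμ
      ((hex S A d M hd hirr hap).2 μ hμ).2.1 hmix hθs h ha hξ0 hc
  · intro ξ κ₁ κ₂ hξ0 hξ hκ₁ hκ hκ'
    obtain ⟨K, p, hK, hp, hT⟩ := hsample ξ κ₁ κ₂ hξ0 hξ hκ₁ hκ hκ'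
    refine ⟨K, p, hK, hp, fun a η C β hη ha₁ ha₂ hC hβ0 hβ1 => ?_⟩
    obtain ⟨c₀, hc, hc₀⟩ := hT a η C β hη ha₁ ha₂ hC hβ0 hβ1
    exact ⟨c₀, hc, fun S A _ _ _ _ _ _ d M μ θs Ω _ Pr _ s sHat θ₀ ε T _ _ _ =>
      hc₀ S A d M μ θs Ω Pr s sHat θ₀ ε T⟩
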